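/- Consider the Ising model on $\mathbb Z^2$ with Hamiltonian $-\sum_{\{x,y\}} S_xS_y$ (sum over nearest neighbour pairs, no external field), let $\beta_c$ be its critical inverse temperature, i.e. the threshold above which the infinite-volume Gibbs distribution is not unique, and let $p_c=1-e^{-2\beta_c}$. Let $P$ be the infinite-volume critical FK (random cluster) measure on bond configurations of $\mathbb Z^2$, with cluster weight $q=2$ and bond parameter $p_c$, obtained as the limit over boxes $[-n,n]^2$ with free or wired boundary conditions. Let $\|\cdot\|$ be the Euclidean norm, $B(r)=\{y\in\mathbb Z^2:\|y\|\le r\}$, and let $\partial B(r)$ be the set of sites of $B(r)$ that have a nearest neighbour outside $B(r)$. Let $P^W_{\partial B(r)}$ be the critical FK measure inside $B(r)$ with wired boundary condition on $\partial B(r)$, and let $0\leftrightarrow\partial B(r)$ be the event that the origin is connected to $\partial B(r)$ by a path of open bonds. For $a>0$, $x\in\mathbb R^2$ and $0<r_1<r_2$, let $p^a(x;r_1,r_2)$ be the $P$-probability that, on the rescaled lattice $a\mathbb Z^2$, there is a circuit of open bonds contained in the annulus $\{z\in\mathbb R^2: r_1\le\|z-x\|\le r_2\}$ and surrounding $x$.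 Assume that for every $x\in\mathbb R^2$ there are $0<r_1<r_2<\infty$ with $\liminf_{a\downarrow0}p^a(x;r_1,r_2)>0$. Then $P(0\leftrightarrow\partial B(\|x-y\|/3))$ and $P^W_{\partial B(\|x-y\|/3)}(0\leftrightarrow\partial B(\|x-y\|/3))$ are comparable up to constants as $\|x-y\|\to\infty$: there are constants $0<c\le C<\infty$ and $R<\infty$ such that for all $x,y\in\mathbb Z^2$ with $\|x-y\|\ge R$, writing $r=\|x-y\|/3$, $$c\,P^W_{\partial B(r)}(0\leftrightarrow\partial B(r))\;\le\;P(0\leftrightarrow\partial B(r))\;\le\;C\,P^W_{\partial B(r)}(0\leftrightarrow\partial B(r)).$$ -/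

import Mathlib

open Filter Topology MeasureTheory
open scoped ENNReal

noncomputable section

namespace IsingFK

/-! ### The square lattice -/

/-- Sites of `ℤ²`. -/
abbrev Site := ℤ × ℤ

/-- The Euclidean plane `ℝ²`. -/
abbrev Plane := EuclideanSpace ℝ (Fin 2)

/-- The inclusion `ℤ² ⊂ ℝ²`. -/
def toPlane (x : Site) : Plane := !₂[(x.1 : ℝ), (x.2 : ℝ)]

/-- The Euclidean distance `‖x - y‖` of two sites. -/
def edist2 (x y : Site) : ℝ := ‖toPlane x - toPlane y‖

/-- The nearest neighbour graph of `ℤ²`. -/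
def squareLattice : SimpleGraph Site where
  Adj x y := |x.1 - y.1| + |x.2 - y.2| = 1
  symm := ⟨fun x y h => by rw [abs_sub_comm y.1, abs_sub_comm y.2]; exact h⟩
  loopless := ⟨fun x h => by simp at h⟩

/-- Bonds (nearest neighbour pairs) of `ℤ²`. -/
abbrev Bond := squareLattice.edgeSet

/-- The `ℤ²`-boundary of a finite set of sites: its sites having a neighbour outside. -/
def boundary (V : Finset Site) : Finset Site := by
  classical exact V.filter fun x => ∃ y, y ∉ V ∧ squareLattice.Adj x y

/-- The lattice disc `B(r) = {y ∈ ℤ² : ‖y‖ ≤ r}`; see `mem_disc`. -/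
def disc (r : ℝ) : Finset Site := by
  classical exact (Finset.Icc ((-⌈r⌉, -⌈r⌉) : Site) (⌈r⌉, ⌈r⌉)).filter fun y => edist2 y 0 ≤ r

theorem mem_disc {r : ℝ} {y : Site} : y ∈ disc r ↔ edist2 y 0 ≤ r := by
  have key : ∀ t s : ℝ, √(t ^ 2 + s ^ 2) ≤ r → |t| ≤ r ∧ |s| ≤ r := fun t s h =>
    ⟨(Real.abs_le_sqrt (by nlinarith [sq_nonneg s])).trans h,
      (Real.abs_le_sqrt (by nlinarith [sq_nonneg t])).trans h⟩
  simp only [disc, Finset.mem_filter, Finset.mem_Icc, and_iff_right_iff_imp]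
  intro h
  have h2 : √((y.1 : ℝ) ^ 2 + (y.2 : ℝ) ^ 2) ≤ r := by
    simpa [edist2, toPlane, EuclideanSpace.norm_eq] using h
  obtain ⟨h3, h4⟩ := key _ _ h2
  have h5 := Int.le_ceil r
  rw [abs_le] at h3 h4
  refine ⟨⟨?_, ?_⟩, ⟨?_, ?_⟩⟩
  · exact_mod_cast (by push_cast; linarith : ((-⌈r⌉ : ℤ) : ℝ) ≤ (y.1 : ℝ))
  · exact_mod_cast (by push_cast; linarith : ((-⌈r⌉ : ℤ) : ℝ) ≤ (y.2 : ℝ))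
  · exact_mod_cast (by linarith : (y.1 : ℝ) ≤ (⌈r⌉ : ℝ))
  · exact_mod_cast (by linarith : (y.2 : ℝ) ≤ (⌈r⌉ : ℝ))

/-- The lattice box `[-n, n]² ∩ ℤ²`. -/
def box (n : ℕ) : Finset Site := Finset.Icc ((-(n : ℤ), -(n : ℤ)) : Site) ((n : ℤ), (n : ℤ))

/-! ### The Ising model at zero external field and its critical inverse temperature -/

/-- The `±1`-value of a spin. -/
def spin (b : Bool) : ℝ := if b then 1 else -1

/-- The product `S_x S_y` over a bond `{x, y}`. -/
def spinProd (σ : Site → Bool) : Sym2 Site → ℝ :=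
  Sym2.lift ⟨fun x y => spin (σ x) * spin (σ y), fun _ _ => mul_comm _ _⟩

/-- The bonds having at least one end point in `Λ`. -/
def bondsTouching (Λ : Finset Site) : Finset (Sym2 Site) := by
  classical exact Λ.biUnion fun x =>
    {s(x, x + (1, 0)), s(x, x - (1, 0)), s(x, x + (0, 1)), s(x, x - (0, 1))}

/-- The energy `- ∑ S_x S_y` over the bonds touching `Λ` (no external field). -/
def energy (Λ : Finset Site) (σ : Site → Bool) : ℝ := -∑ e ∈ bondsTouching Λ, spinProd σ e

/-- The spin configuration equal to `σ` off `Λ`, and with plus spins in `Λ` exactly at `S`. -/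
def resample (Λ S : Finset Site) (σ : Site → Bool) : Site → Bool := by
  classical exact fun x => if x ∈ Λ then decide (x ∈ S) else σ x

/-- The Boltzmann weight `exp (-β H_Λ)` of a spin configuration. -/
def boltzmann (β : ℝ) (Λ : Finset Site) (σ : Site → Bool) : ℝ≥0∞ :=
  ENNReal.ofReal (Real.exp (-β * energy Λ σ))

/-- The Gibbs probability of `A` in `Λ` with boundary condition `σ` outside `Λ`. -/
def gibbsKernel (β : ℝ) (Λ : Finset Site) (σ : Site → Bool) (A : Set (Site → Bool)) : ℝ≥0∞ :=
  (∑ S ∈ Λ.powerset,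
      boltzmann β Λ (resample Λ S σ) * A.indicator (fun _ => 1) (resample Λ S σ)) /
    ∑ S ∈ Λ.powerset, boltzmann β Λ (resample Λ S σ)

/-- Infinite-volume Gibbs distributions (DLR equations) at inverse temperature `β`, field `0`. -/
def IsGibbs (β : ℝ) (μ : Measure (Site → Bool)) : Prop :=
  IsProbabilityMeasure μ ∧ ∀ (Λ : Finset Site) (A : Set (Site → Bool)), MeasurableSet A →
    ∫⁻ σ, gibbsKernel β Λ σ A ∂μ = μ A

/-- The critical inverse temperature: the threshold for nonuniqueness of the Gibbs distribution. -/
def betaC : ℝ := sInf {β : ℝ | 0 ≤ β ∧ ∃ μ ν, IsGibbs β μ ∧ IsGibbs β ν ∧ μ ≠ ν}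

/-- The bond parameter `p = 1 - exp (-2 β)` of the FK representation, at the critical point. -/
def pC : ℝ := 1 - Real.exp (-2 * betaC)

/-! ### FK bond configurations and finite-volume FK measures -/

/-- FK bond configurations (`true` is open). -/
abbrev Config := Bond → Bool

/-- The graph on `ℤ²` of the open bonds. Its connected components are the FK clusters. -/
def openGraph (ω : Config) : SimpleGraph Site where
  Adj x y := ∃ h : squareLattice.Adj x y, ω ⟨s(x, y), h⟩ = true
  symm := ⟨fun x y ⟨h, hω⟩ => ⟨h.symm, by
    have : (⟨s(y, x), h.symm⟩ : Bond) = ⟨s(x, y), h⟩ := Subtype.ext Sym2.eq_swap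
    rw [this]; exact hω⟩⟩
  loopless := ⟨fun x ⟨h, _⟩ => squareLattice.loopless.irrefl x h⟩

/-- The complete graph on `W`: all sites of `W` are declared connected. -/
def wiring (W : Finset Site) : SimpleGraph Site where
  Adj x y := x ≠ y ∧ x ∈ W ∧ y ∈ W
  symm := ⟨fun _ _ h => ⟨h.1.symm, h.2.2, h.2.1⟩⟩
  loopless := ⟨fun _ h => h.1 rfl⟩

/-- The bonds with both end points in `V`. -/
def bondsIn (V : Finset Site) : Finset (Sym2 Site) := by
  classical exact V.sym2.filter fun e => e ∈ squareLattice.edgeSet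

/-- The configuration whose open bonds are those in `S`. -/
def configOf (S : Finset (Sym2 Site)) : Config := by
  classical exact fun e => decide ((e : Sym2 Site) ∈ S)

/-- The number of clusters in `V` when all sites of `W` are counted as connected. -/
def numClusters (V W : Finset Site) (ω : Config) : ℕ :=
  Nat.card ((openGraph ω ⊔ wiring W).induce (V : Set Site)).ConnectedComponent

/-- The FK weight (`q = 2`) `p^{#open} (1-p)^{#closed} 2^{#clusters}`. -/
def fkWeight (p : ℝ) (V W : Finset Site) (S : Finset (Sym2 Site)) : ℝ≥0∞ :=
  ENNReal.ofReal p ^ S.card * ENNReal.ofReal (1 - p) ^ ((bondsIn V).card - S.card) *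
    2 ^ numClusters V W (configOf S)

/-- The FK measure (`q = 2`) on the bonds inside `V`, with the sites of `W` wired together
(bonds not inside `V` are closed). -/
def fkMeasure (p : ℝ) (V W : Finset Site) : Measure Config :=
  (∑ S ∈ (bondsIn V).powerset, fkWeight p V W S)⁻¹ •
    ∑ S ∈ (bondsIn V).powerset, fkWeight p V W S • Measure.dirac (configOf S)

/-- `P^W_{∂B(r)}`: the critical FK measure inside `B(r)`, wired on `∂B(r)`. -/
def wiredDisc (r : ℝ) : Measure Config := fkMeasure pC (disc r) (boundary (disc r))

/-! ### Infinite volume -/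

/-- `P` is the limit of the measures `μ n`: all finite-dimensional distributions converge. -/
def IsLocalLimit (μ : ℕ → Measure Config) (P : Measure Config) : Prop :=
  ∀ (F : Finset Bond) (η : Config),
    Tendsto (fun n => μ n {ω | ∀ e ∈ F, ω e = η e}) atTop (𝓝 (P {ω | ∀ e ∈ F, ω e = η e}))

/-- `P` is the infinite-volume critical FK measure: the limit over the boxes `[-n, n]²` of the
critical FK measures, with free or with wired boundary conditions. -/
def IsCriticalFK (P : Measure Config) : Prop :=
  IsProbabilityMeasure P ∧
    (IsLocalLimit (fun n => fkMeasure pC (box n) ∅) P ∨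
      IsLocalLimit (fun n => fkMeasure pC (box n) (boundary (box n))) P)

/-! ### Events -/

/-- The one-arm event `0 ↔ ∂B(r)`. -/
def oneArm (r : ℝ) : Set Config := {ω | ∃ y ∈ boundary (disc r), (openGraph ω).Reachable 0 y}

/-- The curve in the plane traced on `a ℤ²` by a lattice path. -/
def trace (a : ℝ) {G : SimpleGraph Site} {u v : Site} (c : G.Walk u v) : Set Plane :=
  {z | ∃ d ∈ c.darts, z ∈ segment ℝ (a • toPlane d.fst) (a • toPlane d.snd)}

/-- There is an open FK circuit of `a ℤ²` in the `(r₁, r₂)`-annulus centered at `x`: a cycle of open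
bonds whose trace lies in the annulus and has `x` in a bounded component of its complement. -/
def openCircuit (a : ℝ) (x : Plane) (r₁ r₂ : ℝ) : Set Config :=
  {ω | ∃ (v : Site) (c : (openGraph ω).Walk v v), c.IsCycle ∧
    trace a c ⊆ {z | r₁ ≤ dist z x ∧ dist z x ≤ r₂} ∧
    Bornology.IsBounded (connectedComponentIn (trace a c)ᶜ x)}

/-- The RSW lower bound for open circuits. -/
def RSW (P : Measure Config) : Prop :=
  ∀ x : Plane, ∃ r₁ r₂ : ℝ, 0 < r₁ ∧ r₁ < r₂ ∧
    0 < liminf (fun a : ℝ => P (openCircuit a x r₁ r₂)) (𝓝[>] 0)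

end IsingFK

end

/-! The upper bound holds with constant one: the one-arm event is increasing and local, and wiring
the boundary of the disc dominates every boundary condition that the outside can induce
(`IsCriticalFK.le_wired`).

For the lower bound, the hypothesis gives, with probability at least some `c > 0` at every large
scale, an open circuit in the annulus of radii `ρ` and `κρ = r/4` (`RSW.exists_scale`). Explore the
dual faces reachable from outside a box through closed bonds. An open circuit stops this
exploration, all bonds where it stops are open, and they lie in one cluster (`cutSites_reachable`).
Given the exploration, the unexplored bonds therefore carry an FK measure wired on the cut sites.
This domain lies inside the disc, so by monotonicity `0` reaches the cut sites at least as likely as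
it reaches the boundary under the wired measure on the whole disc. The cut sites being beyond scale
`ρ/4`, the result is `P(0 ↔ ∂B(r/(16κ))) ≥ c P^W(0 ↔ ∂B(r))` (`IsCriticalFK.arm_ge_wired`).

It remains to pass from scale `r/(16κ)` to `r`. A number of circuits independent of `r`, one around
each site of a coarse square annulus, forces any arm that ends in the annulus to continue beyond `r`
(`exists_reachable_far`). Positive association makes the price a fixed power of `c`
(`IsCriticalFK.arm_extend`).

Two devices keep the argument elementary. Cluster counts are dimensions of spaces of functions, so
that supermodularity and independence across wired sites become linear algebra. Planar topology
enters through a mod 2 potential on faces and through bounded components of complements, without the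
Jordan curve theorem. -/

noncomputable section

namespace IsingFK

/-! ### Clusters and their supermodularity -/

/-- The number of connected components of `G` inside `V`. -/
def clusters (V : Finset Site) (G : SimpleGraph Site) : ℕ :=
  Nat.card (G.induce (V : Set Site)).ConnectedComponent

/-- The graph of the bonds of `S`. -/
def bondGraph (S : Finset (Sym2 Site)) : SimpleGraph Site := openGraph (configOf S)

theorem bondGraph_adj {S : Finset (Sym2 Site)} {x y : Site} :
    (bondGraph S).Adj x y ↔ squareLattice.Adj x y ∧ s(x, y) ∈ S := by
  simp [bondGraph, openGraph, configOf]

theorem bondGraph_union (S T : Finset (Sym2 Site)) :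
    bondGraph (S ∪ T) = bondGraph S ⊔ bondGraph T := by
  ext x y
  simp only [bondGraph_adj, SimpleGraph.sup_adj, Finset.mem_union]
  tauto

theorem bondGraph_mono {S T : Finset (Sym2 Site)} (h : S ⊆ T) : bondGraph S ≤ bondGraph T := by
  intro x y
  simp only [bondGraph_adj]
  exact fun ⟨h1, h2⟩ => ⟨h1, h h2⟩

/-- The functions on `V` that are constant along the edges of `G`. -/
def edgeConst (V : Finset Site) (G : SimpleGraph Site) :
    Submodule ℝ (↥(V : Set Site) → ℝ) where
  carrier := {x | ∀ i j : (V : Set Site), G.Adj i j → x i = x j}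
  add_mem' := fun ha hb i j h => by simp [ha i j h, hb i j h]
  zero_mem' := fun _ _ _ => rfl
  smul_mem' := fun c x hx i j h => by simp [hx i j h]

theorem mem_edgeConst {V : Finset Site} {G : SimpleGraph Site} {x : ↥(V : Set Site) → ℝ} :
    x ∈ edgeConst V G ↔ ∀ i j : (V : Set Site), G.Adj i j → x i = x j := Iff.rfl

/-- The kernel of the graph Laplacian consists of the functions constant along edges, and its
dimension is the number of components. Joining graphs then means intersecting subspaces. -/
theorem clusters_eq_finrank (V : Finset Site) (G : SimpleGraph Site) :
    clusters V G = Module.finrank ℝ (edgeConst V G) := by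
  classical
  have h := (G.induce (V : Set Site)).card_connectedComponent_eq_finrank_ker_toLin'_lapMatrix
  rw [clusters, Nat.card_eq_fintype_card, h]
  suffices h' : LinearMap.ker (Matrix.toLin' ((G.induce (V : Set Site)).lapMatrix ℝ)) =
      edgeConst V G by rw [h']
  ext x
  rw [LinearMap.mem_ker, Matrix.toLin'_apply,
    SimpleGraph.lapMatrix_mulVec_eq_zero_iff_forall_adj, mem_edgeConst]
  rfl

theorem edgeConst_sup (V : Finset Site) (G H : SimpleGraph Site) :
    edgeConst V (G ⊔ H) = edgeConst V G ⊓ edgeConst V H := by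
  ext x
  simp only [Submodule.mem_inf, mem_edgeConst, SimpleGraph.sup_adj, or_imp, forall_and]

theorem edgeConst_anti (V : Finset Site) {G H : SimpleGraph Site} (h : G ≤ H) :
    edgeConst V H ≤ edgeConst V G := fun _ hx i j hij => hx i j (h hij)

theorem clusters_sup_eq_finrank (V : Finset Site) (G H : SimpleGraph Site) :
    clusters V (G ⊔ H) = Module.finrank ℝ ↥(edgeConst V G ⊓ edgeConst V H) := by
  rw [clusters_eq_finrank, edgeConst_sup]

/-- The dimension formula `dim (A + B) + dim (A ∩ B) = dim A + dim B`, together with `A + B` being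
contained in the space attached to the smaller graph `L`. -/
theorem clusters_supermodular (V : Finset Site) {G H L : SimpleGraph Site} (hG : L ≤ G)
    (hH : L ≤ H) : clusters V G + clusters V H ≤ clusters V L + clusters V (G ⊔ H) := by
  rw [clusters_sup_eq_finrank, clusters_eq_finrank V G, clusters_eq_finrank V H,
    clusters_eq_finrank V L, ← Submodule.finrank_sup_add_finrank_inf_eq]
  gcongr
  exact Submodule.finrank_mono (sup_le (edgeConst_anti V hG) (edgeConst_anti V hH))

/-- Two graphs which only share vertices that are wired together are independent. -/
theorem clusters_decouple (V W : Finset Site) {G H : SimpleGraph Site} (A B : Set Site)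
    (hG : ∀ x y, G.Adj x y → x ∈ A ∧ y ∈ A) (hH : ∀ x y, H.Adj x y → x ∈ B ∧ y ∈ B)
    (hAB : A ∩ B ⊆ W) (hWG : wiring W ≤ G) (hWH : wiring W ≤ H) :
    clusters V (G ⊔ H) + clusters V (wiring W) = clusters V G + clusters V H := by
  classical
  rw [clusters_sup_eq_finrank, clusters_eq_finrank V G, clusters_eq_finrank V H,
    clusters_eq_finrank V (wiring W),
    ← Submodule.finrank_sup_add_finrank_inf_eq (edgeConst V G) (edgeConst V H), add_comm]
  suffices h : edgeConst V (wiring W) = edgeConst V G ⊔ edgeConst V H by rw [h]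
  refine le_antisymm ?_ (sup_le (edgeConst_anti V hWG) (edgeConst_anti V hWH))
  intro x hx
  -- The common value of `x` on the wired sites; the value 0 is arbitrary when no wired site lies in
  -- `V`.
  obtain ⟨c, hc⟩ : ∃ c : ℝ, ∀ i : (V : Set Site), (i : Site) ∈ W → x i = c := by
    by_cases h : ∃ i : (V : Set Site), (i : Site) ∈ W
    · obtain ⟨i, hi⟩ := h
      refine ⟨x i, fun j hj => ?_⟩
      by_cases hij : j = i
      · rw [hij]
      · exact hx j i ⟨fun h => hij (Subtype.ext h), hj, hi⟩
    · exact ⟨0, fun i hi => (h ⟨i, hi⟩).elim⟩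
  rw [Submodule.mem_sup]
  -- The first summand is constant on `A`, hence along the edges of `G`. The second vanishes on `B`,
  -- since `A ∩ B` is wired and `x` equals `c` there.
  refine ⟨fun i => if (i : Site) ∈ A then c else x i, ?_,
    fun i => if (i : Site) ∈ A then x i - c else 0, ?_, ?_⟩
  · intro i j hij
    simp [hG _ _ hij]
  · have h0 : ∀ i : (V : Set Site), (i : Site) ∈ B →
        (if (i : Site) ∈ A then x i - c else 0) = 0 := by
      intro i hi
      split_ifs with h
      · rw [hc i (hAB ⟨h, hi⟩), sub_self]
      · rfl
    intro i j hij
    show (if (i : Site) ∈ A then x i - c else 0) = (if (j : Site) ∈ A then x j - c else 0)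
    rw [h0 i (hH _ _ hij).1, h0 j (hH _ _ hij).2]
  · ext i
    by_cases h : (i : Site) ∈ A <;> simp [h]

/-- Wiring sites of `V` that are already connected inside `V` changes nothing. -/
theorem clusters_sup_wiring (V W : Finset Site) {G : SimpleGraph Site}
    (hV : ∀ x y, G.Adj x y → y ∈ V) (h : ∀ x ∈ W, ∀ y ∈ W, G.Reachable x y) :
    clusters V (G ⊔ wiring W) = clusters V G := by
  rw [clusters_eq_finrank, clusters_eq_finrank, edgeConst_sup, inf_eq_left.2]
  intro x hx i j hij
  have key : ∀ (u v : Site) (p : G.Walk u v) (hu : u ∈ V) (hv : v ∈ V),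
      x ⟨u, hu⟩ = x ⟨v, hv⟩ := by
    intro u v p
    induction p with
    | nil => intros; rfl
    | cons hadj q ih =>
      intro hu hv
      exact (hx ⟨_, hu⟩ ⟨_, hV _ _ hadj⟩ hadj).trans (ih _ _)
  obtain ⟨p⟩ := h i hij.2.1 j hij.2.2
  exact key _ _ p i.2 j.2

/-- Sites that no edge meets only add isolated clusters. -/
theorem clusters_extend {V V' : Finset Site} (h : V ⊆ V') {G : SimpleGraph Site}
    (hG : ∀ x y, G.Adj x y → x ∈ V ∧ y ∈ V) :
    clusters V' G = clusters V G + (V' \ V).card := by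
  classical
  rw [clusters_eq_finrank, clusters_eq_finrank, ← Fintype.card_coe (V' \ V),
    ← Module.finrank_pi ℝ (ι := ↥(V' \ V)), ← Module.finrank_prod]
  refine LinearEquiv.finrank_eq ?_
  exact
  { toFun := fun x => (⟨fun i => x.1 ⟨i.1, h i.2⟩, fun i j hij => x.2 ⟨i.1, h i.2⟩ ⟨j.1, h j.2⟩ hij⟩,
      fun i => x.1 ⟨i.1, (Finset.mem_sdiff.1 i.2).1⟩)
    map_add' := fun _ _ => rfl
    map_smul' := fun _ _ => rfl
    invFun := fun y => ⟨fun i => if hi : i.1 ∈ V then y.1.1 ⟨i.1, hi⟩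
        else y.2 ⟨i.1, Finset.mem_sdiff.2 ⟨i.2, hi⟩⟩, fun i j hij => by
          refine (dif_pos (hG _ _ hij).1).trans (Eq.trans ?_ (dif_pos (hG _ _ hij).2).symm)
          exact y.1.2 ⟨i.1, (hG _ _ hij).1⟩ ⟨j.1, (hG _ _ hij).2⟩ hij⟩
    left_inv := fun x => by
      ext i
      by_cases hi : i.1 ∈ V <;> simp [hi]
    right_inv := fun y => by
      refine Prod.ext (Subtype.ext (funext fun i => ?_)) (funext fun i => ?_)
      · have hi : i.1 ∈ V := i.2
        simp [hi]
      · have hi : i.1 ∉ V := (Finset.mem_sdiff.1 i.2).2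
        simp [hi] }

/-! ### FK weights on a finite set of bonds, with a background graph -/

/-- The FK weight of the open bonds `S` among `F`, connections through `G` being counted too. -/
def wt (p : ℝ) (V : Finset Site) (G : SimpleGraph Site) (F S : Finset (Sym2 Site)) : ℝ :=
  p ^ S.card * (1 - p) ^ (F.card - S.card) * 2 ^ clusters V (bondGraph S ⊔ G)

/-- The sum of `f` against the FK weights. -/
def total (p : ℝ) (V : Finset Site) (G : SimpleGraph Site) (F : Finset (Sym2 Site))
    (f : Finset (Sym2 Site) → ℝ) : ℝ := ∑ S ∈ F.powerset, wt p V G F S * f S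

section

variable {p : ℝ} {V : Finset Site} {F : Finset (Sym2 Site)}

theorem wt_nonneg (h0 : 0 ≤ p) (h1 : p < 1) (G : SimpleGraph Site) (S : Finset (Sym2 Site)) :
    0 ≤ wt p V G F S := by
  have : 0 ≤ 1 - p := by linarith
  unfold wt; positivity

theorem total_nonneg (h0 : 0 ≤ p) (h1 : p < 1) (G : SimpleGraph Site)
    {f : Finset (Sym2 Site) → ℝ} (hf : ∀ S, 0 ≤ f S) : 0 ≤ total p V G F f :=
  Finset.sum_nonneg fun S _ => mul_nonneg (wt_nonneg h0 h1 G S) (hf S)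

theorem total_one_pos (h0 : 0 ≤ p) (h1 : p < 1) (G : SimpleGraph Site) :
    0 < total p V G F (fun _ => 1) := by
  refine Finset.sum_pos' (fun S _ => mul_nonneg (wt_nonneg h0 h1 G S) zero_le_one)
    ⟨∅, by simp, ?_⟩
  have : 0 < 1 - p := by linarith
  simp only [wt, Finset.card_empty, pow_zero, one_mul, mul_one]
  positivity

/-- The numbers of open and closed bonds are modular in `(S, T)`, so the powers of `p` and `1 - p`
agree on both sides. Only the cluster exponent changes, and it is supermodular, the cluster weight 2
being at least 1. -/
theorem wt_lattice (h0 : 0 ≤ p) (h1 : p < 1) {G H : SimpleGraph Site} (hGH : G ≤ H)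
    {S T : Finset (Sym2 Site)} (hS : S ⊆ F) (hT : T ⊆ F) :
    wt p V G F S * wt p V H F T ≤ wt p V G F (S ∩ T) * wt p V H F (S ∪ T) := by
  have h1' : 0 ≤ 1 - p := by linarith
  have hc := Finset.card_union_add_card_inter S T
  have hS' := Finset.card_le_card hS
  have hT' := Finset.card_le_card hT
  have hU := Finset.card_le_card (Finset.union_subset hS hT)
  have hI := Finset.card_le_card (Finset.inter_subset_left (s₁ := S) (s₂ := T))
  have hk := clusters_supermodular V (G := bondGraph S ⊔ G) (H := bondGraph T ⊔ H)
    (L := bondGraph (S ∩ T) ⊔ G)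
    (sup_le_sup_right (bondGraph_mono Finset.inter_subset_left) _)
    (sup_le_sup (bondGraph_mono Finset.inter_subset_right) hGH)
  have hU' : bondGraph S ⊔ G ⊔ (bondGraph T ⊔ H) = bondGraph (S ∪ T) ⊔ H := by
    rw [bondGraph_union, sup_sup_sup_comm, sup_eq_right.2 hGH]
  rw [hU'] at hk
  have e1 : wt p V G F S * wt p V H F T = p ^ (S.card + T.card) *
      (1 - p) ^ (F.card - S.card + (F.card - T.card)) *
      2 ^ (clusters V (bondGraph S ⊔ G) + clusters V (bondGraph T ⊔ H)) := by
    simp only [wt, pow_add]; ring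
  have e2 : wt p V G F (S ∩ T) * wt p V H F (S ∪ T) = p ^ (S.card + T.card) *
      (1 - p) ^ (F.card - S.card + (F.card - T.card)) *
      2 ^ (clusters V (bondGraph (S ∩ T) ⊔ G) + clusters V (bondGraph (S ∪ T) ⊔ H)) := by
    rw [← hc, show F.card - S.card + (F.card - T.card) =
      F.card - (S ∩ T).card + (F.card - (S ∪ T).card) by omega]
    simp only [wt, pow_add]; ring
  rw [e1, e2]
  gcongr
  norm_num

/-- Positive association, jointly with monotonicity in the background graph. -/
theorem total_mul_le (h0 : 0 ≤ p) (h1 : p < 1) {G H : SimpleGraph Site} (hGH : G ≤ H)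
    {f g : Finset (Sym2 Site) → ℝ} (hf : Monotone f) (hg : Monotone g) (hf0 : ∀ S, 0 ≤ f S)
    (hg0 : ∀ S, 0 ≤ g S) :
    total p V G F f * total p V H F g ≤
      total p V G F (fun _ => 1) * total p V H F (fun S => f S * g S) := by
  -- The smaller background goes with the intersection, the larger one with the union, where both
  -- monotone functions take larger values.
  have h := Finset.four_functions_theorem (β := ℝ) F
    (f₁ := fun S => wt p V G F S * f S) (f₂ := fun S => wt p V H F S * g S)
    (f₃ := fun S => wt p V G F S * 1) (f₄ := fun S => wt p V H F S * (f S * g S))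
    (fun S => mul_nonneg (wt_nonneg h0 h1 G S) (hf0 S))
    (fun S => mul_nonneg (wt_nonneg h0 h1 H S) (hg0 S))
    (fun S => mul_nonneg (wt_nonneg h0 h1 G S) zero_le_one)
    (fun S => mul_nonneg (wt_nonneg h0 h1 H S) (mul_nonneg (hf0 S) (hg0 S)))
    (fun S hS T hT => by
      have hw := wt_lattice (V := V) h0 h1 hGH hS hT
      calc wt p V G F S * f S * (wt p V H F T * g T)
          = wt p V G F S * wt p V H F T * (f S * g T) := by ring
        _ ≤ wt p V G F (S ∩ T) * wt p V H F (S ∪ T) * (f (S ∪ T) * g (S ∪ T)) := by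
          refine mul_le_mul hw (mul_le_mul (hf Finset.subset_union_left)
            (hg Finset.subset_union_right) (hg0 _) (hf0 _)) (mul_nonneg (hf0 _) (hg0 _)) ?_
          exact mul_nonneg (wt_nonneg h0 h1 G _) (wt_nonneg h0 h1 H _)
        _ = _ := by ring)
    (Finset.Subset.refl F.powerset) (Finset.Subset.refl F.powerset)
  simpa only [Finset.powerset_infs_powerset_self, Finset.powerset_sups_powerset_self, total]
    using h

/-- Holley's comparison in cross-multiplied form: the mean of an increasing function grows with the
background. -/
theorem total_mono_background (h0 : 0 ≤ p) (h1 : p < 1) {G H : SimpleGraph Site} (hGH : G ≤ H)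
    {f : Finset (Sym2 Site) → ℝ} (hf : Monotone f) (hf0 : ∀ S, 0 ≤ f S) :
    total p V G F f * total p V H F (fun _ => 1) ≤
      total p V G F (fun _ => 1) * total p V H F f := by
  simpa using total_mul_le h0 h1 hGH hf (monotone_const (c := (1 : ℝ))) hf0
    (fun _ => zero_le_one)

/-- The weight factorizes when part of the bonds is fixed. -/
theorem wt_union {F' S T : Finset (Sym2 Site)} (G : SimpleGraph Site) (hF : F' ⊆ F)
    (hS : S ⊆ F') (hT : T ⊆ F \ F') :
    wt p V G F (T ∪ S) = p ^ T.card * (1 - p) ^ ((F \ F').card - T.card) *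
      wt p V (bondGraph T ⊔ G) F' S := by
  have hd : Disjoint T S :=
    Finset.disjoint_of_subset_left hT (Finset.disjoint_of_subset_right hS Finset.sdiff_disjoint)
  have h1 := Finset.card_sdiff_add_card_eq_card hF
  have h2 := Finset.card_le_card hS
  have h3 := Finset.card_le_card hT
  rw [wt, wt, Finset.card_union_of_disjoint hd, bondGraph_union, sup_comm (bondGraph T),
    sup_assoc, ← h1, show (F \ F').card + F'.card - (T.card + S.card) =
      ((F \ F').card - T.card) + (F'.card - S.card) by omega, pow_add, pow_add]
  ring

end

/-- Summation along an exploration: `L S` is the part of `S`'s surroundings left unexplored. -/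
theorem sum_nonneg_of_exploration {α : Type*} [DecidableEq α] {E : Finset (Finset α)}
    (L : Finset α → Finset α)
    (hL : ∀ S ∈ E, ∀ S' ⊆ L S, (S \ L S) ∪ S' ∈ E ∧ L ((S \ L S) ∪ S') = L S)
    (u : Finset α → ℝ)
    (hu : ∀ S ∈ E, 0 ≤ ∑ S' ∈ (L S).powerset, u ((S \ L S) ∪ S')) :
    0 ≤ ∑ S ∈ E, u S := by
  -- Group the configurations by their explored part `S \ L S`; each group consists of all ways of
  -- filling `L S`.
  rw [← Finset.sum_fiberwise_of_maps_to (g := fun S => S \ L S)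
    (t := E.image fun S => S \ L S) (fun S hS => Finset.mem_image_of_mem _ hS)]
  refine Finset.sum_nonneg fun T hT => ?_
  obtain ⟨S, hS, rfl⟩ := Finset.mem_image.1 hT
  refine (hu S hS).trans_eq ?_
  refine Finset.sum_bij' (fun S' _ => (S \ L S) ∪ S') (fun R _ => R ∩ L S) ?_ ?_ ?_ ?_ ?_
  · intro S' hS'
    rw [Finset.mem_powerset] at hS'
    rw [Finset.mem_filter, (hL S hS S' hS').2]
    refine ⟨(hL S hS S' hS').1, ?_⟩
    ext e
    have := @hS' e
    simp only [Finset.mem_sdiff, Finset.mem_union]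
    tauto
  · intro R _
    exact Finset.mem_powerset.2 Finset.inter_subset_right
  · intro S' hS'
    rw [Finset.mem_powerset] at hS'
    ext e
    have := @hS' e
    simp only [Finset.mem_sdiff, Finset.mem_union, Finset.mem_inter]
    tauto
  -- `L` is determined by the explored part alone (apply `hL` with the empty filling), so `R` and
  -- `S` leave the same bonds unexplored.
  · intro R hR
    rw [Finset.mem_filter] at hR
    have h1 := (hL S hS ∅ (Finset.empty_subset _)).2
    have h2 := (hL R hR.1 ∅ (Finset.empty_subset _)).2
    rw [Finset.union_empty] at h1 h2
    rw [hR.2, h1] at h2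
    rw [← hR.2, ← h2]
    exact Finset.sdiff_union_inter R _
  · intro _ _; rfl

/-! ### Comparison of domains -/

section

variable {p : ℝ} {V : Finset Site} {F F' : Finset (Sym2 Site)}

theorem sum_nonneg_of_conditional (hF : F' ⊆ F) (u : Finset (Sym2 Site) → ℝ)
    (hu : ∀ T ⊆ F \ F', 0 ≤ ∑ S ∈ F'.powerset, u (T ∪ S)) : 0 ≤ ∑ S ∈ F.powerset, u S := by
  refine sum_nonneg_of_exploration (fun _ => F') (fun S hS S' hS' => ⟨?_, rfl⟩) u
    fun S hS => hu _ ?_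
  · rw [Finset.mem_powerset] at hS ⊢
    exact Finset.union_subset (Finset.sdiff_subset.trans hS) (hS'.trans hF)
  · exact Finset.sdiff_subset_sdiff (Finset.mem_powerset.1 hS) subset_rfl

theorem conditional_inter {S T : Finset (Sym2 Site)} (hT : T ⊆ F \ F') (hS : S ⊆ F') :
    (T ∪ S) ∩ F' = S := by
  ext e
  have h1 := @hT e
  have h2 := @hS e
  simp only [Finset.mem_sdiff, Finset.mem_inter, Finset.mem_union] at *
  tauto

theorem sum_wt_conditional (hF : F' ⊆ F) (G : SimpleGraph Site) {T : Finset (Sym2 Site)}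
    (hT : T ⊆ F \ F') (f : Finset (Sym2 Site) → ℝ) :
    ∑ S ∈ F'.powerset, wt p V G F (T ∪ S) * f S =
      p ^ T.card * (1 - p) ^ ((F \ F').card - T.card) * total p V (bondGraph T ⊔ G) F' f := by
  rw [total, Finset.mul_sum]
  refine Finset.sum_congr rfl fun S hS => ?_
  rw [wt_union G hF (Finset.mem_powerset.1 hS) hT, mul_assoc]

/-- Averaging over the state `T` of the bonds outside `F'`: given `T`, the bonds of `F'` see the
background `bondGraph T ⊔ G`. The coefficients `a` and `b` may be negative, so upper bounds are
covered too. -/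
theorem total_le_of_conditional (h0 : 0 ≤ p) (h1 : p < 1) (hF : F' ⊆ F) (G : SimpleGraph Site)
    (a b : ℝ) (f : Finset (Sym2 Site) → ℝ)
    (h : ∀ T ⊆ F \ F', a * total p V (bondGraph T ⊔ G) F' (fun _ => 1) ≤
      b * total p V (bondGraph T ⊔ G) F' f) :
    a * total p V G F (fun _ => 1) ≤ b * total p V G F (fun S => f (S ∩ F')) := by
  have h1' : 0 ≤ 1 - p := by linarith
  rw [← sub_nonneg, total, total, Finset.mul_sum, Finset.mul_sum, ← Finset.sum_sub_distrib]
  refine sum_nonneg_of_conditional hF _ fun T hT => ?_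
  have e : ∀ S ∈ F'.powerset, b * (wt p V G F (T ∪ S) * f ((T ∪ S) ∩ F')) -
      a * (wt p V G F (T ∪ S) * 1) = wt p V G F (T ∪ S) * (b * f S - a) := fun S hS => by
    rw [conditional_inter hT (Finset.mem_powerset.1 hS)]; ring
  rw [Finset.sum_congr rfl e, sum_wt_conditional hF G hT]
  refine mul_nonneg (by positivity) ?_
  have := h T hT
  simp only [total, Finset.mul_sum] at this ⊢
  rw [← sub_nonneg, ← Finset.sum_sub_distrib] at this
  exact this.trans_eq (Finset.sum_congr rfl fun S _ => by ring)

/-- The measure with the smaller background on fewer bonds is dominated. -/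
theorem total_free_le (h0 : 0 ≤ p) (h1 : p < 1) (hF : F' ⊆ F) {K G : SimpleGraph Site}
    (hKG : K ≤ G) {f : Finset (Sym2 Site) → ℝ} (hf : Monotone f) (hf0 : ∀ S, 0 ≤ f S) :
    total p V K F' f * total p V G F (fun _ => 1) ≤
      total p V K F' (fun _ => 1) * total p V G F (fun S => f (S ∩ F')) :=
  total_le_of_conditional h0 h1 hF G _ _ f fun _ _ =>
    total_mono_background h0 h1 (hKG.trans le_sup_right) hf hf0

/-- A background attached to the bonds of `F` through wired sites only has no influence. -/
theorem total_decouple (W : Finset Site) {H : SimpleGraph Site} (A B : Set Site)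
    (hA : ∀ x y, squareLattice.Adj x y → s(x, y) ∈ F → x ∈ A) (hWA : ↑W ⊆ A)
    (hB : ∀ x y, H.Adj x y → x ∈ B) (hAB : A ∩ B ⊆ W) (hWH : wiring W ≤ H)
    (f : Finset (Sym2 Site) → ℝ) :
    2 ^ clusters V (wiring W) * total p V H F f =
      2 ^ clusters V H * total p V (wiring W) F f := by
  rw [total, total, Finset.mul_sum, Finset.mul_sum]
  refine Finset.sum_congr rfl fun S hS => ?_
  have key := clusters_decouple V W (G := bondGraph S ⊔ wiring W) (H := H) A B ?_
    (fun x y h => ⟨hB x y h, hB y x h.symm⟩) hAB le_sup_right hWH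
  · rw [sup_assoc, sup_eq_right.2 hWH] at key
    have e : (2 : ℝ) ^ clusters V (bondGraph S ⊔ H) * 2 ^ clusters V (wiring W) =
        2 ^ clusters V (bondGraph S ⊔ wiring W) * 2 ^ clusters V H := by
      rw [← pow_add, ← pow_add, key]
    simp only [wt]
    linear_combination (p ^ S.card * (1 - p) ^ (F.card - S.card) * f S) * e
  · have hx : ∀ x y, (bondGraph S ⊔ wiring W).Adj x y → x ∈ A := by
      rintro x y (h | h)
      · rw [bondGraph_adj] at h
        exact hA x y h.1 (Finset.mem_powerset.1 hS h.2)
      · exact hWA h.2.1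
    exact fun x y h => ⟨hx x y h, hx y x h.symm⟩

/-- Wiring the sites through which the bonds of `F'` communicate with the rest dominates. -/
theorem total_le_wired (h0 : 0 ≤ p) (h1 : p < 1) (hF : F' ⊆ F) {G : SimpleGraph Site}
    (W : Finset Site) (A B : Set Site)
    (hA : ∀ x y, squareLattice.Adj x y → s(x, y) ∈ F' → x ∈ A) (hWA : ↑W ⊆ A)
    (hB : ∀ x y, squareLattice.Adj x y → s(x, y) ∈ F \ F' → x ∈ B) (hWB : ↑W ⊆ B)
    (hG : ∀ x y, G.Adj x y → x ∈ B) (hAB : A ∩ B ⊆ W)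
    {f : Finset (Sym2 Site) → ℝ} (hf : Monotone f) (hf0 : ∀ S, 0 ≤ f S) :
    total p V (wiring W) F' (fun _ => 1) * total p V G F (fun S => f (S ∩ F')) ≤
      total p V (wiring W) F' f * total p V G F (fun _ => 1) := by
  -- Negative coefficients turn the averaging lemma into an upper bound.
  have := total_le_of_conditional (V := V) h0 h1 hF G (-total p V (wiring W) F' f)
    (-total p V (wiring W) F' (fun _ => 1)) f fun T hT => ?_
  · linarith
  -- Add the wiring of `W` to the conditional background: this can only increase the mean of `f`,
  -- and the enlarged background acts on `F'` like the wiring alone.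
  have hdec := total_decouple (p := p) (V := V) (F := F') W (H := bondGraph T ⊔ G ⊔ wiring W) A B
    hA hWA ?_ hAB le_sup_right
  · have hm := total_mono_background (V := V) (F := F') h0 h1
      (le_sup_left : bondGraph T ⊔ G ≤ bondGraph T ⊔ G ⊔ wiring W) hf hf0
    have e1 := hdec f
    have e2 := hdec fun _ => 1
    have p1 : (0 : ℝ) < 2 ^ clusters V (wiring W) := by positivity
    have p2 : (0 : ℝ) < 2 ^ clusters V (bondGraph T ⊔ G ⊔ wiring W) := by positivity
    have hm' := mul_le_mul_of_nonneg_left hm p1.le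
    rw [mul_left_comm, e2, mul_left_comm (2 ^ clusters V (wiring W) : ℝ), e1] at hm'
    have : 2 ^ clusters V (bondGraph T ⊔ G ⊔ wiring W) *
        (total p V (wiring W) F' (fun _ => 1) * total p V (bondGraph T ⊔ G) F' f) ≤
        2 ^ clusters V (bondGraph T ⊔ G ⊔ wiring W) *
        (total p V (wiring W) F' f * total p V (bondGraph T ⊔ G) F' (fun _ => 1)) := by
      linarith
    have := le_of_mul_le_mul_left this p2
    linarith
  · rintro x y ((h | h) | h)
    · rw [bondGraph_adj] at h
      exact hB x y h.1 (hT h.2)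
    · exact hG x y h
    · exact hWB h.2.1

end

/-! ### Local events and the finite-volume measures -/

/-- `A` only depends on the bonds inside `V`. -/
def LocalIn (V : Finset Site) (A : Set Config) : Prop :=
  ∀ ω ω' : Config, (∀ e : Bond, (e : Sym2 Site) ∈ bondsIn V → ω e = ω' e) → ω ∈ A → ω' ∈ A

theorem mem_bondsIn {V : Finset Site} {x y : Site} :
    s(x, y) ∈ bondsIn V ↔ (x ∈ V ∧ y ∈ V) ∧ squareLattice.Adj x y := by
  simp [bondsIn]

theorem bondsIn_mono {V V' : Finset Site} (h : V ⊆ V') : bondsIn V ⊆ bondsIn V' := by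
  intro e
  induction e with
  | _ x y =>
    rw [mem_bondsIn, mem_bondsIn]
    exact fun h' => ⟨⟨h h'.1.1, h h'.1.2⟩, h'.2⟩

theorem LocalIn.mono {V V' : Finset Site} (h : V ⊆ V') {A : Set Config} (hA : LocalIn V A) :
    LocalIn V' A := fun ω ω' hω => hA ω ω' fun e he => hω e (bondsIn_mono h he)

theorem LocalIn.inter {V : Finset Site} {A B : Set Config} (hA : LocalIn V A)
    (hB : LocalIn V B) : LocalIn V (A ∩ B) :=
  fun ω ω' h hω => ⟨hA ω ω' h hω.1, hB ω ω' h hω.2⟩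

theorem configOf_apply {S : Finset (Sym2 Site)} {e : Bond} :
    configOf S e = true ↔ (e : Sym2 Site) ∈ S := by
  simp [configOf]

theorem configOf_mono {S T : Finset (Sym2 Site)} (h : S ⊆ T) : configOf S ≤ configOf T := by
  intro e
  rw [Bool.le_iff_imp, configOf_apply, configOf_apply]
  exact fun h' => h h'

open Classical in
/-- The configurations which coincide with `η` inside `V`. -/
def cylinder (V : Finset Site) (η : Config) : Set Config :=
  {ω | ∀ e ∈ (bondsIn V).subtype (· ∈ squareLattice.edgeSet), ω e = η e}

theorem measurableSet_cylinder (V : Finset Site) (η : Config) :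
    MeasurableSet (cylinder V η) := by
  classical
  have : cylinder V η = ⋂ e ∈ (bondsIn V).subtype (· ∈ squareLattice.edgeSet),
      (fun ω : Config => ω e) ⁻¹' {η e} := by
    ext ω; simp [cylinder]
  rw [this]
  exact Finset.measurableSet_biInter _ fun e _ =>
    measurable_pi_apply e (measurableSet_singleton _)

theorem mem_cylinder {V : Finset Site} {ω η : Config} :
    ω ∈ cylinder V η ↔ ∀ e : Bond, (e : Sym2 Site) ∈ bondsIn V → ω e = η e := by
  simp [cylinder]

-- A local event is a finite union of cylinders, which are disjoint for distinct sets of open bonds.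
-- Convergence of finite-dimensional distributions thus passes to all local events.
open Classical in
theorem LocalIn.eq_biUnion {V : Finset Site} {A : Set Config} (hA : LocalIn V A) :
    A = ⋃ S ∈ (bondsIn V).powerset.filter (fun S => configOf S ∈ A),
      cylinder V (configOf S) := by
  ext ω
  simp only [Set.mem_iUnion, Finset.mem_filter, Finset.mem_powerset, mem_cylinder]
  constructor
  · intro hω
    have key : ∀ e : Bond, (e : Sym2 Site) ∈ bondsIn V →
        ω e = configOf ((bondsIn V).filter fun e => ∃ h : e ∈ squareLattice.edgeSet,
          ω ⟨e, h⟩ = true) e := by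
      intro e he
      rw [Bool.eq_iff_iff, configOf_apply, Finset.mem_filter]
      exact ⟨fun h => ⟨he, e.2, h⟩, fun h => h.2.2⟩
    exact ⟨_, ⟨Finset.filter_subset _ _, hA _ _ key hω⟩, key⟩
  · rintro ⟨S, ⟨_, hS⟩, h⟩
    exact hA _ _ (fun e he => (h e he).symm) hS

theorem LocalIn.measurableSet {V : Finset Site} {A : Set Config} (hA : LocalIn V A) :
    MeasurableSet A := by
  classical
  rw [hA.eq_biUnion]
  exact Finset.measurableSet_biUnion _ fun S _ => measurableSet_cylinder V _

theorem bond_mem_edgeSet {V : Finset Site} {e : Sym2 Site} (he : e ∈ bondsIn V) :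
    e ∈ squareLattice.edgeSet := by
  simp only [bondsIn, Finset.mem_filter] at he
  exact he.2

open Classical in
theorem LocalIn.measure_eq {V : Finset Site} {A : Set Config} (hA : LocalIn V A)
    (μ : Measure Config) :
    μ A = ∑ S ∈ (bondsIn V).powerset.filter (fun S => configOf S ∈ A),
      μ (cylinder V (configOf S)) := by
  conv_lhs => rw [hA.eq_biUnion]
  refine measure_biUnion_finset ?_ fun S _ => measurableSet_cylinder V _
  intro S hS T hT hST
  rw [Function.onFun, Set.disjoint_left]
  intro ω h1 h2
  rw [mem_cylinder] at h1 h2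
  simp only [Finset.coe_filter, Finset.mem_powerset, Set.mem_ofPred_eq] at hS hT
  refine hST (Finset.ext fun e => ?_)
  by_cases he : e ∈ bondsIn V
  · have h3 := (h1 ⟨e, bond_mem_edgeSet he⟩ he).symm.trans (h2 ⟨e, bond_mem_edgeSet he⟩ he)
    rw [Bool.eq_iff_iff, configOf_apply, configOf_apply] at h3
    exact h3
  · exact ⟨fun h => (he (hS.1 h)).elim, fun h => (he (hT.1 h)).elim⟩

theorem IsLocalLimit.tendsto_real {μ : ℕ → Measure Config} {P : Measure Config}
    [IsFiniteMeasure P] (h : IsLocalLimit μ P) {V : Finset Site} {A : Set Config}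
    (hA : LocalIn V A) : Tendsto (fun n => (μ n).real A) atTop (𝓝 (P.real A)) := by
  classical
  refine (ENNReal.tendsto_toReal (measure_ne_top P A)).comp ?_
  simp only [hA.measure_eq]
  exact tendsto_finsetSum _ fun S _ => h _ _

/-- With `pC_lt_one`, this is all that the argument uses about the value of the critical point. The
infimum is nonnegative also for an empty set, where it is 0 by convention. -/
theorem pC_nonneg : 0 ≤ pC := by
  have : 0 ≤ betaC := Real.sInf_nonneg fun β hβ => hβ.1
  rw [pC, sub_nonneg, Real.exp_le_one_iff]
  linarith

theorem pC_lt_one : pC < 1 := by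
  have := Real.exp_pos (-2 * betaC)
  rw [pC]; linarith

/-- The indicator of `A`, as a function of the set of open bonds. -/
def ind (A : Set Config) (S : Finset (Sym2 Site)) : ℝ := A.indicator (fun _ => 1) (configOf S)

theorem ind_nonneg (A : Set Config) (S : Finset (Sym2 Site)) : 0 ≤ ind A S :=
  Set.indicator_nonneg (fun _ _ => zero_le_one) _

theorem ind_monotone {A : Set Config} (hA : IsUpperSet A) : Monotone (ind A) := by
  intro S T h
  by_cases hS : configOf S ∈ A
  · rw [ind, ind, Set.indicator_of_mem hS, Set.indicator_of_mem (hA (configOf_mono h) hS)]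
  · rw [ind, Set.indicator_of_notMem hS]
    exact ind_nonneg A T

theorem LocalIn.ind_inter {V : Finset Site} {A : Set Config} (hA : LocalIn V A)
    (S : Finset (Sym2 Site)) : ind A (S ∩ bondsIn V) = ind A S := by
  have h : ∀ e : Bond, (e : Sym2 Site) ∈ bondsIn V →
      configOf (S ∩ bondsIn V) e = configOf S e := by
    intro e he
    rw [Bool.eq_iff_iff, configOf_apply, configOf_apply, Finset.mem_inter]
    exact and_iff_left he
  have h' : configOf (S ∩ bondsIn V) ∈ A ↔ configOf S ∈ A :=
    ⟨hA _ _ h, hA _ _ fun e he => (h e he).symm⟩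
  by_cases hS : configOf S ∈ A
  · rw [ind, ind, Set.indicator_of_mem hS, Set.indicator_of_mem (h'.2 hS)]
  · rw [ind, ind, Set.indicator_of_notMem hS, Set.indicator_of_notMem (mt h'.1 hS)]

section

variable {p : ℝ} {V W : Finset Site}

theorem fkWeight_eq (h0 : 0 ≤ p) (h1 : p < 1) (S : Finset (Sym2 Site)) :
    fkWeight p V W S = ENNReal.ofReal (wt p V (wiring W) (bondsIn V) S) := by
  have h1' : 0 ≤ 1 - p := by linarith
  rw [wt, ENNReal.ofReal_mul (by positivity), ENNReal.ofReal_mul (by positivity),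
    ENNReal.ofReal_pow h0, ENNReal.ofReal_pow h1', ENNReal.ofReal_pow (by norm_num),
    ENNReal.ofReal_ofNat]
  rfl

theorem fkMeasure_real (h0 : 0 ≤ p) (h1 : p < 1) {A : Set Config} (hA : MeasurableSet A) :
    (fkMeasure p V W).real A = total p V (wiring W) (bondsIn V) (ind A) /
      total p V (wiring W) (bondsIn V) (fun _ => 1) := by
  have hw : ∀ S, 0 ≤ wt p V (wiring W) (bondsIn V) S := fun S => wt_nonneg h0 h1 _ S
  have e1 : ∑ S ∈ (bondsIn V).powerset, fkWeight p V W S =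
      ENNReal.ofReal (total p V (wiring W) (bondsIn V) (fun _ => 1)) := by
    rw [total, ENNReal.ofReal_sum_of_nonneg fun S _ => mul_nonneg (hw S) zero_le_one]
    exact Finset.sum_congr rfl fun S _ => by rw [fkWeight_eq h0 h1, mul_one]
  have e2 : (∑ S ∈ (bondsIn V).powerset, fkWeight p V W S • Measure.dirac (configOf S)) A =
      ENNReal.ofReal (total p V (wiring W) (bondsIn V) (ind A)) := by
    rw [total, ENNReal.ofReal_sum_of_nonneg fun S _ => mul_nonneg (hw S) (ind_nonneg A S),
      Measure.finsetSum_apply]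
    refine Finset.sum_congr rfl fun S _ => ?_
    rw [Measure.smul_apply, Measure.dirac_apply' _ hA, fkWeight_eq h0 h1, smul_eq_mul,
      ENNReal.ofReal_mul (hw S)]
    congr 1
    by_cases hS : configOf S ∈ A <;> simp [ind, hS]
  rw [Measure.real, fkMeasure, Measure.smul_apply, e1, e2, smul_eq_mul, ENNReal.toReal_mul,
    ENNReal.toReal_inv, ENNReal.toReal_ofReal (total_one_pos h0 h1 _).le,
    ENNReal.toReal_ofReal (total_nonneg h0 h1 _ (ind_nonneg A)), div_eq_inv_mul]

theorem fkMeasure_fkg (h0 : 0 ≤ p) (h1 : p < 1) {A B : Set Config} (hA : IsUpperSet A)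
    (hB : IsUpperSet B) (hA' : MeasurableSet A) (hB' : MeasurableSet B) :
    (fkMeasure p V W).real A * (fkMeasure p V W).real B ≤ (fkMeasure p V W).real (A ∩ B) := by
  have h := total_mul_le (V := V) (F := bondsIn V) h0 h1 (le_refl (wiring W)) (ind_monotone hA)
    (ind_monotone hB) (ind_nonneg A) (ind_nonneg B)
  have e : (fun S => ind A S * ind B S) = ind (A ∩ B) := by
    ext S
    by_cases h1 : configOf S ∈ A <;> by_cases h2 : configOf S ∈ B <;> simp [ind, h1, h2]
  have hZ := total_one_pos (V := V) (F := bondsIn V) h0 h1 (wiring W)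
  rw [e] at h
  rw [fkMeasure_real h0 h1 hA', fkMeasure_real h0 h1 hB', fkMeasure_real h0 h1 (hA'.inter hB'),
    div_mul_div_comm, div_le_div_iff₀ (by positivity) hZ]
  nlinarith [h, hZ]

/-- The extra sites are isolated clusters. The resulting factor cancels in probabilities, so
measures on different domains can be compared over one vertex set. -/
theorem total_extend {V' : Finset Site} (hV : V ⊆ V') (hW : W ⊆ V) {F : Finset (Sym2 Site)}
    (hF : F ⊆ bondsIn V) (f : Finset (Sym2 Site) → ℝ) :
    total p V' (wiring W) F f = 2 ^ (V' \ V).card * total p V (wiring W) F f := by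
  rw [total, total, Finset.mul_sum]
  refine Finset.sum_congr rfl fun S hS => ?_
  have : clusters V' (bondGraph S ⊔ wiring W) = clusters V (bondGraph S ⊔ wiring W) +
      (V' \ V).card := by
    refine clusters_extend hV ?_
    rintro x y (h | h)
    · rw [bondGraph_adj] at h
      exact (mem_bondsIn.1 (hF (Finset.mem_powerset.1 hS h.2))).1
    · exact ⟨hW h.2.1, hW h.2.2⟩
  rw [wt, wt, this, pow_add]
  ring

/-- The free measure has an empty background, which lies below whatever the larger domain induces on
the bonds of `V`. -/
theorem fkMeasure_free_le (h0 : 0 ≤ p) (h1 : p < 1) {V' W' : Finset Site} (hV : V ⊆ V')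
    {A : Set Config} (hA : IsUpperSet A) (hAV : LocalIn V A) :
    (fkMeasure p V ∅).real A ≤ (fkMeasure p V' W').real A := by
  have hZ := total_one_pos (V := V) (F := bondsIn V) h0 h1 (wiring ∅)
  have hZ' := total_one_pos (V := V') (F := bondsIn V') h0 h1 (wiring W')
  have h := total_free_le (V := V') h0 h1 (bondsIn_mono hV) (K := wiring ∅) (G := wiring W')
    (fun x y h => by simp [wiring] at h) (ind_monotone hA) (ind_nonneg A)
  rw [total_extend hV (Finset.empty_subset _) subset_rfl,
    total_extend hV (Finset.empty_subset _) subset_rfl, mul_assoc, mul_assoc] at h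
  have h := le_of_mul_le_mul_left h (by positivity)
  simp only [hAV.ind_inter] at h
  rw [fkMeasure_real h0 h1 hAV.measurableSet, fkMeasure_real h0 h1 hAV.measurableSet,
    div_le_div_iff₀ hZ hZ']
  exact h.trans_eq (mul_comm _ _)

theorem mem_boundary {x : Site} :
    x ∈ boundary V ↔ x ∈ V ∧ ∃ y, y ∉ V ∧ squareLattice.Adj x y := by
  simp [boundary]

theorem boundary_subset : boundary V ⊆ V := fun _ hx => (mem_boundary.1 hx).1

/-- A bond of `V'` not inside `V` touches `V` only at boundary sites, and so does the wiring of
`W'`. Hence the boundary of `V` separates the two families of bonds, as `total_le_wired` requires.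
-/
theorem fkMeasure_le_wired (h0 : 0 ≤ p) (h1 : p < 1) {V' W' : Finset Site} (hV : V ⊆ V')
    (hW' : W' ∩ V ⊆ boundary V) {A : Set Config} (hA : IsUpperSet A) (hAV : LocalIn V A) :
    (fkMeasure p V' W').real A ≤ (fkMeasure p V (boundary V)).real A := by
  have hZ := total_one_pos (V := V) (F := bondsIn V) h0 h1 (wiring (boundary V))
  have hZ' := total_one_pos (V := V') (F := bondsIn V') h0 h1 (wiring W')
  have h := total_le_wired (V := V') h0 h1 (bondsIn_mono hV) (G := wiring W') (boundary V)
    (V : Set Site) ({x | x ∈ V → x ∈ boundary V})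
    (fun x y _ h => (mem_bondsIn.1 h).1.1) (fun x hx => boundary_subset hx)
    (fun x y hxy h hx => by
      rw [Finset.mem_sdiff, mem_bondsIn, mem_bondsIn] at h
      exact mem_boundary.2 ⟨hx, y, fun hy => h.2 ⟨⟨hx, hy⟩, hxy⟩, hxy⟩)
    (fun x hx _ => hx) (fun x y hxy hx => hW' (Finset.mem_inter.2 ⟨hxy.2.1, hx⟩))
    (fun x hx => hx.2 hx.1) (ind_monotone hA) (ind_nonneg A)
  rw [total_extend hV boundary_subset subset_rfl,
    total_extend hV boundary_subset subset_rfl, mul_assoc, mul_assoc] at h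
  have h := le_of_mul_le_mul_left h (by positivity)
  simp only [hAV.ind_inter] at h
  rw [fkMeasure_real h0 h1 hAV.measurableSet, fkMeasure_real h0 h1 hAV.measurableSet,
    div_le_div_iff₀ hZ' hZ]
  exact (mul_comm _ _).trans_le h

end

/-! ### Translations -/

theorem squareLattice_adj_add {x y : Site} (v : Site) :
    squareLattice.Adj (x + v) (y + v) ↔ squareLattice.Adj x y := by
  simp [squareLattice]

/-- The translation of bonds by `v`. -/
def shiftBond (v : Site) (e : Bond) : Bond :=
  ⟨Sym2.map (· + v) e, by
    obtain ⟨e, he⟩ := e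
    induction e with
    | _ x y => exact (squareLattice_adj_add v).2 he⟩

/-- The configuration seen from `v`. -/
def shift (v : Site) (ω : Config) : Config := fun e => ω (shiftBond v e)

theorem shift_mono (v : Site) : Monotone (shift v) := fun _ _ h e => h (shiftBond v e)

theorem openGraph_shift_adj {v : Site} {ω : Config} {x y : Site} :
    (openGraph (shift v ω)).Adj x y ↔ (openGraph ω).Adj (x + v) (y + v) :=
  ⟨fun ⟨h, hω⟩ => ⟨(squareLattice_adj_add v).2 h, hω⟩,
    fun ⟨h, hω⟩ => ⟨(squareLattice_adj_add v).1 h, hω⟩⟩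

theorem add_injective_site (v : Site) : Function.Injective (· + v : Site → Site) :=
  add_left_injective v

/-- Translates of sets of sites. -/
abbrev translate (v : Site) (V : Finset Site) : Finset Site :=
  V.map ⟨(· + v), add_injective_site v⟩

theorem mem_translate {v x : Site} {V : Finset Site} : x + v ∈ translate v V ↔ x ∈ V :=
  Finset.mem_map' ⟨(· + v), add_injective_site v⟩

/-- Translates of sets of bonds. -/
abbrev translateBonds (v : Site) (S : Finset (Sym2 Site)) : Finset (Sym2 Site) :=
  S.map ⟨Sym2.map (· + v), Sym2.map.injective (add_injective_site v)⟩

theorem mem_translateBonds {v : Site} {e : Sym2 Site} {S : Finset (Sym2 Site)} :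
    Sym2.map (· + v) e ∈ translateBonds v S ↔ e ∈ S :=
  Finset.mem_map' ⟨Sym2.map (· + v), Sym2.map.injective (add_injective_site v)⟩

theorem boundary_translate (v : Site) (V : Finset Site) :
    boundary (translate v V) = translate v (boundary V) := by
  ext x
  obtain ⟨x, rfl⟩ : ∃ y, y + v = x := ⟨x - v, sub_add_cancel x v⟩
  rw [mem_translate, mem_boundary, mem_boundary, mem_translate]
  refine and_congr_right fun _ => ⟨?_, ?_⟩
  · rintro ⟨y, hy, h⟩
    obtain ⟨y, rfl⟩ : ∃ z, z + v = y := ⟨y - v, sub_add_cancel y v⟩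
    rw [mem_translate] at hy
    exact ⟨y, hy, (squareLattice_adj_add v).1 h⟩
  · rintro ⟨y, hy, h⟩
    exact ⟨y + v, mt mem_translate.1 hy, (squareLattice_adj_add v).2 h⟩

theorem bondsIn_translate (v : Site) (V : Finset Site) :
    bondsIn (translate v V) = translateBonds v (bondsIn V) := by
  ext e
  obtain ⟨e, rfl⟩ : ∃ e', Sym2.map (· + v) e' = e := by
    induction e with
    | _ x y => exact ⟨s(x - v, y - v), by simp⟩
  rw [mem_translateBonds]
  induction e with
  | _ x y =>
    rw [Sym2.map_mk, mem_bondsIn, mem_bondsIn, mem_translate, mem_translate,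
      squareLattice_adj_add]

theorem shift_configOf (v : Site) (S : Finset (Sym2 Site)) :
    shift v (configOf (translateBonds v S)) = configOf S := by
  ext e
  rw [Bool.eq_iff_iff, configOf_apply]
  exact configOf_apply.trans mem_translateBonds

theorem clusters_translate (v : Site) (V : Finset Site) {G H : SimpleGraph Site}
    (h : ∀ x y, G.Adj (x + v) (y + v) ↔ H.Adj x y) :
    clusters (translate v V) G = clusters V H := by
  refine Nat.card_congr (SimpleGraph.Iso.connectedComponentEquiv (RelIso.symm ?_))
  exact
  { toFun := fun x => ⟨x.1 + v, mem_translate.2 x.2⟩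
    invFun := fun x => ⟨x.1 - v, mem_translate.1 (by rw [sub_add_cancel]; exact x.2)⟩
    left_inv := fun x => Subtype.ext (add_sub_cancel_right _ _)
    right_inv := fun x => Subtype.ext (sub_add_cancel _ _)
    map_rel_iff' := by
      intro x y
      exact h x.1 y.1 }

theorem fkMeasure_translate {p : ℝ} (h0 : 0 ≤ p) (h1 : p < 1) (v : Site) (V W : Finset Site)
    {A : Set Config} (hA : MeasurableSet A) (hA' : MeasurableSet (shift v ⁻¹' A)) :
    (fkMeasure p (translate v V) (translate v W)).real (shift v ⁻¹' A) =
      (fkMeasure p V W).real A := by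
  have key : ∀ f g : Finset (Sym2 Site) → ℝ, (∀ S, f (translateBonds v S) = g S) →
      total p (translate v V) (wiring (translate v W)) (bondsIn (translate v V)) f =
        total p V (wiring W) (bondsIn V) g := by
    intro f g hfg
    rw [total, total, bondsIn_translate]
    symm
    refine Finset.sum_bij (fun S _ => translateBonds v S) ?_ ?_ ?_ ?_
    · intro S hS
      rw [Finset.mem_powerset] at hS ⊢
      exact Finset.map_subset_map.2 hS
    · intro S _ T _ h
      exact Finset.map_injective _ h
    · intro S hS
      rw [Finset.mem_powerset, Finset.subset_map_iff] at hS
      obtain ⟨T, hT, rfl⟩ := hS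
      exact ⟨T, Finset.mem_powerset.2 hT, rfl⟩
    · intro S _
      rw [hfg, wt, wt, Finset.card_map, Finset.card_map]
      congr 3
      refine (clusters_translate v V fun x y => ?_).symm
      simp only [SimpleGraph.sup_adj, bondGraph_adj, squareLattice_adj_add]
      refine or_congr (and_congr_right fun _ => ?_) ?_
      · exact mem_translateBonds (e := s(x, y))
      · simp only [wiring, mem_translate, ne_eq, add_left_inj]
  rw [fkMeasure_real h0 h1 hA', fkMeasure_real h0 h1 hA, key _ (ind A), key _ fun _ => 1]
  · exact fun _ => rfl
  · intro S
    by_cases hS : configOf S ∈ A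
    · rw [ind, ind, Set.indicator_of_mem hS, Set.indicator_of_mem]
      rwa [Set.mem_preimage, shift_configOf]
    · rw [ind, ind, Set.indicator_of_notMem hS, Set.indicator_of_notMem]
      rwa [Set.mem_preimage, shift_configOf]

theorem LocalIn.shift {V : Finset Site} {A : Set Config} (hA : LocalIn V A) (v : Site) :
    LocalIn (translate v V) (shift v ⁻¹' A) := by
  intro ω ω' h hω
  refine hA _ _ (fun e he => h _ ?_) hω
  rw [bondsIn_translate]
  exact mem_translateBonds.2 he

/-! ### Infinite volume -/

theorem mem_box {n : ℕ} {x : Site} : x ∈ box n ↔ |x.1| ≤ n ∧ |x.2| ≤ n := by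
  simp only [box, Finset.mem_Icc, Prod.le_def, abs_le]
  tauto

theorem exists_subset_box (V : Finset Site) : ∃ n₀ : ℕ, ∀ n ≥ n₀, V ⊆ box n := by
  refine ⟨V.sup fun x => x.1.natAbs + x.2.natAbs, fun n hn x hx => ?_⟩
  have : x.1.natAbs + x.2.natAbs ≤ n :=
    (Finset.le_sup (f := fun x : Site => x.1.natAbs + x.2.natAbs) hx).trans hn
  rw [mem_box, abs_le, abs_le]
  omega

theorem disjoint_boundary_box {n : ℕ} {V : Finset Site} (h : V ⊆ box n) :
    boundary (box (n + 1)) ∩ V = ∅ := by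
  rw [Finset.eq_empty_iff_forall_notMem]
  intro x hx
  rw [Finset.mem_inter, mem_boundary] at hx
  obtain ⟨⟨_, y, hy, hxy⟩, hxV⟩ := hx
  have h1 := mem_box.1 (h hxV)
  rw [mem_box] at hy
  simp only [squareLattice] at hxy
  push_cast at hy
  refine hy ⟨?_, ?_⟩
  · have h2 := abs_sub_abs_le_abs_sub y.1 x.1
    rw [abs_sub_comm] at h2
    linarith [h1.1, abs_nonneg (x.2 - y.2)]
  · have h2 := abs_sub_abs_le_abs_sub y.2 x.2
    rw [abs_sub_comm] at h2
    linarith [h1.2, abs_nonneg (x.1 - y.1)]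

section

variable {P : Measure Config}

/-- The critical measure is a limit over boxes, with boundary conditions far from any finite set. -/
theorem IsCriticalFK.exists_limit (hP : IsCriticalFK P) :
    ∃ W : ℕ → Finset Site, IsLocalLimit (fun n => fkMeasure pC (box n) (W n)) P ∧
      (∀ n, W n ⊆ box n) ∧ ∀ V : Finset Site, ∀ᶠ n in atTop, V ⊆ box n ∧ W n ∩ V = ∅ := by
  rcases hP.2 with h | h
  · refine ⟨_, h, fun n => Finset.empty_subset _, fun V => ?_⟩
    obtain ⟨n₀, hn₀⟩ := exists_subset_box V
    filter_upwards [eventually_ge_atTop n₀] with n hn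
    exact ⟨hn₀ n hn, Finset.empty_inter _⟩
  · refine ⟨_, h, fun n => boundary_subset, fun V => ?_⟩
    obtain ⟨n₀, hn₀⟩ := exists_subset_box V
    filter_upwards [eventually_ge_atTop (n₀ + 1)] with n hn
    obtain ⟨k, rfl⟩ : ∃ k, n = k + 1 := ⟨n - 1, by omega⟩
    exact ⟨hn₀ _ (by omega), disjoint_boundary_box (hn₀ k (by omega))⟩

theorem IsCriticalFK.fkg (hP : IsCriticalFK P) {V : Finset Site} {A B : Set Config}
    (hA : IsUpperSet A) (hB : IsUpperSet B) (hAV : LocalIn V A) (hBV : LocalIn V B) :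
    P.real A * P.real B ≤ P.real (A ∩ B) := by
  have := hP.1
  obtain ⟨W, h, -⟩ := hP.exists_limit
  exact le_of_tendsto_of_tendsto' ((h.tendsto_real hAV).mul (h.tendsto_real hBV))
    (h.tendsto_real (hAV.inter hBV)) fun n => fkMeasure_fkg pC_nonneg pC_lt_one hA hB
      hAV.measurableSet hBV.measurableSet

/-- The finite-volume comparison holds along the approximating boxes once they contain `V` and their
wired sites are off `V`; then pass to the limit. -/
theorem IsCriticalFK.le_wired (hP : IsCriticalFK P) {V : Finset Site} {A : Set Config}
    (hA : IsUpperSet A) (hAV : LocalIn V A) :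
    P.real A ≤ (fkMeasure pC V (boundary V)).real A := by
  have := hP.1
  obtain ⟨W, h, -, hW⟩ := hP.exists_limit
  refine le_of_tendsto (h.tendsto_real hAV) ?_
  filter_upwards [hW V] with n hn
  exact fkMeasure_le_wired pC_nonneg pC_lt_one hn.1 (by simp [hn.2]) hA hAV

theorem translate_box_subset (v : Site) (n : ℕ) :
    translate v (box n) ⊆ box (n + (v.1.natAbs + v.2.natAbs)) := by
  intro x hx
  obtain ⟨x, rfl⟩ : ∃ y, y + v = x := ⟨x - v, sub_add_cancel x v⟩
  rw [mem_translate, mem_box, abs_le, abs_le] at hx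
  rw [mem_box, abs_le, abs_le]
  simp only [Prod.fst_add, Prod.snd_add]
  omega

theorem box_subset_translate (v : Site) (n : ℕ) :
    box n ⊆ translate v (box (n + (v.1.natAbs + v.2.natAbs))) := by
  intro x hx
  obtain ⟨x, rfl⟩ : ∃ y, y + v = x := ⟨x - v, sub_add_cancel x v⟩
  rw [mem_translate, mem_box, abs_le, abs_le]
  rw [mem_box, abs_le, abs_le] at hx
  simp only [Prod.fst_add, Prod.snd_add] at hx
  omega

/-- Increasing local events are at least as likely after a translation. -/
theorem IsCriticalFK.le_shift (hP : IsCriticalFK P) {V : Finset Site} {A : Set Config}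
    (hA : IsUpperSet A) (hAV : LocalIn V A) (v : Site) :
    P.real A ≤ P.real (shift v ⁻¹' A) := by
  have := hP.1
  obtain ⟨n₀, hn₀⟩ := exists_subset_box V
  have hA' : IsUpperSet (shift v ⁻¹' A) := fun _ _ h hω => hA (shift_mono v h) hω
  have hAV' := hAV.shift v
  set k := v.1.natAbs + v.2.natAbs with hk
  rcases hP.2 with h | h
  -- Free case: the translate of `box n` lies in `box (n + k)`, and free measures increase with the
  -- domain.
  · refine le_of_tendsto_of_tendsto (h.tendsto_real hAV)
      ((h.tendsto_real hAV').comp (tendsto_add_atTop_nat k)) ?_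
    filter_upwards [eventually_ge_atTop n₀] with n hn
    have h1 := fkMeasure_translate pC_nonneg pC_lt_one v (box n) ∅ hAV.measurableSet
      hAV'.measurableSet
    rw [← h1]
    exact fkMeasure_free_le pC_nonneg pC_lt_one (translate_box_subset v n) hA'
      ((hAV.mono (hn₀ n hn)).shift v)
  -- Wired case: the translate of `box (n + k)` contains `box n`, and wired measures decrease as the
  -- domain grows.
  · refine le_of_tendsto_of_tendsto ((h.tendsto_real hAV).comp (tendsto_add_atTop_nat k))
      (h.tendsto_real hAV') ?_
    obtain ⟨n₁, hn₁⟩ := exists_subset_box (translate v V)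
    filter_upwards [eventually_ge_atTop n₁] with n hn
    have h1 := fkMeasure_translate pC_nonneg pC_lt_one v (box (n + k)) (boundary (box (n + k)))
      hAV.measurableSet hAV'.measurableSet
    have hsub := box_subset_translate v n
    simp only [Function.comp_apply]
    rw [← h1, ← boundary_translate]
    refine fkMeasure_le_wired pC_nonneg pC_lt_one hsub (fun x hx => ?_) hA'
      (hAV'.mono (hn₁ n hn))
    rw [Finset.mem_inter, mem_boundary] at hx
    obtain ⟨⟨_, y, hy, hxy⟩, hx⟩ := hx
    exact mem_boundary.2 ⟨hx, y, fun h => hy (hsub h), hxy⟩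

end

/-! ### Potentials on the square lattice -/

theorem exists_antiderivative {M : Type*} [AddCommGroup M] (a : ℤ → M) :
    ∃ b : ℤ → M, ∀ i, b (i + 1) = b i + a i := by
  refine ⟨fun i => ∑ k ∈ Finset.range i.toNat, a k -
    ∑ k ∈ Finset.range (-i).toNat, a (-(k : ℤ) - 1), fun i => ?_⟩
  rcases lt_or_ge i 0 with hi | hi
  · obtain ⟨n, rfl⟩ : ∃ n : ℕ, i = -(n : ℤ) - 1 := ⟨(-i - 1).toNat, by omega⟩
    have h1 : (-(-(n : ℤ) - 1)).toNat = n + 1 := by omega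
    have h2 : (-(-(n : ℤ) - 1 + 1)).toNat = n := by omega
    have h3 : (-(n : ℤ) - 1 + 1).toNat = 0 := by omega
    have h4 : (-(n : ℤ) - 1).toNat = 0 := by omega
    simp only [h1, h2, h3, h4, Finset.sum_range_succ, Finset.sum_range_zero]
    abel
  · obtain ⟨n, rfl⟩ : ∃ n : ℕ, i = n := ⟨i.toNat, by omega⟩
    have h1 : ((n : ℤ) + 1).toNat = n + 1 := by omega
    have h2 : (-((n : ℤ) + 1)).toNat = 0 := by omega
    have h3 : (-(n : ℤ)).toNat = 0 := by omega
    simp only [h1, h2, h3, Finset.sum_range_succ, Finset.sum_range_zero, Int.toNat_natCast]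
    abel

/-- A closed cochain on `ℤ²` is exact. -/
theorem exists_potential {M : Type*} [AddCommGroup M] (cR cU : Site → M)
    (hc : ∀ x y, cR (x, y) + cU (x + 1, y) = cU (x, y) + cR (x, y + 1)) :
    ∃ h : Site → M, (∀ x y, h (x + 1, y) = h (x, y) + cR (x, y)) ∧
      ∀ x y, h (x, y + 1) = h (x, y) + cU (x, y) := by
  -- Integrate along the horizontal axis, then vertically in each column. Subtracting `d f.1 0`
  -- removes the arbitrary additive constant of the column.
  obtain ⟨b, hb⟩ := exists_antiderivative fun x => cR (x, 0)
  choose d hd using fun x => exists_antiderivative fun y => cU (x, y)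
  refine ⟨fun f => b f.1 + d f.1 f.2 - d f.1 0, fun x y => ?_, fun x y => ?_⟩
  · simp only
    induction y using Int.induction_on with
    | zero => rw [hb]; abel
    | succ n ih =>
      rw [hd, hd]
      have := hc x n
      have e : cR (x, (n : ℤ) + 1) = cR (x, (n : ℤ)) + cU (x + 1, (n : ℤ)) - cU (x, (n : ℤ)) := by
        rw [this]; abel
      rw [e]
      have ih' : b (x + 1) + d (x + 1) n - d (x + 1) 0 + cU (x + 1, (n : ℤ)) =
        b x + d x n - d x 0 + cR (x, (n : ℤ)) + cU (x + 1, (n : ℤ)) := by rw [ih]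
      rw [show b (x + 1) + (d (x + 1) ↑n + cU (x + 1, (n : ℤ))) - d (x + 1) 0 =
        b (x + 1) + d (x + 1) n - d (x + 1) 0 + cU (x + 1, (n : ℤ)) by abel, ih']
      abel
    | pred n ih =>
      have h1 := hd (x + 1) (-(n : ℤ) - 1)
      have h2 := hd x (-(n : ℤ) - 1)
      have h3 := hc x (-(n : ℤ) - 1)
      rw [sub_add_cancel] at h1 h2 h3
      rw [h1, h2] at ih
      have e : cR (x, -(n : ℤ) - 1) =
          cU (x, -(n : ℤ) - 1) + cR (x, -(n : ℤ)) - cU (x + 1, -(n : ℤ) - 1) := by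
        rw [← h3]; abel
      rw [e, show b (x + 1) + d (x + 1) (-(n : ℤ) - 1) - d (x + 1) 0 =
        b (x + 1) + (d (x + 1) (-(n : ℤ) - 1) + cU (x + 1, -(n : ℤ) - 1)) - d (x + 1) 0 -
          cU (x + 1, -(n : ℤ) - 1) by abel, ih]
      abel
  · simp only [hd]; abel

theorem eq_of_forall_step {α : Type*} (h : ℤ → α) {a b : ℤ} (hab : a ≤ b)
    (hs : ∀ i, a ≤ i → i < b → h (i + 1) = h i) : h a = h b := by
  induction b, hab using Int.leInduction with
  | base => rfl
  | succ b hb ih =>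
    rw [hs b hb (by omega)]
    exact ih fun i h1 h2 => hs i h1 (by omega)

/-- A square annulus of `ℤ²` is connected. -/
theorem eq_of_square_annulus {α : Type*} (h : Site → α) {a b N : ℤ} (hb : b < N) (hb' : -N ≤ b)
    (J : Set Site) (hJ : J = {f | (|f.1| ≤ N ∧ |f.2| ≤ N) ∧
      (f.1 < a ∨ b < f.1 ∨ f.2 < a ∨ b < f.2)})
    (_hab : a ≤ b)
    (hR : ∀ x y, (x, y) ∈ J → (x + 1, y) ∈ J → h (x + 1, y) = h (x, y))
    (hU : ∀ x y, (x, y) ∈ J → (x, y + 1) ∈ J → h (x, y + 1) = h (x, y))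
    {f g : Site} (hf : f ∈ J) (hg : g ∈ J) : h f = h g := by
  have hmem : ∀ x y, (x, y) ∈ J ↔ ((-N ≤ x ∧ x ≤ N) ∧ -N ≤ y ∧ y ≤ N) ∧
      (x < a ∨ b < x ∨ y < a ∨ b < y) := by
    intro x y; rw [hJ]; simp only [Set.mem_ofPred_eq, abs_le]
  have hor : ∀ x x' y, x ≤ x' → (∀ i, x ≤ i → i ≤ x' → (i, y) ∈ J) → h (x, y) = h (x', y) :=
    fun x x' y hx hi => eq_of_forall_step (fun i => h (i, y)) hx fun i h1 h2 =>
      hR i y (hi i h1 h2.le) (hi _ (by omega) (by omega))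
  have ver : ∀ x y y', y ≤ y' → (∀ i, y ≤ i → i ≤ y' → (x, i) ∈ J) → h (x, y) = h (x, y') :=
    fun x y y' hx hi => eq_of_forall_step (fun i => h (x, i)) hx fun i h1 h2 =>
      hU x i (hi i h1 h2.le) (hi _ (by omega) (by omega))
  have hor' : ∀ x x' y, (∀ i, min x x' ≤ i → i ≤ max x x' → (i, y) ∈ J) →
      h (x, y) = h (x', y) := by
    intro x x' y hi
    rcases le_total x x' with hx | hx
    · exact hor x x' y hx fun i h1 h2 => hi i (by omega) (by omega)
    · exact (hor x' x y hx fun i h1 h2 => hi i (by omega) (by omega)).symm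
  have ver' : ∀ x y y', (∀ i, min y y' ≤ i → i ≤ max y y' → (x, i) ∈ J) →
      h (x, y) = h (x, y') := by
    intro x y y' hi
    rcases le_total y y' with hx | hx
    · exact ver x y y' hx fun i h1 h2 => hi i (by omega) (by omega)
    · exact (ver x y' y hx fun i h1 h2 => hi i (by omega) (by omega)).symm
  -- Join each site to the corner `(b + 1, b + 1)` by two straight pieces. A column avoiding `[a,
  -- b]` lies in the annulus within the outer square, so start vertically there; otherwise the row
  -- avoids `[a, b]`, so start horizontally.
  suffices key : ∀ f ∈ J, h f = h (b + 1, b + 1) from (key f hf).trans (key g hg).symm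
  rintro ⟨x, y⟩ hf
  rw [hmem] at hf
  by_cases hx : x < a ∨ b < x
  · rw [ver' x y (b + 1) fun i h1 h2 => (hmem _ _).2 (by omega),
      hor' x (b + 1) (b + 1) fun i h1 h2 => (hmem _ _).2 (by omega)]
  · rw [hor' x (b + 1) y fun i h1 h2 => (hmem _ _).2 (by omega),
      ver' (b + 1) y (b + 1) fun i h1 h2 => (hmem _ _).2 (by omega)]

/-! ### Dual exploration from the outside of a box

The face of `ℤ²` with corners `f` and `f + (1, 1)` is represented by the site `f`. -/

theorem adj_iff {f g : Site} : squareLattice.Adj f g ↔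
    g = f + (1, 0) ∨ f = g + (1, 0) ∨ g = f + (0, 1) ∨ f = g + (0, 1) := by
  obtain ⟨a, b⟩ := f
  obtain ⟨c, d⟩ := g
  simp only [squareLattice, Prod.mk_add_mk, Prod.mk.injEq]
  rcases abs_cases (a - c) with h | h <;> rcases abs_cases (b - d) with h' | h' <;> omega

/-- The graph of the adjacent faces which are separated by a closed bond. -/
def closedDual (G : SimpleGraph Site) : SimpleGraph Site where
  -- The sites `f ⊔ g` and `f ⊓ g + (1, 1)` are the end points of the bond shared by the adjacent
  -- faces `f` and `g`.
  Adj f g := squareLattice.Adj f g ∧ ¬ G.Adj (f ⊔ g) (f ⊓ g + (1, 1))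
  symm := ⟨fun f g h => ⟨h.1.symm, by rw [sup_comm, inf_comm]; exact h.2⟩⟩
  loopless := ⟨fun f h => squareLattice.loopless.irrefl f h.1⟩

/-- The faces in the box `[-m, m]²`. -/
def faceBox (m : ℤ) : Set Site := {f | (-m ≤ f.1 ∧ f.1 < m) ∧ -m ≤ f.2 ∧ f.2 < m}

/-- The faces that are explored from the outside of the box `[-m, m]²`. -/
def explored (G : SimpleGraph Site) (m : ℤ) : Set Site :=
  {g | ∃ q ∉ faceBox m, (closedDual G).Reachable q g}

/-- The adjacency of unexplored faces. -/
def unexplored (G : SimpleGraph Site) (m : ℤ) : SimpleGraph Site where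
  Adj f g := squareLattice.Adj f g ∧ f ∉ explored G m ∧ g ∉ explored G m
  symm := ⟨fun _ _ h => ⟨h.1.symm, h.2.2, h.2.1⟩⟩
  loopless := ⟨fun f h => squareLattice.loopless.irrefl f h.1⟩

/-- The unexplored faces which are connected to the face `0`. -/
def innerFaces (G : SimpleGraph Site) (m : ℤ) : Set Site :=
  {f | f ∉ explored G m ∧ (unexplored G m).Reachable 0 f}

/-- `f` is one of the four faces around the site `v`. -/
def IsFaceOf (f v : Site) : Prop := f = v ∨ f = v - (1, 0) ∨ f = v - (0, 1) ∨ f = v - (1, 1)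

/-- The sites with a face in `I` and a face off `I`. -/
def cutSites (I : Set Site) : Set Site :=
  {v | (∃ f ∈ I, IsFaceOf f v) ∧ ∃ f ∉ I, IsFaceOf f v}

theorem innerFaces_subset {G : SimpleGraph Site} {m : ℤ} {f : Site} (hf : f ∈ innerFaces G m) :
    f ∈ faceBox m := by
  by_contra h
  exact hf.1 ⟨f, h, SimpleGraph.Reachable.refl f⟩

theorem explored_of_adj_innerFaces {G : SimpleGraph Site} {m : ℤ} {f g : Site}
    (hf : f ∈ innerFaces G m) (hg : g ∉ innerFaces G m) (h : squareLattice.Adj f g) :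
    g ∈ explored G m := by
  by_contra hg'
  exact hg ⟨hg', hf.2.trans (SimpleGraph.Adj.reachable ⟨h, hf.1, hg'⟩)⟩

/-- The outer face `g` is explored; were the common bond closed, the exploration would cross it into
`f`. -/
theorem open_of_cut {G : SimpleGraph Site} {m : ℤ} {f g : Site}
    (hf : f ∈ innerFaces G m) (hg : g ∉ innerFaces G m) (h : squareLattice.Adj f g) :
    G.Adj (f ⊔ g) (f ⊓ g + (1, 1)) := by
  by_contra hc
  obtain ⟨q, hq, hqg⟩ := explored_of_adj_innerFaces hf hg h
  exact hf.1 ⟨q, hq, hqg.trans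
    (SimpleGraph.Adj.reachable (G := closedDual G) ⟨h, hc⟩).symm⟩

/-- Three adjacencies chain together the four faces around `v`. If membership in `I` changed across
none of them, `v` could not see both kinds of faces. -/
theorem exists_cut_of_cutSites {I : Set Site} {v : Site} (hv : v ∈ cutSites I) :
    ∃ f g, f ∈ I ∧ g ∉ I ∧ squareLattice.Adj f g ∧ (v = f ⊔ g ∨ v = f ⊓ g + (1, 1)) := by
  have key : ∀ f g, squareLattice.Adj f g → (v = f ⊔ g ∨ v = f ⊓ g + (1, 1)) →
      ¬ (f ∈ I ↔ g ∈ I) → ∃ f g, f ∈ I ∧ g ∉ I ∧ squareLattice.Adj f g ∧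
        (v = f ⊔ g ∨ v = f ⊓ g + (1, 1)) := by
    intro f g hfg hv h
    by_cases hf : f ∈ I
    · exact ⟨f, g, hf, fun hg => h (iff_of_true hf hg), hfg, hv⟩
    · refine ⟨g, f, ?_, hf, hfg.symm, by rwa [sup_comm, inf_comm]⟩
      by_contra hg
      exact h (iff_of_false hf hg)
  by_contra hno
  obtain ⟨x, y⟩ := v
  have h1 := not_not.1 (mt (key (x - 1, y - 1) (x, y - 1) (by rw [adj_iff]; simp)
    (by right; simp)) hno)
  have h2 := not_not.1 (mt (key (x, y - 1) (x, y) (by rw [adj_iff]; simp) (by left; simp)) hno)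
  have h3 := not_not.1 (mt (key (x - 1, y) (x, y) (by rw [adj_iff]; simp) (by left; simp)) hno)
  obtain ⟨⟨f, hf, hf'⟩, g, hg, hg'⟩ := hv
  have hall : ∀ f, IsFaceOf f (x, y) → (f ∈ I ↔ (x, y) ∈ I) := by
    rintro f (rfl | rfl | rfl | rfl)
    · rfl
    · simpa using h3
    · simpa using h2
    · simpa using h1.trans h2
  exact hg ((hall g hg').2 ((hall f hf').1 hf))

/-- The open bonds at the boundary of the inner faces belong to one cluster. -/
theorem cutSites_reachable (G : SimpleGraph Site) {m : ℤ} (hm : 0 < m) {b b' : Site}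
    (hb : b ∈ cutSites (innerFaces G m)) (hb' : b' ∈ cutSites (innerFaces G m)) :
    G.Reachable b b' := by
  classical
  set I := innerFaces G m with hI
  -- Mod 2 cohomology: `c` marks the dual steps crossing the cut and `ρ` marks the cluster of `b`.
  -- The product is the part of the cut lying in that cluster. It will be shown to be the whole cut.
  let c : Site → Site → ZMod 2 := fun f g => if (f ∈ I ↔ g ∈ I) then 0 else 1
  let ρ : Site → ZMod 2 := fun v => if G.Reachable b v then 1 else 0
  have hopen : ∀ f g, ¬ (f ∈ I ↔ g ∈ I) → squareLattice.Adj f g →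
      G.Adj (f ⊔ g) (f ⊓ g + (1, 1)) := by
    intro f g h hfg
    by_cases hf : f ∈ I
    · exact open_of_cut hf (fun hg => h (iff_of_true hf hg)) hfg
    · rw [sup_comm, inf_comm]
      refine open_of_cut ?_ hf hfg.symm
      by_contra hg
      exact h (iff_of_false hf hg)
  have hρ : ∀ u v, G.Adj u v → ρ u = ρ v := by
    intro u v huv
    have : G.Reachable b u ↔ G.Reachable b v :=
      ⟨fun h => h.trans huv.reachable, fun h => h.trans huv.symm.reachable⟩
    simp only [ρ, this]
  have hcρ : ∀ f g, squareLattice.Adj f g →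
      c f g * ρ (f ⊔ g) = c f g * ρ (f ⊓ g + (1, 1)) := by
    intro f g hfg
    by_cases h : (f ∈ I ↔ g ∈ I)
    · simp [c, h]
    · rw [hρ _ _ (hopen f g h hfg)]
  have hsq : ∀ f g k l : Site, c f g + c g l = c f k + c k l := by
    intro f g k l
    have h2 : (1 : ZMod 2) + 1 = 0 := by decide
    by_cases h1 : f ∈ I <;> by_cases h2 : g ∈ I <;> by_cases h3 : k ∈ I <;>
      by_cases h4 : l ∈ I <;> simp [c, h1, h2, h3, h4] <;> decide
  -- The product is closed: the four bonds around a square of faces share a site, where `ρ` can be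
  -- evaluated for each crossed bond, and `c` is a coboundary. Hence it has a potential `h`.
  obtain ⟨h, hR, hU⟩ := exists_potential
    (fun f => c f (f + (1, 0)) * ρ (f + (1, 1))) (fun f => c f (f + (0, 1)) * ρ (f + (1, 1))) (by
      intro x y
      have e1 := hcρ (x + 1, y) (x + 1, y + 1) (by rw [adj_iff]; simp)
      have e2 := hcρ (x, y + 1) (x + 1, y + 1) (by rw [adj_iff]; simp)
      have e3 := hsq (x, y) (x + 1, y) (x, y + 1) (x + 1, y + 1)
      simp only [Prod.mk_sup_mk, Prod.mk_inf_mk, Prod.mk_add_mk, sup_idem, inf_idem,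
        sup_of_le_right (show y ≤ y + 1 by omega), inf_of_le_left (show y ≤ y + 1 by omega),
        sup_of_le_right (show x ≤ x + 1 by omega), inf_of_le_left (show x ≤ x + 1 by omega)]
        at e1 e2
      simp only [Prod.mk_add_mk, add_zero]
      rw [← e1, ← e2, ← add_mul, ← add_mul, e3])
  have hstep : ∀ f g, squareLattice.Adj f g → h g = h f + c f g * ρ (f ⊓ g + (1, 1)) := by
    have h0 : ∀ u : ZMod 2, u + u = 0 := by decide
    have hsymm : ∀ f g, c f g = c g f := fun f g => by
      by_cases h1 : f ∈ I <;> by_cases h2 : g ∈ I <;> simp [c, h1, h2]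
    intro f g hfg
    rw [adj_iff] at hfg
    have a1 : ∀ k : Site, k ⊓ (k + (1, 0)) = k := fun k => inf_of_le_left (by
      rw [Prod.le_def]; constructor <;> simp)
    have a2 : ∀ k : Site, k ⊓ (k + (0, 1)) = k := fun k => inf_of_le_left (by
      rw [Prod.le_def]; constructor <;> simp)
    rcases hfg with rfl | rfl | rfl | rfl
    · rw [a1, show f + (1, 0) = (f.1 + 1, f.2) by ext <;> simp, hR f.1 f.2]
      simp only [Prod.mk.eta]
      rw [show f + (1, 0) = (f.1 + 1, f.2) by ext <;> simp]
    · rw [inf_comm, a1, hsymm]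
      have := hR g.1 g.2
      simp only [Prod.mk.eta] at this
      rw [show g + (1, 0) = (g.1 + 1, g.2) by ext <;> simp] at *
      rw [this, add_assoc, h0, add_zero]
    · rw [a2, show f + (0, 1) = (f.1, f.2 + 1) by ext <;> simp, hU f.1 f.2]
      simp only [Prod.mk.eta]
      rw [show f + (0, 1) = (f.1, f.2 + 1) by ext <;> simp]
    · rw [inf_comm, a2, hsymm]
      have := hU g.1 g.2
      simp only [Prod.mk.eta] at this
      rw [show g + (0, 1) = (g.1, g.2 + 1) by ext <;> simp] at *
      rw [this, add_assoc, h0, add_zero]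
  have hsame : ∀ f g, squareLattice.Adj f g → (f ∈ I ↔ g ∈ I) → h g = h f := by
    intro f g hfg hiff
    rw [hstep f g hfg]
    simp [c, hiff]
  have hin : ∀ f ∈ I, h f = h 0 := by
    intro f hf
    have := hf.2
    rw [SimpleGraph.reachable_iff_reflTransGen] at this
    have key : ∀ k, Relation.ReflTransGen (unexplored G m).Adj 0 k → h k = h 0 := by
      intro k hk
      induction hk with
      | refl => rfl
      | tail h1 h2 ih =>
        rw [← SimpleGraph.reachable_iff_reflTransGen] at h1
        rw [hsame _ _ h2.1 (iff_of_true ⟨h2.2.1, h1⟩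
          ⟨h2.2.2, h1.trans (SimpleGraph.Adj.reachable h2)⟩), ih]
    exact key f this
  have hexp : ∀ f ∈ explored G m, f ∉ I := fun f hf hf' => hf'.1 hf
  -- The potential changes only across the cut. It is thus constant on the inner faces, on the
  -- connected outside of the box, and along the exploration starting there.
  have hQ : ∀ q ∉ faceBox m, ∀ q' ∉ faceBox m, h q = h q' := by
    intro q hq q' hq'
    let N := |q.1| + |q.2| + |q'.1| + |q'.2| + m
    have hN : ∀ f : Site, f ∉ faceBox m ↔ (f.1 < -m ∨ m - 1 < f.1 ∨ f.2 < -m ∨ m - 1 < f.2) := by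
      intro f
      simp only [faceBox, Set.mem_ofPred_eq]
      omega
    have hout : ∀ f ∉ faceBox m, f ∉ I := fun f hf hf' => hf (innerFaces_subset hf')
    have n1 := abs_nonneg q.1
    have n2 := abs_nonneg q.2
    have n3 := abs_nonneg q'.1
    have n4 := abs_nonneg q'.2
    refine eq_of_square_annulus h (a := -m) (b := m - 1) (N := N) (by omega) (by omega) _ rfl
      (by omega) (fun x y h1 h2 => ?_) (fun x y h1 h2 => ?_)
      ⟨⟨by omega, by omega⟩, (hN q).1 hq⟩ ⟨⟨by omega, by omega⟩, (hN q').1 hq'⟩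
    · exact hsame _ _ (by rw [adj_iff]; simp)
        (iff_of_false (hout _ ((hN _).2 h1.2)) (hout _ ((hN _).2 h2.2)))
    · exact hsame _ _ (by rw [adj_iff]; simp)
        (iff_of_false (hout _ ((hN _).2 h1.2)) (hout _ ((hN _).2 h2.2)))
  have hX : ∀ f ∈ explored G m, ∃ q ∉ faceBox m, h f = h q := by
    rintro f ⟨q, hq, hqf⟩
    refine ⟨q, hq, ?_⟩
    rw [SimpleGraph.reachable_iff_reflTransGen] at hqf
    induction hqf with
    | refl => rfl
    | tail h1 h2 ih =>
      rw [← SimpleGraph.reachable_iff_reflTransGen] at h1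
      rw [hsame _ _ h2.1 (iff_of_false (hexp _ ⟨q, hq, h1⟩)
        (hexp _ ⟨q, hq, h1.trans (SimpleGraph.Adj.reachable h2)⟩)), ih]
  -- So `ρ` is the same potential difference at every cut bond; it equals 1 at `b`, hence everywhere
  -- on the cut.
  have hcut : ∀ f g, f ∈ I → g ∉ I → squareLattice.Adj f g →
      ∃ q ∉ faceBox m, ρ (f ⊓ g + (1, 1)) = h q - h 0 := by
    intro f g hf hg hfg
    obtain ⟨q, hq, hgq⟩ := hX g (explored_of_adj_innerFaces hf hg hfg)
    refine ⟨q, hq, ?_⟩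
    rw [← hgq, hstep f g hfg, hin f hf]
    simp [c, hf, hg]
  obtain ⟨f, g, hf, hg, hfg, hv⟩ := exists_cut_of_cutSites hb
  obtain ⟨f', g', hf', hg', hfg', hv'⟩ := exists_cut_of_cutSites hb'
  obtain ⟨q, hq, e⟩ := hcut f g hf hg hfg
  obtain ⟨q', hq', e'⟩ := hcut f' g' hf' hg' hfg'
  have r1 : G.Reachable b (f ⊓ g + (1, 1)) := by
    rcases hv with hv | hv
    · rw [hv]; exact (open_of_cut hf hg hfg).reachable
    · rw [← hv]
  have r2 : G.Reachable b (f' ⊓ g' + (1, 1)) := by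
    by_contra hno
    have : ρ (f ⊓ g + (1, 1)) = ρ (f' ⊓ g' + (1, 1)) := by rw [e, e', hQ q hq q' hq']
    simp [ρ, r1, hno] at this
  rcases hv' with hv' | hv'
  · rw [hv']; exact r2.trans (open_of_cut hf' hg' hfg').symm.reachable
  · rw [hv']; exact r2

/-! ### Wired domains inside an open circuit -/

/-- The event that `0` is connected to the boundary of `D`. -/
def arm (D : Finset Site) : Set Config := {ω | ∃ y ∈ boundary D, (openGraph ω).Reachable 0 y}

theorem openGraph_le (ω : Config) : openGraph ω ≤ squareLattice := fun _ _ h => h.1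

theorem openGraph_mono {ω ω' : Config} (h : ω ≤ ω') : openGraph ω ≤ openGraph ω' :=
  fun _ _ ⟨h1, h2⟩ => ⟨h1, Bool.le_iff_imp.1 (h _) h2⟩

theorem arm_isUpperSet (D : Finset Site) : IsUpperSet (arm D) :=
  fun _ _ h ⟨y, hy, hr⟩ => ⟨y, hy, hr.mono (openGraph_mono h)⟩

theorem exists_reachable_boundary {G : SimpleGraph Site} (hG : G ≤ squareLattice)
    {V : Finset Site} {x y : Site} (hx : x ∈ V) (hy : y ∉ V) (h : G.Reachable x y) :
    ∃ z ∈ boundary V, G.Reachable x z := by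
  rw [SimpleGraph.reachable_iff_reflTransGen] at h
  by_contra hno
  have key : ∀ z, Relation.ReflTransGen G.Adj x z → z ∈ V := by
    intro z hz
    induction hz with
    | refl => exact hx
    | @tail u v h1 h2 ih =>
      by_contra hv
      exact hno ⟨u, mem_boundary.2 ⟨ih, v, hv, hG h2⟩,
        (SimpleGraph.reachable_iff_reflTransGen _ _).2 h1⟩
  exact hy (key y h)

/-- The exploration inspects only bonds bordering explored faces. This is its stopping-set property:
resampling the remaining bonds does not change it. -/
theorem explored_congr {G G' : SimpleGraph Site} {m : ℤ}
    (h : ∀ f g, f ∈ explored G m → squareLattice.Adj f g →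
      (G.Adj (f ⊔ g) (f ⊓ g + (1, 1)) ↔ G'.Adj (f ⊔ g) (f ⊓ g + (1, 1)))) :
    explored G' m = explored G m := by
  ext g
  constructor
  · rintro ⟨q, hq, hqg⟩
    rw [SimpleGraph.reachable_iff_reflTransGen] at hqg
    induction hqg with
    | refl => exact ⟨q, hq, SimpleGraph.Reachable.refl q⟩
    | tail h1 h2 ih =>
      obtain ⟨q', hq', hr⟩ := ih
      refine ⟨q', hq', hr.trans (SimpleGraph.Adj.reachable ⟨h2.1, ?_⟩)⟩
      rw [h _ _ ⟨q', hq', hr⟩ h2.1]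
      exact h2.2
  · rintro ⟨q, hq, hqg⟩
    refine ⟨q, hq, ?_⟩
    rw [SimpleGraph.reachable_iff_reflTransGen] at hqg
    induction hqg with
    | refl => exact SimpleGraph.Reachable.refl q
    | tail h1 h2 ih =>
      refine ih.trans (SimpleGraph.Adj.reachable ⟨h2.1, ?_⟩)
      rw [← SimpleGraph.reachable_iff_reflTransGen] at h1
      rw [← h _ _ ⟨q, hq, h1⟩ h2.1]
      exact h2.2

theorem innerFaces_congr {G G' : SimpleGraph Site} {m : ℤ}
    (h : explored G' m = explored G m) : innerFaces G' m = innerFaces G m := by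
  have : unexplored G' m = unexplored G m := by
    ext f g
    simp only [unexplored, h]
  simp only [innerFaces, h, this]

/-- No dual path of closed bonds enters `[-l, l]²` from the outside of `[-m, m]²`. -/
def Shielded (G : SimpleGraph Site) (l m : ℤ) : Prop := ∀ g ∈ explored G m, g ∉ faceBox l

/-- The two faces of the bond `e` belong to `I`. -/
def FacesIn (I : Set Site) (e : Sym2 Site) : Prop :=
  ∃ u v : Site, e = s(u, v) ∧ u ⊓ v ∈ I ∧ u ⊔ v - (1, 1) ∈ I

/-- The bonds of `D` whose two faces belong to `I`. -/
def bondsOfFaces (D : Finset Site) (I : Set Site) : Finset (Sym2 Site) := by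
  classical exact (bondsIn D).filter (FacesIn I)

theorem mem_bondsOfFaces {D : Finset Site} {I : Set Site} {x y : Site} :
    s(x, y) ∈ bondsOfFaces D I ↔
      s(x, y) ∈ bondsIn D ∧ x ⊓ y ∈ I ∧ x ⊔ y - (1, 1) ∈ I := by
  simp only [bondsOfFaces, Finset.mem_filter]
  refine and_congr_right fun _ => ⟨?_, fun h => ⟨x, y, rfl, h⟩⟩
  rintro ⟨u, v, h, h'⟩
  rcases Sym2.eq_iff.1 h with ⟨rfl, rfl⟩ | ⟨rfl, rfl⟩
  · exact h'
  · rwa [inf_comm, sup_comm]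

theorem isFaceOf_of_adj {x y : Site} (h : squareLattice.Adj x y) :
    IsFaceOf (x ⊓ y) x ∧ IsFaceOf (x ⊔ y - (1, 1)) x := by
  obtain ⟨a, b⟩ := x
  obtain ⟨c, d⟩ := y
  rw [adj_iff] at h
  simp only [IsFaceOf, Prod.mk_inf_mk, Prod.mk_sup_mk, Prod.mk_sub_mk, Prod.mk_add_mk,
    Prod.mk.injEq] at *
  rcases h with h | h | h | h <;> omega

theorem dual_faces {f g : Site} (h : squareLattice.Adj f g) :
    ((f ⊔ g) ⊓ (f ⊓ g + (1, 1)) = f ∧ (f ⊔ g) ⊔ (f ⊓ g + (1, 1)) - (1, 1) = g) ∨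
    ((f ⊔ g) ⊓ (f ⊓ g + (1, 1)) = g ∧ (f ⊔ g) ⊔ (f ⊓ g + (1, 1)) - (1, 1) = f) := by
  obtain ⟨a, b⟩ := f
  obtain ⟨c, d⟩ := g
  rw [adj_iff] at h
  simp only [Prod.mk_inf_mk, Prod.mk_sup_mk, Prod.mk_sub_mk, Prod.mk_add_mk,
    Prod.mk.injEq] at *
  rcases h with h | h | h | h <;> omega

theorem abs_le_of_isFaceOf {f x : Site} {m : ℤ} (h : IsFaceOf f x) (hf : f ∈ faceBox m) :
    |x.1| ≤ m ∧ |x.2| ≤ m := by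
  obtain ⟨a, b⟩ := x
  rw [abs_le, abs_le]
  rcases h with rfl | rfl | rfl | rfl <;> simp [faceBox] at hf ⊢ <;> omega

theorem mem_faceBox_of_isFaceOf {f x : Site} {l : ℤ} (h : IsFaceOf f x)
    (h1 : |x.1| < l) (h2 : |x.2| < l) : f ∈ faceBox l := by
  obtain ⟨a, b⟩ := x
  rw [abs_lt] at h1 h2
  rcases h with rfl | rfl | rfl | rfl <;> simp [faceBox] at h1 h2 ⊢ <;> omega

theorem Shielded.faceBox_subset {G : SimpleGraph Site} {l m : ℤ} (hS : Shielded G l m)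
    (hl : 0 < l) : faceBox l ⊆ innerFaces G m := by
  intro f hf
  have hx : ∀ g ∈ faceBox l, g ∉ explored G m := fun g hg hg' => hS g hg' hg
  refine ⟨hx f hf, ?_⟩
  have hstep : ∀ g g', g ∈ faceBox l → g' ∈ faceBox l → squareLattice.Adj g g' →
      (unexplored G m).connectedComponentMk g' = (unexplored G m).connectedComponentMk g := by
    intro g g' hg hg' h
    exact SimpleGraph.ConnectedComponent.sound
      (SimpleGraph.Adj.reachable (G := unexplored G m) ⟨h.symm, hx _ hg', hx _ hg⟩)
  have hor : ∀ x x' y, x ≤ x' → (∀ i, x ≤ i → i ≤ x' → (i, y) ∈ faceBox l) →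
      (unexplored G m).connectedComponentMk (x, y) =
        (unexplored G m).connectedComponentMk (x', y) := fun x x' y hxx hi =>
    eq_of_forall_step (fun i => (unexplored G m).connectedComponentMk (i, y)) hxx
      fun i h1 h2 => hstep _ _ (hi i h1 h2.le) (hi _ (by omega) (by omega))
        (by rw [adj_iff]; simp)
  have ver : ∀ x y y', y ≤ y' → (∀ i, y ≤ i → i ≤ y' → (x, i) ∈ faceBox l) →
      (unexplored G m).connectedComponentMk (x, y) =
        (unexplored G m).connectedComponentMk (x, y') := fun x y y' hyy hi =>
    eq_of_forall_step (fun i => (unexplored G m).connectedComponentMk (x, i)) hyy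
      fun i h1 h2 => hstep _ _ (hi i h1 h2.le) (hi _ (by omega) (by omega))
        (by rw [adj_iff]; simp)
  obtain ⟨x, y⟩ := f
  have hmem : ∀ x y, (x, y) ∈ faceBox l ↔ (-l ≤ x ∧ x < l) ∧ -l ≤ y ∧ y < l :=
    fun _ _ => Iff.rfl
  rw [hmem] at hf
  refine SimpleGraph.ConnectedComponent.exact ?_
  have e1 : (unexplored G m).connectedComponentMk (0, 0) =
      (unexplored G m).connectedComponentMk (x, 0) := by
    rcases le_total 0 x with h | h
    · exact hor 0 x 0 h fun i _ _ => (hmem _ _).2 (by omega)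
    · exact (hor x 0 0 h fun i _ _ => (hmem _ _).2 (by omega)).symm
  have e2 : (unexplored G m).connectedComponentMk (x, 0) =
      (unexplored G m).connectedComponentMk (x, y) := by
    rcases le_total 0 y with h | h
    · exact ver x 0 y h fun i _ _ => (hmem _ _).2 (by omega)
    · exact (ver x y 0 h fun i _ _ => (hmem _ _).2 (by omega)).symm
  exact e1.trans e2

open Classical in
/-- The indicator that `0` is connected to a cut site by the bonds of `S`. -/
def cutInd (I : Set Site) (S : Finset (Sym2 Site)) : ℝ :=
  if ∃ b ∈ cutSites I, (bondGraph S).Reachable 0 b then 1 else 0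

theorem cutInd_nonneg (I : Set Site) (S : Finset (Sym2 Site)) : 0 ≤ cutInd I S := by
  unfold cutInd; split_ifs <;> norm_num

theorem cutInd_monotone (I : Set Site) : Monotone (cutInd I) := by
  intro S T h
  unfold cutInd
  by_cases hS : ∃ b ∈ cutSites I, (bondGraph S).Reachable 0 b
  · obtain ⟨b, hb, hr⟩ := hS
    rw [if_pos ⟨b, hb, hr⟩, if_pos ⟨b, hb, hr.mono (bondGraph_mono h)⟩]
  · rw [if_neg hS]
    exact cutInd_nonneg I T

section

variable {D : Finset Site} {l m : ℤ} {G : SimpleGraph Site}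

/-- Before it leaves the inner faces, a path from `0` only uses bonds between inner faces. -/
theorem ind_arm_le_cutInd (hl : 0 < l) (hm : ∀ x : Site, |x.1| ≤ m → |x.2| ≤ m →
      x ∈ D ∧ x ∉ boundary D) (hG : Shielded G l m) (S : Finset (Sym2 Site)) :
    ind (arm D) S ≤ cutInd (innerFaces G m) (S ∩ bondsOfFaces D (innerFaces G m)) := by
  set I := innerFaces G m
  by_cases hS : configOf S ∈ arm D
  swap
  · rw [ind, Set.indicator_of_notMem hS]
    exact cutInd_nonneg _ _
  rw [ind, Set.indicator_of_mem hS, cutInd]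
  suffices h : ∃ b ∈ cutSites I, (bondGraph (S ∩ bondsOfFaces D I)).Reachable 0 b by
    rw [if_pos h]
  by_contra hno
  obtain ⟨y, hy, hr⟩ := hS
  rw [SimpleGraph.reachable_iff_reflTransGen] at hr
  have hmem : ∀ x f, IsFaceOf f x → f ∈ I → x ∈ D ∧ x ∉ boundary D := fun x f hf hfI =>
    have h := abs_le_of_isFaceOf hf (innerFaces_subset hfI)
    hm x h.1 h.2
  -- If no cut site is reached, the path keeps every face around its current site inner, so each
  -- step uses an inner bond. It then cannot arrive at the boundary of `D`, contrary to the arm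
  -- event.
  have key : ∀ z, Relation.ReflTransGen (openGraph (configOf S)).Adj 0 z →
      (∀ f, IsFaceOf f z → f ∈ I) ∧
        (bondGraph (S ∩ bondsOfFaces D I)).Reachable 0 z := by
    intro z hz
    induction hz with
    | refl =>
      exact ⟨fun f hf => hG.faceBox_subset hl
        (mem_faceBox_of_isFaceOf hf (by simpa using hl) (by simpa using hl)),
        SimpleGraph.Reachable.refl 0⟩
    | @tail u v _ h2 ih =>
      have huv := bondGraph_adj.1 h2
      have hu := isFaceOf_of_adj huv.1
      have hv := isFaceOf_of_adj huv.1.symm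
      rw [inf_comm, sup_comm] at hv
      have i1 := ih.1 _ hu.1
      have i2 := ih.1 _ hu.2
      have hrv : (bondGraph (S ∩ bondsOfFaces D I)).Reachable 0 v := by
        refine ih.2.trans (SimpleGraph.Adj.reachable (bondGraph_adj.2 ⟨huv.1, ?_⟩))
        rw [Finset.mem_inter, mem_bondsOfFaces, mem_bondsIn]
        exact ⟨huv.2, ⟨⟨(hmem u _ hu.1 i1).1, (hmem v _ hv.1 i1).1⟩, huv.1⟩, i1, i2⟩
      refine ⟨fun f hf => ?_, hrv⟩
      by_contra hfI
      exact hno ⟨v, ⟨⟨_, i1, hv.1⟩, f, hfI, hf⟩, hrv⟩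
  exact (hmem y y (Or.inl rfl) ((key y hr).1 y (Or.inl rfl))).2 hy

-- An arm to the boundary of `D` must first reach the cut. The law inside the cut is dominated by
-- the one wired on the cut sites, since these separate the inner bonds from the others and from the
-- wired boundary of `D`.
open Classical in
theorem total_arm_le_cut {p : ℝ} (h0 : 0 ≤ p) (h1 : p < 1) (V : Finset Site) (hl : 0 < l)
    (hm : ∀ x : Site, |x.1| ≤ m → |x.2| ≤ m → x ∈ D ∧ x ∉ boundary D)
    (hG : Shielded G l m) :
    total p V (wiring (D.filter (· ∈ cutSites (innerFaces G m))))
        (bondsOfFaces D (innerFaces G m)) (fun _ => 1) *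
      total p V (wiring (boundary D)) (bondsIn D) (ind (arm D)) ≤
    total p V (wiring (D.filter (· ∈ cutSites (innerFaces G m))))
        (bondsOfFaces D (innerFaces G m)) (cutInd (innerFaces G m)) *
      total p V (wiring (boundary D)) (bondsIn D) (fun _ => 1) := by
  set I := innerFaces G m
  refine le_trans (mul_le_mul_of_nonneg_left ?_ (total_one_pos h0 h1 _).le)
    (total_le_wired (F' := bondsOfFaces D I) (F := bondsIn D) h0 h1 (Finset.filter_subset _ _)
      (D.filter (· ∈ cutSites I)) {x | ∃ f ∈ I, IsFaceOf f x}
      {x | x ∈ D → ∃ f ∉ I, IsFaceOf f x} ?_ ?_ ?_ ?_ ?_ ?_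
      (cutInd_monotone I) (cutInd_nonneg I))
  · exact Finset.sum_le_sum fun S _ => mul_le_mul_of_nonneg_left
      (ind_arm_le_cutInd hl hm hG S) (wt_nonneg h0 h1 _ S)
  · intro x y hxy h
    exact ⟨_, (mem_bondsOfFaces.1 h).2.1, (isFaceOf_of_adj hxy).1⟩
  · intro x hx
    exact (Finset.mem_filter.1 hx).2.1
  · intro x y hxy h _
    rw [Finset.mem_sdiff, mem_bondsOfFaces] at h
    by_cases h' : x ⊓ y ∈ I
    · exact ⟨_, fun h'' => h.2 ⟨h.1, h', h''⟩, (isFaceOf_of_adj hxy).2⟩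
    · exact ⟨_, h', (isFaceOf_of_adj hxy).1⟩
  · intro x hx _
    exact (Finset.mem_filter.1 hx).2.2
  · intro x y hxy _
    refine ⟨x, fun hx => ?_, Or.inl rfl⟩
    have h := abs_le_of_isFaceOf (Or.inl rfl) (innerFaces_subset hx)
    exact (hm x h.1 h.2).2 hxy.2.1
  · rintro x ⟨⟨f, hf, hfx⟩, hx⟩
    have h := abs_le_of_isFaceOf hfx (innerFaces_subset hf)
    have hxD := (hm x h.1 h.2).1
    exact Finset.mem_filter.2 ⟨hxD, ⟨f, hf, hfx⟩, hx hxD⟩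

open Classical in
/-- The outside of an open circuit acts on its inside like a wired boundary condition. -/
theorem total_cut_eq_wired {p : ℝ} {V W : Finset Site} (hDV : D ⊆ V) (hWV : W ⊆ V)
    (hWD : W ∩ D = ∅) (hm : ∀ x : Site, |x.1| ≤ m → |x.2| ≤ m → x ∈ D ∧ x ∉ boundary D)
    (hm0 : 0 < m) {T : Finset (Sym2 Site)} (hT : T ⊆ bondsIn V)
    (hTd : Disjoint T (bondsOfFaces D (innerFaces (bondGraph T) m))) :
    ∃ a > 0, ∀ f, total p V (bondGraph T ⊔ wiring W)
        (bondsOfFaces D (innerFaces (bondGraph T) m)) f =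
      a * total p V (wiring (D.filter (· ∈ cutSites (innerFaces (bondGraph T) m))))
        (bondsOfFaces D (innerFaces (bondGraph T) m)) f := by
  set I := innerFaces (bondGraph T) m with hI
  set B := D.filter (· ∈ cutSites I) with hB
  have hD : ∀ f ∈ I, ∀ x, IsFaceOf f x → x ∈ D := fun f hf x hfx =>
    have h := abs_le_of_isFaceOf hfx (innerFaces_subset hf)
    (hm x h.1 h.2).1
  -- The cut sites are already joined by open bonds of `T`, so wiring them is free.
  have hBV : ∀ S ⊆ bondsOfFaces D I, clusters V (bondGraph S ⊔ (bondGraph T ⊔ wiring W ⊔ wiring B)) =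
      clusters V (bondGraph S ⊔ (bondGraph T ⊔ wiring W)) := by
    intro S hS
    rw [← sup_assoc]
    refine clusters_sup_wiring V B ?_ ?_
    · rintro x y (h | h | h)
      · have := (mem_bondsOfFaces.1 (hS (bondGraph_adj.1 h).2)).1
        exact hDV (mem_bondsIn.1 this).1.2
      · exact (mem_bondsIn.1 (hT (bondGraph_adj.1 h).2)).1.2
      · exact hWV h.2.2
    · intro x hx y hy
      rw [hB, Finset.mem_filter] at hx hy
      exact (cutSites_reachable (bondGraph T) hm0 hx.2 hy.2).mono
        (le_sup_left.trans le_sup_right)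
  have e1 : ∀ f, total p V (bondGraph T ⊔ wiring W) (bondsOfFaces D I) f =
      total p V (bondGraph T ⊔ wiring W ⊔ wiring B) (bondsOfFaces D I) f := by
    intro f
    refine Finset.sum_congr rfl fun S hS => ?_
    rw [wt, wt, hBV S (Finset.mem_powerset.1 hS)]
  -- Sites of `T` or of `W` that lie in `D` have a face outside `I`; the exterior meets the inner
  -- bonds only through the cut sites.
  have e2 := fun f => total_decouple (p := p) (V := V) (F := bondsOfFaces D I) B
    (H := bondGraph T ⊔ wiring W ⊔ wiring B)
    {x | ∃ f ∈ I, IsFaceOf f x} {x | x ∈ D → ∃ f ∉ I, IsFaceOf f x}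
    (fun x y hxy h => ⟨_, (mem_bondsOfFaces.1 h).2.1, (isFaceOf_of_adj hxy).1⟩)
    (fun x hx => (Finset.mem_filter.1 hx).2.1) (by
      rintro x y ((h | h) | h) hx
      · rw [bondGraph_adj] at h
        have hn : s(x, y) ∉ bondsOfFaces D I := Finset.disjoint_left.1 hTd h.2
        rw [mem_bondsOfFaces, mem_bondsIn] at hn
        have hy := isFaceOf_of_adj h.1.symm
        rw [inf_comm, sup_comm] at hy
        by_cases h' : x ⊓ y ∈ I
        · exact ⟨_, fun h'' => hn ⟨⟨⟨hx, hD _ h' _ hy.1⟩, h.1⟩, h', h''⟩,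
            (isFaceOf_of_adj h.1).2⟩
        · exact ⟨_, h', (isFaceOf_of_adj h.1).1⟩
      · have : x ∈ W ∩ D := Finset.mem_inter.2 ⟨h.2.1, hx⟩
        simp [hWD] at this
      · exact (Finset.mem_filter.1 h.2.1).2.2)
    (by
      rintro x ⟨⟨f, hf, hfx⟩, hx⟩
      have hxD := hD f hf x hfx
      exact Finset.mem_filter.2 ⟨hxD, ⟨f, hf, hfx⟩, hx hxD⟩) le_sup_right f
  refine ⟨2 ^ clusters V (bondGraph T ⊔ wiring W ⊔ wiring B) / 2 ^ clusters V (wiring B),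
    by positivity, fun f => ?_⟩
  rw [e1, div_mul_eq_mul_div, eq_div_iff (by positivity), mul_comm, e2]

open Classical in
/-- Inside an open circuit, `0` is connected to distance `l` at least as likely as it is connected
to the wired boundary of a larger domain. -/
theorem sum_shielded_le {p : ℝ} (h0 : 0 ≤ p) (h1 : p < 1) {V W D' : Finset Site} (hDV : D ⊆ V)
    (hWV : W ⊆ V) (hWD : W ∩ D = ∅) (hl : 0 < l) (hm0 : 0 < m)
    (hm : ∀ x : Site, |x.1| ≤ m → |x.2| ≤ m → x ∈ D ∧ x ∉ boundary D)
    (h0D' : (0 : Site) ∈ D') (hD' : ∀ x ∈ D', |x.1| < l ∧ |x.2| < l) :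
    total p V (wiring (boundary D)) (bondsIn D) (ind (arm D)) *
      ∑ S ∈ (bondsIn V).powerset.filter (fun S => Shielded (bondGraph S) l m),
        wt p V (wiring W) (bondsIn V) S ≤
    total p V (wiring (boundary D)) (bondsIn D) (fun _ => 1) *
      ∑ S ∈ (bondsIn V).powerset.filter (fun S => Shielded (bondGraph S) l m),
        wt p V (wiring W) (bondsIn V) S * ind (arm D') S := by
  set N := total p V (wiring (boundary D)) (bondsIn D) (ind (arm D))
  set Z := total p V (wiring (boundary D)) (bondsIn D) (fun _ => 1) with hZ
  have hZ0 : 0 < Z := total_one_pos h0 h1 _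
  have h1' : 0 ≤ 1 - p := by linarith
  rw [← sub_nonneg, Finset.mul_sum, Finset.mul_sum, ← Finset.sum_sub_distrib]
  -- The bonds to be resampled are those with both faces inner; everything else, including the cut
  -- itself, is kept fixed.
  let L : Finset (Sym2 Site) → Finset (Sym2 Site) :=
    fun S => bondsOfFaces D (innerFaces (bondGraph S) m)
  have hLV : ∀ S, L S ⊆ bondsIn V := fun S =>
    (Finset.filter_subset _ _).trans (bondsIn_mono hDV)
  have hexp : ∀ S, ∀ S' ⊆ L S,
      explored (bondGraph ((S \ L S) ∪ S')) m = explored (bondGraph S) m := by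
    intro S S' hS'
    refine explored_congr fun f g hf hfg => ?_
    have hn : s(f ⊔ g, f ⊓ g + (1, 1)) ∉ L S := by
      intro h
      rw [mem_bondsOfFaces] at h
      rcases dual_faces hfg with e | e
      · rw [e.1] at h; exact h.2.1.1 hf
      · rw [e.2] at h; exact h.2.2.1 hf
    rw [bondGraph_adj, bondGraph_adj, Finset.mem_union, Finset.mem_sdiff]
    refine and_congr_right fun _ => ⟨fun h => Or.inl ⟨h, hn⟩, ?_⟩
    rintro (h | h)
    · exact h.1
    · exact (hn (hS' h)).elim
  have hL : ∀ S, ∀ S' ⊆ L S, L ((S \ L S) ∪ S') = L S := fun S S' hS' => by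
    simp only [L, innerFaces_congr (hexp S S' hS')]
  refine sum_nonneg_of_exploration L (fun S hS S' hS' => ⟨?_, hL S S' hS'⟩) _ fun S hS => ?_
  · rw [Finset.mem_filter, Finset.mem_powerset] at hS ⊢
    refine ⟨Finset.union_subset (Finset.sdiff_subset.trans hS.1) (hS'.trans (hLV S)), ?_⟩
    rw [Shielded, hexp S S' hS']
    exact hS.2
  · rw [Finset.mem_filter, Finset.mem_powerset] at hS
    set T := S \ L S with hT
    have hTL : L T = L S := by simpa using hL S ∅ (Finset.empty_subset _)
    have hTsh : Shielded (bondGraph T) l m := by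
      have := hexp S ∅ (Finset.empty_subset _)
      rw [Finset.union_empty] at this
      rw [Shielded, this]
      exact hS.2
    have hTsub : T ⊆ bondsIn V \ L S := Finset.sdiff_subset_sdiff hS.1 subset_rfl
    set I := innerFaces (bondGraph T) m with hI
    -- A cut site has a non-inner face, whereas all faces around a site of `D'` lie in `faceBox l`
    -- and are inner. Reaching the cut therefore means leaving `D'`.
    have harm : ∀ S' ⊆ L S, cutInd I S' ≤ ind (arm D') (T ∪ S') := by
      intro S' _
      by_cases h : ∃ b ∈ cutSites I, (bondGraph S').Reachable 0 b
      swap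
      · rw [cutInd, if_neg h]
        exact ind_nonneg _ _
      · rw [cutInd, if_pos h, ind, Set.indicator_of_mem]
        obtain ⟨b, hb, hr⟩ := h
        refine exists_reachable_boundary (openGraph_le _) h0D' (y := b) (fun hbD => ?_)
          (hr.mono (bondGraph_mono Finset.subset_union_right))
        obtain ⟨_, f, hf, hfb⟩ := hb
        exact hf (hTsh.faceBox_subset hl
          (mem_faceBox_of_isFaceOf hfb (hD' b hbD).1 (hD' b hbD).2))
    have hcalc : ∑ S' ∈ (L S).powerset, wt p V (wiring W) (bondsIn V) (T ∪ S') *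
          (Z * cutInd I S' - N) ≤
        ∑ S' ∈ (L S).powerset, (Z * (wt p V (wiring W) (bondsIn V) (T ∪ S') *
          ind (arm D') (T ∪ S')) - N * wt p V (wiring W) (bondsIn V) (T ∪ S')) := by
      refine Finset.sum_le_sum fun S' hS' => ?_
      have hw := wt_nonneg (V := V) (F := bondsIn V) h0 h1 (wiring W) (T ∪ S')
      have := mul_le_mul_of_nonneg_left (harm S' (Finset.mem_powerset.1 hS')) hw
      nlinarith [mul_le_mul_of_nonneg_left this hZ0.le]
    refine le_trans ?_ hcalc
    rw [sum_wt_conditional (hLV S) _ hTsub]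
    refine mul_nonneg (by positivity) ?_
    -- Given the explored part, the inner law is wired on the cut up to a factor `a > 0`, and
    -- `total_arm_le_cut` applies.
    obtain ⟨a, ha, hae⟩ := total_cut_eq_wired (p := p) hDV hWV hWD hm hm0
      (hTsub.trans Finset.sdiff_subset)
      (by
        change Disjoint T (L T)
        rw [hTL]
        exact Finset.sdiff_disjoint)
    change ∀ f, total p V (bondGraph T ⊔ wiring W) (L T) f = a * total p V _ (L T) f at hae
    rw [hTL] at hae
    rw [hae]
    refine mul_nonneg ha.le ?_
    have hcut := total_arm_le_cut h0 h1 V hl hm hTsh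
    change total p V _ (L T) _ * N ≤ total p V _ (L T) _ * Z at hcut
    rw [hTL] at hcut
    simp only [total, Finset.sum_mul] at hcut ⊢
    rw [← sub_nonneg, ← Finset.sum_sub_distrib] at hcut
    exact hcut.trans_eq (Finset.sum_congr rfl fun S' _ => by ring)

/-- Normalized form of `sum_shielded_le`: `C` is contained in the shielded configurations, and
dropping the shielding on the right only increases the sum. -/
theorem fkMeasure_arm_ge {p : ℝ} (h0 : 0 ≤ p) (h1 : p < 1) {V W D' : Finset Site} (hDV : D ⊆ V)
    (hWV : W ⊆ V) (hWD : W ∩ D = ∅) (hl : 0 < l) (hm0 : 0 < m)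
    (hm : ∀ x : Site, |x.1| ≤ m → |x.2| ≤ m → x ∈ D ∧ x ∉ boundary D)
    (h0D' : (0 : Site) ∈ D') (hD' : ∀ x ∈ D', |x.1| < l ∧ |x.2| < l)
    (hA : MeasurableSet (arm D)) (hA' : MeasurableSet (arm D')) {C : Set Config}
    (hC : MeasurableSet C) (hCsh : ∀ ω ∈ C, Shielded (openGraph ω) l m) :
    (fkMeasure p D (boundary D)).real (arm D) * (fkMeasure p V W).real C ≤
      (fkMeasure p V W).real (arm D') := by
  classical
  have h := sum_shielded_le h0 h1 hDV hWV hWD hl hm0 hm h0D' hD'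
  have hZ := total_one_pos (V := D) (F := bondsIn D) h0 h1 (wiring (boundary D))
  have hZ' := total_one_pos (V := V) (F := bondsIn V) h0 h1 (wiring W)
  rw [total_extend hDV boundary_subset subset_rfl, total_extend hDV boundary_subset subset_rfl,
    mul_assoc, mul_assoc] at h
  have h := le_of_mul_le_mul_left h (by positivity)
  have hw : ∀ S, 0 ≤ wt p V (wiring W) (bondsIn V) S := fun S => wt_nonneg h0 h1 _ S
  have e1 : total p V (wiring W) (bondsIn V) (ind C) ≤
      ∑ S ∈ (bondsIn V).powerset.filter (fun S => Shielded (bondGraph S) l m),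
        wt p V (wiring W) (bondsIn V) S := by
    rw [total, Finset.sum_filter]
    refine Finset.sum_le_sum fun S _ => ?_
    by_cases hS : configOf S ∈ C
    · rw [if_pos (show Shielded (bondGraph S) l m from hCsh _ hS), ind, Set.indicator_of_mem hS, mul_one]
    · rw [ind, Set.indicator_of_notMem hS, mul_zero]
      split_ifs
      exacts [hw S, le_rfl]
  have e2 : ∑ S ∈ (bondsIn V).powerset.filter (fun S => Shielded (bondGraph S) l m),
        wt p V (wiring W) (bondsIn V) S * ind (arm D') S ≤
      total p V (wiring W) (bondsIn V) (ind (arm D')) :=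
    Finset.sum_le_sum_of_subset_of_nonneg (Finset.filter_subset _ _)
      fun S _ _ => mul_nonneg (hw S) (ind_nonneg _ S)
  have e3 := (mul_le_mul_of_nonneg_left e1 (total_nonneg (V := D) (F := bondsIn D) h0 h1
    (wiring (boundary D)) (ind_nonneg (arm D)))).trans
    (h.trans (mul_le_mul_of_nonneg_left e2 hZ.le))
  rw [fkMeasure_real h0 h1 hA, fkMeasure_real h0 h1 hC, fkMeasure_real h0 h1 hA',
    div_mul_div_comm, div_le_div_iff₀ (by positivity) hZ']
  nlinarith [mul_le_mul_of_nonneg_right e3 hZ'.le]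

end

/-! ### Separating sets in the plane -/

/-- `D` is a bounded connected open set whose boundary is contained in the connected set `γ`. -/
structure IsLoop (γ D : Set Plane) : Prop where
  preconnected : IsPreconnected γ
  isOpen : IsOpen D
  preconnected_inner : IsPreconnected D
  closure_subset : closure D ⊆ D ∪ γ
  disjoint : Disjoint D γ
  bounded : Bornology.IsBounded D
  nonempty : D.Nonempty

theorem not_isBounded_univ_plane : ¬ Bornology.IsBounded (Set.univ : Set Plane) :=
  NormedSpace.noncompactSpace ℝ Plane |> fun _ h =>
    noncompact_univ Plane (Metric.isCompact_of_isClosed_isBounded isClosed_univ h)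

/-- Within a connected set missing `γ`, the open set `D` is also relatively closed. -/
theorem IsLoop.inter_nonempty {γ D : Set Plane} (h : IsLoop γ D) {s : Set Plane}
    (hs : IsPreconnected s) (h1 : (s ∩ D).Nonempty) (h2 : ¬ s ⊆ D) : (s ∩ γ).Nonempty := by
  by_contra hno
  refine h2 (hs.subset_of_closure_inter_subset h.isOpen h1 ?_)
  rintro z ⟨hz, hzs⟩
  rcases h.closure_subset hz with hz | hz
  · exact hz
  · exact (hno ⟨z, hzs, hz⟩).elim

theorem IsLoop.gamma_nonempty {γ D : Set Plane} (h : IsLoop γ D) : γ.Nonempty := by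
  have hD : ¬ (Set.univ : Set Plane) ⊆ D := fun hD =>
    not_isBounded_univ_plane (h.bounded.subset hD)
  obtain ⟨z, -, hz⟩ := h.inter_nonempty isPreconnected_univ
    (by rw [Set.univ_inter]; exact h.nonempty) hD
  exact ⟨z, hz⟩

/-- Two regions that meet and are not nested would each cross the loop of the other. Connectedness
then puts each loop inside the other region, which makes `D ∪ D'` open, closed and bounded in the
plane, a contradiction. -/
theorem IsLoop.ssubset_or_ssubset {γ D γ' D' : Set Plane} (h : IsLoop γ D) (h' : IsLoop γ' D')
    (hγ : Disjoint γ γ') (hD : (D ∩ D').Nonempty) : D ⊂ D' ∨ D' ⊂ D := by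
  have hne : D ≠ D' := by
    rintro rfl
    obtain ⟨x, hx⟩ := h.nonempty
    have hcl : ¬ (Set.univ : Set Plane) ⊆ D := fun hD =>
      not_isBounded_univ_plane (h.bounded.subset hD)
    refine hcl (isPreconnected_univ.subset_of_closure_inter_subset h.isOpen ⟨x, trivial, hx⟩ ?_)
    rintro z ⟨hz, -⟩
    rcases h.closure_subset hz with hz1 | hz1
    · exact hz1
    · rcases h'.closure_subset hz with hz2 | hz2
      · exact hz2
      · exact (Set.disjoint_left.1 hγ hz1 hz2).elim
  by_cases h1 : D ⊆ D'
  · exact Or.inl (lt_of_le_of_ne h1 hne)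
  by_cases h2 : D' ⊆ D
  · exact Or.inr (lt_of_le_of_ne h2 hne.symm)
  exfalso
  have k1 := h'.inter_nonempty h.preconnected_inner hD h1
  have k2 := h.inter_nonempty h'.preconnected_inner (by rwa [Set.inter_comm]) h2
  have s1 : γ' ⊆ D := by
    by_contra hno
    obtain ⟨z, hz, hz'⟩ := h.inter_nonempty h'.preconnected (by rwa [Set.inter_comm]) hno
    exact Set.disjoint_left.1 hγ hz' hz
  have s2 : γ ⊆ D' := by
    by_contra hno
    obtain ⟨z, hz, hz'⟩ := h'.inter_nonempty h.preconnected (by rwa [Set.inter_comm]) hno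
    exact Set.disjoint_left.1 hγ hz hz'
  refine not_isBounded_univ_plane ((h.bounded.union h'.bounded).subset
    (isPreconnected_univ.subset_of_closure_inter_subset (h.isOpen.union h'.isOpen)
      ((h.nonempty.mono Set.subset_union_left).mono fun z hz => ⟨trivial, hz⟩) ?_))
  rintro z ⟨hz, -⟩
  rw [closure_union] at hz
  rcases hz with hz | hz
  · rcases h.closure_subset hz with hz | hz
    · exact Or.inl hz
    · exact Or.inr (s2 hz)
  · rcases h'.closure_subset hz with hz | hz
    · exact Or.inr hz
    · exact Or.inl (s1 hz)

/-- The component of `x` in the complement of a bounded set only contains points that are not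
farther from `x`, if it is bounded. -/
theorem connectedComponentIn_subset_closedBall {γ : Set Plane} {x : Plane} {ρ : ℝ}
    (hγ : γ ⊆ Metric.closedBall x ρ) (hρ : 0 ≤ ρ)
    (hb : Bornology.IsBounded (connectedComponentIn γᶜ x)) :
    connectedComponentIn γᶜ x ⊆ Metric.closedBall x ρ := by
  intro z hz
  by_contra hzρ
  rw [Metric.mem_closedBall, not_le, dist_eq_norm] at hzρ
  -- The ray from `z` away from `x` stays farther than `ρ` from `x`, misses `γ`, and would make the
  -- component unbounded.
  let f : ℝ → Plane := fun t => x + t • (z - x)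
  have hf : Continuous f := by fun_prop
  have hf1 : f 1 = z := by simp [f]
  have hsub : f '' Set.Ici 1 ⊆ connectedComponentIn γᶜ x := by
    rw [connectedComponentIn_eq hz]
    refine (isPreconnected_Ici.image f hf.continuousOn).subset_connectedComponentIn
      ⟨1, Set.self_mem_Ici, hf1⟩ ?_
    rintro _ ⟨t, ht, rfl⟩ hmem
    have h1 := hγ hmem
    have ht' : (1 : ℝ) ≤ t := ht
    rw [Metric.mem_closedBall, dist_eq_norm, add_sub_cancel_left, norm_smul,
      Real.norm_of_nonneg (by linarith)] at h1
    nlinarith [norm_nonneg (z - x)]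
  obtain ⟨C, hC⟩ := isBounded_iff_forall_norm_le.1 (hb.subset hsub)
  have hpos : 0 < ‖z - x‖ := lt_of_le_of_lt hρ hzρ
  set t : ℝ := max 1 ((C + ‖x‖ + 1) / ‖z - x‖) with ht
  have h1 := hC (f t) ⟨t, Set.mem_Ici.2 (le_max_left _ _), rfl⟩
  have h2 : ‖t • (z - x)‖ ≤ ‖f t‖ + ‖x‖ := by
    have : t • (z - x) = f t - x := by simp [f]
    rw [this]; exact norm_sub_le _ _
  rw [norm_smul, Real.norm_of_nonneg (le_trans zero_le_one (le_max_left _ _))] at h2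
  have h3 : (C + ‖x‖ + 1) / ‖z - x‖ ≤ t := le_max_right _ _
  rw [div_le_iff₀ hpos] at h3
  linarith

/-! ### Curves traced by lattice paths -/

theorem toPlane_zero (x : Site) : toPlane x 0 = x.1 := rfl

theorem toPlane_one (x : Site) : toPlane x 1 = x.2 := rfl

theorem toPlane_add (x y : Site) : toPlane (x + y) = toPlane x + toPlane y := by
  ext i
  fin_cases i <;> simp [toPlane]

theorem abs_apply_le_norm (z : Plane) (i : Fin 2) : |z i| ≤ ‖z‖ := by
  simpa using PiLp.norm_apply_le z i

theorem norm_le_abs_add_abs (z : Plane) : ‖z‖ ≤ |z 0| + |z 1| := by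
  rw [EuclideanSpace.norm_eq, Fin.sum_univ_two, Real.norm_eq_abs, Real.norm_eq_abs]
  refine Real.sqrt_le_iff.2 ⟨by positivity, ?_⟩
  nlinarith [abs_nonneg (z 0), abs_nonneg (z 1)]

theorem segment_bounds {u v z : Plane} (h : z ∈ segment ℝ u v) (i : Fin 2) :
    min (u i) (v i) ≤ z i ∧ z i ≤ max (u i) (v i) := by
  obtain ⟨a, b, ha, hb, hab, rfl⟩ := h
  have e : (a • u + b • v) i = a * u i + b * v i := by simp
  rw [e]
  have hb' : b = 1 - a := by linarith
  subst hb'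
  constructor
  · nlinarith [mul_le_mul_of_nonneg_left (min_le_left (u i) (v i)) ha,
      mul_le_mul_of_nonneg_left (min_le_right (u i) (v i)) hb]
  · nlinarith [mul_le_mul_of_nonneg_left (le_max_left (u i) (v i)) ha,
      mul_le_mul_of_nonneg_left (le_max_right (u i) (v i)) hb]

/-- Lattice bonds can only meet at a lattice site. Overlapping coordinate ranges give integer
inequalities that settle every orientation. -/
theorem exists_common_of_segments {x y u v : Site} (hxy : squareLattice.Adj x y)
    (huv : squareLattice.Adj u v) {z : Plane} (h1 : z ∈ segment ℝ (toPlane x) (toPlane y))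
    (h2 : z ∈ segment ℝ (toPlane u) (toPlane v)) :
    (x = u ∨ x = v) ∨ (y = u ∨ y = v) := by
  have a := segment_bounds h1 0
  have b := segment_bounds h1 1
  have c := segment_bounds h2 0
  have d := segment_bounds h2 1
  simp only [toPlane_zero, toPlane_one] at a b c d
  have e1 : min x.1 y.1 ≤ max u.1 v.1 := by exact_mod_cast a.1.trans c.2
  have e2 : min u.1 v.1 ≤ max x.1 y.1 := by exact_mod_cast c.1.trans a.2
  have e3 : min x.2 y.2 ≤ max u.2 v.2 := by exact_mod_cast b.1.trans d.2
  have e4 : min u.2 v.2 ≤ max x.2 y.2 := by exact_mod_cast d.1.trans b.2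
  clear a b c d h1 h2
  rw [adj_iff] at hxy huv
  obtain ⟨x1, x2⟩ := x
  obtain ⟨y1, y2⟩ := y
  obtain ⟨u1, u2⟩ := u
  obtain ⟨v1, v2⟩ := v
  simp only [Prod.mk_add_mk, Prod.mk.injEq] at *
  rcases hxy with h | h | h | h <;> rcases huv with h' | h' | h' | h' <;> omega

/-- The center of a face. -/
def center (f : Site) : Plane := !₂[(f.1 : ℝ) + 1 / 2, (f.2 : ℝ) + 1 / 2]

/-- A dual step crosses exactly one lattice bond. Coordinates are doubled to make the half-integers
integral. -/
theorem dual_bond_of_segments {f g u v : Site} (hfg : squareLattice.Adj f g)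
    (huv : squareLattice.Adj u v) {z : Plane} (h1 : z ∈ segment ℝ (center f) (center g))
    (h2 : z ∈ segment ℝ (toPlane u) (toPlane v)) : s(u, v) = s(f ⊔ g, f ⊓ g + (1, 1)) := by
  have a := segment_bounds h1 0
  have b := segment_bounds h1 1
  have c := segment_bounds h2 0
  have d := segment_bounds h2 1
  have c0 : ∀ f : Site, center f 0 = f.1 + 1 / 2 := fun _ => rfl
  have c1 : ∀ f : Site, center f 1 = f.2 + 1 / 2 := fun _ => rfl
  simp only [toPlane_zero, toPlane_one, c0, c1, min_add_add_right, max_add_add_right] at a b c d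
  have e1 : 2 * min f.1 g.1 + 1 ≤ 2 * max u.1 v.1 := by
    have := a.1.trans c.2
    have : (2 * min (f.1 : ℝ) g.1 + 1) ≤ 2 * max (u.1 : ℝ) v.1 := by linarith
    exact_mod_cast this
  have e2 : 2 * min u.1 v.1 ≤ 2 * max f.1 g.1 + 1 := by
    have := c.1.trans a.2
    have : 2 * min (u.1 : ℝ) v.1 ≤ (2 * max (f.1 : ℝ) g.1 + 1) := by linarith
    exact_mod_cast this
  have e3 : 2 * min f.2 g.2 + 1 ≤ 2 * max u.2 v.2 := by
    have := b.1.trans d.2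
    have : (2 * min (f.2 : ℝ) g.2 + 1) ≤ 2 * max (u.2 : ℝ) v.2 := by linarith
    exact_mod_cast this
  have e4 : 2 * min u.2 v.2 ≤ 2 * max f.2 g.2 + 1 := by
    have := d.1.trans b.2
    have : 2 * min (u.2 : ℝ) v.2 ≤ (2 * max (f.2 : ℝ) g.2 + 1) := by linarith
    exact_mod_cast this
  clear a b c d h1 h2 c0 c1
  rw [adj_iff] at hfg huv
  rw [Sym2.eq_iff]
  obtain ⟨x1, x2⟩ := f
  obtain ⟨y1, y2⟩ := g
  obtain ⟨u1, u2⟩ := u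
  obtain ⟨v1, v2⟩ := v
  simp only [Prod.mk_add_mk, Prod.mk.injEq, Prod.mk_inf_mk, Prod.mk_sup_mk] at *
  rcases hfg with h | h | h | h <;> rcases huv with h' | h' | h' | h' <;> omega

section

variable {G : SimpleGraph Site} {u v : Site}

theorem mem_trace {a : ℝ} {c : G.Walk u v} {z : Plane} : z ∈ trace a c ↔
    ∃ x y, s(x, y) ∈ c.edges ∧ z ∈ segment ℝ (a • toPlane x) (a • toPlane y) := by
  constructor
  · rintro ⟨d, hd, hz⟩
    exact ⟨d.fst, d.snd, List.mem_map.2 ⟨d, hd, rfl⟩, hz⟩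
  · rintro ⟨x, y, he, hz⟩
    obtain ⟨d, hd, hde⟩ := List.mem_map.1 he
    refine ⟨d, hd, ?_⟩
    rcases SimpleGraph.dart_edge_eq_mk'_iff'.1 hde with ⟨h1, h2⟩ | ⟨h1, h2⟩
    · rw [h1, h2]; exact hz
    · rw [h1, h2, segment_symm]; exact hz

theorem mem_trace_one {c : G.Walk u v} {z : Plane} : z ∈ trace 1 c ↔
    ∃ x y, s(x, y) ∈ c.edges ∧ z ∈ segment ℝ (toPlane x) (toPlane y) := by
  simp only [mem_trace, one_smul]

theorem trace_nil (a : ℝ) : trace a (SimpleGraph.Walk.nil : G.Walk u u) = ∅ := by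
  ext z; simp [trace]

theorem trace_cons (a : ℝ) {w : Site} (h : G.Adj u v) (c : G.Walk v w) :
    trace a (SimpleGraph.Walk.cons h c) =
      segment ℝ (a • toPlane u) (a • toPlane v) ∪ trace a c := by
  ext z; simp [trace]

theorem isCompact_trace (a : ℝ) (c : G.Walk u v) : IsCompact (trace a c) := by
  induction c with
  | nil => rw [trace_nil]; exact isCompact_empty
  | cons h c ih =>
    rw [trace_cons]
    refine IsCompact.union ?_ ih
    rw [segment_eq_image_lineMap]
    exact isCompact_Icc.image AffineMap.lineMap_continuous

/-- The starting point is inserted because the trace of a trivial walk is empty. -/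
theorem isPreconnected_insert_trace (a : ℝ) (c : G.Walk u v) :
    IsPreconnected (insert (a • toPlane u) (trace a c)) := by
  induction c with
  | nil => rw [trace_nil, insert_empty_eq]; exact isPreconnected_singleton
  | @cons u v w h c ih =>
    rw [trace_cons]
    have e : insert (a • toPlane u) (segment ℝ (a • toPlane u) (a • toPlane v) ∪ trace a c) =
        segment ℝ (a • toPlane u) (a • toPlane v) ∪ insert (a • toPlane v) (trace a c) := by
      ext z
      have h1 : z = a • toPlane u → z ∈ segment ℝ (a • toPlane u) (a • toPlane v) :=
        fun h => h ▸ left_mem_segment ℝ _ _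
      have h2 : z = a • toPlane v → z ∈ segment ℝ (a • toPlane u) (a • toPlane v) :=
        fun h => h ▸ right_mem_segment ℝ _ _
      simp only [Set.mem_insert_iff, Set.mem_union]
      tauto
    rw [e]
    exact IsPreconnected.union (a • toPlane v) (right_mem_segment ℝ _ _) (Set.mem_insert _ _)
      (convex_segment _ _).isPreconnected ih

theorem insert_trace_eq {a : ℝ} {c : G.Walk u v} (hc : ¬ c.Nil) :
    insert (a • toPlane u) (trace a c) = trace a c := by
  cases c with
  | nil => simp at hc
  | cons h c =>
    rw [trace_cons]
    exact Set.insert_eq_of_mem (Or.inl (left_mem_segment ℝ _ _))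

theorem reachable_of_traces_meet {ω : Config} {u v u' v' : Site} {c : (openGraph ω).Walk u v}
    {c' : (openGraph ω).Walk u' v'} (h : (trace 1 c ∩ trace 1 c').Nonempty) :
    (openGraph ω).Reachable u u' := by
  obtain ⟨z, h1, h2⟩ := h
  rw [mem_trace_one] at h1 h2
  obtain ⟨x, y, he, hz⟩ := h1
  obtain ⟨x', y', he', hz'⟩ := h2
  have ha := openGraph_le ω (c.adj_of_mem_edges he)
  have ha' := openGraph_le ω (c'.adj_of_mem_edges he')
  have r : ∀ {w w' : Site} (c : (openGraph ω).Walk w w') {t}, t ∈ c.support →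
      (openGraph ω).Reachable w t := fun c _ ht => ⟨c.takeUntil _ ht⟩
  have rx := r c (c.fst_mem_support_of_mem_edges he)
  have ry := r c (c.snd_mem_support_of_mem_edges he)
  have rx' := r c' (c'.fst_mem_support_of_mem_edges he')
  have ry' := r c' (c'.snd_mem_support_of_mem_edges he')
  rcases exists_common_of_segments ha ha' hz hz' with (rfl | rfl) | (rfl | rfl)
  · exact rx.trans rx'.symm
  · exact rx.trans ry'.symm
  · exact ry.trans rx'.symm
  · exact ry.trans ry'.symm

end

/-! ### Open circuits -/

/-- The closure of a component of the complement adds only points of the trace, since a further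
point of the complement could be adjoined to the component, which is maximal. Boundedness is part of
the event. -/
theorem isLoop_of_circuit {ω : Config} {x : Plane} {ρ₁ ρ₂ : ℝ} (hρ : 0 < ρ₁) {v : Site}
    {c : (openGraph ω).Walk v v} (hc : c.IsCycle)
    (htr : trace 1 c ⊆ {z | ρ₁ ≤ dist z x ∧ dist z x ≤ ρ₂})
    (hb : Bornology.IsBounded (connectedComponentIn (trace 1 c)ᶜ x)) :
    IsLoop (trace 1 c) (connectedComponentIn (trace 1 c)ᶜ x) ∧
      Metric.ball x ρ₁ ⊆ connectedComponentIn (trace 1 c)ᶜ x := by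
  have hball : Metric.ball x ρ₁ ⊆ (trace 1 c)ᶜ := fun z hz hz' => by
    have := (htr hz').1
    rw [Metric.mem_ball] at hz
    linarith
  have hx : x ∈ (trace 1 c)ᶜ := hball (Metric.mem_ball_self hρ)
  have hcl := (isCompact_trace 1 c).isClosed
  refine ⟨⟨?_, hcl.isOpen_compl.connectedComponentIn, isPreconnected_connectedComponentIn, ?_, ?_,
    hb, ⟨x, mem_connectedComponentIn hx⟩⟩, ?_⟩
  · have := isPreconnected_insert_trace 1 c
    rwa [insert_trace_eq hc.not_nil] at this
  · intro z hz
    by_cases h : z ∈ trace 1 c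
    · exact Or.inr h
    · left
      have hmax := (isPreconnected_connectedComponentIn (F := (trace 1 c)ᶜ) (x := x)).subset_closure
        (t := insert z (connectedComponentIn (trace 1 c)ᶜ x)) (Set.subset_insert _ _)
        (Set.insert_subset hz subset_closure)
      exact hmax.subset_connectedComponentIn (Set.mem_insert_of_mem _ (mem_connectedComponentIn hx))
        (Set.insert_subset h (connectedComponentIn_subset _ _)) (Set.mem_insert _ _)
  · exact Set.disjoint_left.2 fun z hz => connectedComponentIn_subset _ _ hz
  · exact (convex_ball x ρ₁).isPreconnected.subset_connectedComponentIn
      (Metric.mem_ball_self hρ) hball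

/-- An open circuit blocks the dual paths of closed bonds. -/
theorem shielded_of_openCircuit {ω : Config} {ρ₁ ρ₂ : ℝ} {l m : ℤ} (hl : 2 * (l : ℝ) ≤ ρ₁)
    (hl0 : 0 < l) (hm : ρ₂ ≤ m) (hω : ω ∈ openCircuit 1 0 ρ₁ ρ₂) :
    Shielded (openGraph ω) l m := by
  obtain ⟨v, c, hc, htr, hb⟩ := hω
  have hl0' : (0 : ℝ) < l := by exact_mod_cast hl0
  have hρ : 0 < ρ₁ := by linarith
  obtain ⟨hloop, hball⟩ := isLoop_of_circuit hρ hc htr hb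
  have hρ₂ : 0 ≤ ρ₂ := by
    obtain ⟨z, hz⟩ := hloop.gamma_nonempty
    have := htr hz
    simp only [Set.mem_ofPred_eq] at this
    linarith
  have hsub := connectedComponentIn_subset_closedBall (γ := trace 1 c) (x := 0) (ρ := ρ₂)
    (fun z hz => (htr hz).2) hρ₂ hb
  set D := connectedComponentIn (trace 1 c)ᶜ (0 : Plane)
  -- To leave the region, a dual step must cross the trace, hence a bond of the circuit; but that
  -- bond is open.
  have hstep : ∀ f g, (closedDual (openGraph ω)).Adj f g → center f ∈ D → center g ∈ D := by
    intro f g hfg hf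
    have hdis : ¬ (segment ℝ (center f) (center g) ∩ trace 1 c).Nonempty := by
      rintro ⟨z, hz, hz'⟩
      rw [mem_trace_one] at hz'
      obtain ⟨x, y, he, hz'⟩ := hz'
      have hadj := c.adj_of_mem_edges he
      have heq := dual_bond_of_segments hfg.1 (openGraph_le ω hadj) hz hz'
      refine hfg.2 ?_
      rw [← SimpleGraph.mem_edgeSet, ← heq]
      exact hadj
    by_contra hg
    exact hdis (hloop.inter_nonempty (convex_segment _ _).isPreconnected
      ⟨_, left_mem_segment ℝ _ _, hf⟩ fun h => hg (h (right_mem_segment ℝ _ _)))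
  rintro g ⟨q, hq, hqg⟩ hg
  -- The coordinates of the center are at most `l - 1/2` in absolute value, so its norm is at most
  -- `2 l - 1 < ρ₁`.
  have hgD : center g ∈ D := by
    refine hball (mem_ball_zero_iff.2 ?_)
    refine lt_of_le_of_lt (norm_le_abs_add_abs _) ?_
    have h1 : |center g 0| ≤ l - 1 / 2 := by
      change |(g.1 : ℝ) + 1 / 2| ≤ _
      have a1 : (-l : ℝ) ≤ g.1 := by exact_mod_cast hg.1.1
      have a2 : (g.1 : ℝ) + 1 ≤ l := by exact_mod_cast hg.1.2
      rw [abs_le]; constructor <;> linarith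
    have h2 : |center g 1| ≤ l - 1 / 2 := by
      change |(g.2 : ℝ) + 1 / 2| ≤ _
      have a1 : (-l : ℝ) ≤ g.2 := by exact_mod_cast hg.2.1
      have a2 : (g.2 : ℝ) + 1 ≤ l := by exact_mod_cast hg.2.2
      rw [abs_le]; constructor <;> linarith
    linarith
  have hqD : center q ∈ D := by
    have key : ∀ k, Relation.ReflTransGen (closedDual (openGraph ω)).Adj g k → center k ∈ D := by
      intro k hk
      induction hk with
      | refl => exact hgD
      | tail _ h2 ih => exact hstep _ _ h2 ih
    exact key q ((SimpleGraph.reachable_iff_reflTransGen _ _).1 hqg.symm)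
  have hq1 := mem_closedBall_zero_iff.1 (hsub hqD)
  have q1 := (abs_apply_le_norm (center q) 0).trans (hq1.trans hm)
  have q2 := (abs_apply_le_norm (center q) 1).trans (hq1.trans hm)
  change |(q.1 : ℝ) + 1 / 2| ≤ _ at q1
  change |(q.2 : ℝ) + 1 / 2| ≤ _ at q2
  rw [abs_le] at q1 q2
  have b1 : -(2 * m) ≤ 2 * q.1 + 1 := by
    have : -(2 * (m : ℝ)) ≤ 2 * q.1 + 1 := by linarith
    exact_mod_cast this
  have b2 : 2 * q.1 + 1 ≤ 2 * m := by
    have : 2 * (q.1 : ℝ) + 1 ≤ 2 * m := by linarith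
    exact_mod_cast this
  have b3 : -(2 * m) ≤ 2 * q.2 + 1 := by
    have : -(2 * (m : ℝ)) ≤ 2 * q.2 + 1 := by linarith
    exact_mod_cast this
  have b4 : 2 * q.2 + 1 ≤ 2 * m := by
    have : 2 * (q.2 : ℝ) + 1 ≤ 2 * m := by linarith
    exact_mod_cast this
  -- By parity, `-2m ≤ 2k + 1 ≤ 2m` means `-m ≤ k < m`, which is the definition of the face box.
  exact hq ⟨⟨by omega, by omega⟩, by omega, by omega⟩

/-- The event depends on the configuration only through the bonds of one circuit; both monotonicity
and locality follow. -/
theorem openCircuit_of_edges {ω ω' : Config} {a : ℝ} {x : Plane} {ρ₁ ρ₂ : ℝ} {v : Site}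
    {c : (openGraph ω).Walk v v} (hc : c.IsCycle)
    (htr : trace a c ⊆ {z | ρ₁ ≤ dist z x ∧ dist z x ≤ ρ₂})
    (hb : Bornology.IsBounded (connectedComponentIn (trace a c)ᶜ x))
    (h : ∀ e ∈ c.edges, e ∈ (openGraph ω').edgeSet) : ω' ∈ openCircuit a x ρ₁ ρ₂ := by
  have e : trace a (c.transfer _ h) = trace a c := by
    ext z
    rw [mem_trace, mem_trace, SimpleGraph.Walk.edges_transfer]
  refine ⟨v, c.transfer _ h, hc.transfer h, ?_, ?_⟩
  · rwa [e]
  · rwa [e]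

theorem openCircuit_isUpperSet (a : ℝ) (x : Plane) (ρ₁ ρ₂ : ℝ) :
    IsUpperSet (openCircuit a x ρ₁ ρ₂) := by
  rintro ω ω' h ⟨v, c, hc, htr, hb⟩
  exact openCircuit_of_edges hc htr hb fun e he =>
    SimpleGraph.edgeSet_mono (openGraph_mono h) (c.edges_subset_edgeSet he)

theorem openCircuit_localIn (ρ₁ ρ₂ : ℝ) : LocalIn (disc ρ₂) (openCircuit 1 0 ρ₁ ρ₂) := by
  rintro ω ω' h ⟨v, c, hc, htr, hb⟩
  refine openCircuit_of_edges hc htr hb fun e he => ?_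
  induction e with
  | _ x y =>
    have hadj := c.adj_of_mem_edges he
    have hmem : ∀ w, toPlane w ∈ segment ℝ (toPlane x) (toPlane y) → w ∈ disc ρ₂ := by
      intro w hw
      have := (htr (mem_trace_one.2 ⟨x, y, he, hw⟩)).2
      rw [mem_disc, edist2]
      have h0 : toPlane 0 = 0 := by ext i; fin_cases i <;> simp [toPlane]
      rwa [h0, ← dist_eq_norm]
    obtain ⟨hl, hω⟩ := hadj
    refine ⟨hl, ?_⟩
    rw [← h _ (mem_bondsIn.2 ⟨⟨hmem x (left_mem_segment ℝ _ _),
      hmem y (right_mem_segment ℝ _ _)⟩, hl⟩)]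
    exact hω

/-- A continuous map carries components into components, and the growth bound `hC` pulls boundedness
back. It serves for dilations and translations. -/
theorem isBounded_component_of_map {S S' : Set Plane} {x : Plane} {f : Plane → Plane}
    (hf : Continuous f) (hS : Set.MapsTo f S S') (hx : x ∈ S) {C K : ℝ}
    (hC : ∀ z, ‖z‖ ≤ C * ‖f z‖ + K) (hC0 : 0 ≤ C)
    (hb : Bornology.IsBounded (connectedComponentIn S' (f x))) :
    Bornology.IsBounded (connectedComponentIn S x) := by
  obtain ⟨M, hM⟩ := isBounded_iff_forall_norm_le.1 hb
  refine isBounded_iff_forall_norm_le.2 ⟨C * M + K, fun z hz => ?_⟩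
  have h1 : f z ∈ connectedComponentIn S' (f x) :=
    (isPreconnected_connectedComponentIn.image f hf.continuousOn).subset_connectedComponentIn
      ⟨x, mem_connectedComponentIn hx, rfl⟩
      (Set.image_subset_iff.2 fun w hw => hS (connectedComponentIn_subset _ _ hw)) ⟨z, hz, rfl⟩
  have := mul_le_mul_of_nonneg_left (hM _ h1) hC0
  linarith [hC z]

theorem openCircuit_rescale {a ρ₁ ρ₂ : ℝ} (ha : 0 < a) (hρ : 0 < ρ₁) :
    openCircuit a 0 ρ₁ ρ₂ ⊆ openCircuit 1 0 (ρ₁ / a) (ρ₂ / a) := by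
  rintro ω ⟨v, c, hc, htr, hb⟩
  have hmap : ∀ z, z ∈ trace 1 c → a • z ∈ trace a c := by
    intro z hz
    rw [mem_trace_one] at hz
    obtain ⟨x, y, he, s, t, hs, ht, hst, rfl⟩ := hz
    exact mem_trace.2 ⟨x, y, he, s, t, hs, ht, hst, by
      rw [smul_add, smul_comm a s, smul_comm a t]⟩
  have hmap' : ∀ z, a • z ∈ trace a c → z ∈ trace 1 c := by
    intro z hz
    rw [mem_trace] at hz
    obtain ⟨x, y, he, s, t, hs, ht, hst, h⟩ := hz
    refine mem_trace_one.2 ⟨x, y, he, s, t, hs, ht, hst, ?_⟩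
    rw [smul_comm s a, smul_comm t a, ← smul_add] at h
    exact smul_right_injective Plane ha.ne' h
  have hn : ∀ z : Plane, ‖a • z‖ = a * ‖z‖ := fun z => by
    rw [norm_smul, Real.norm_of_nonneg ha.le]
  refine ⟨v, c, hc, fun z hz => ?_, ?_⟩
  · have := htr (hmap z hz)
    simp only [Set.mem_ofPred_eq, dist_zero_right, hn] at this ⊢
    rw [div_le_iff₀ ha, le_div_iff₀ ha]
    constructor <;> linarith [mul_comm a ‖z‖]
  · refine isBounded_component_of_map (f := fun z => a • z) (S' := (trace a c)ᶜ) (by fun_prop)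
      (fun z hz hz' => hz (hmap' z hz')) ?_ (C := a⁻¹) (K := 0) (fun z => ?_) (by positivity)
      (by simpa using hb)
    · intro h0
      have := (htr (hmap 0 h0)).1
      simp at this
      linarith
    · rw [hn, add_zero, inv_mul_cancel_left₀ ha.ne']

theorem openCircuit_shift {v : Site} {ρ₁ ρ₂ : ℝ} (hρ : 0 < ρ₁) :
    shift v ⁻¹' openCircuit 1 0 ρ₁ ρ₂ ⊆ openCircuit 1 (toPlane v) ρ₁ ρ₂ := by
  rintro ω ⟨u, c, hc, htr, hb⟩
  let φ : openGraph (shift v ω) →g openGraph ω := ⟨(· + v), fun h => openGraph_shift_adj.1 h⟩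
  have hmem : ∀ z, z ∈ trace 1 (c.map φ) ↔ z - toPlane v ∈ trace 1 c := by
    intro z
    rw [mem_trace_one, mem_trace_one]
    have key : ∀ x y : Site, z ∈ segment ℝ (toPlane (x + v)) (toPlane (y + v)) ↔
        z - toPlane v ∈ segment ℝ (toPlane x) (toPlane y) := by
      intro x y
      rw [toPlane_add, toPlane_add, add_comm _ (toPlane v), add_comm _ (toPlane v),
        ← mem_segment_translate ℝ (toPlane v) (x := z - toPlane v), add_sub_cancel]
    constructor
    · rintro ⟨x, y, he, hz⟩
      rw [SimpleGraph.Walk.edges_map, List.mem_map] at he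
      obtain ⟨e, he, hexy⟩ := he
      induction e with
      | _ x' y' =>
        refine ⟨x', y', he, ?_⟩
        rw [← key]
        change s(x' + v, y' + v) = s(x, y) at hexy
        rcases Sym2.eq_iff.1 hexy with ⟨rfl, rfl⟩ | ⟨rfl, rfl⟩
        · exact hz
        · rwa [segment_symm]
    · rintro ⟨x, y, he, hz⟩
      refine ⟨x + v, y + v, ?_, (key x y).2 hz⟩
      rw [SimpleGraph.Walk.edges_map, List.mem_map]
      exact ⟨_, he, rfl⟩
  refine ⟨u + v, c.map φ, hc.map (add_injective_site v), fun z hz => ?_, ?_⟩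
  · have := htr ((hmem z).1 hz)
    simpa only [Set.mem_ofPred_eq, dist_zero_right, ← dist_eq_norm] using this
  · refine isBounded_component_of_map (f := fun z => z - toPlane v) (S' := (trace 1 c)ᶜ)
      (by fun_prop) (fun z hz hz' => hz ((hmem z).2 hz')) ?_ (C := 1) (K := ‖toPlane v‖)
      (fun z => ?_) zero_le_one (by simpa using hb)
    · intro h0
      have := (htr ((hmem _).1 h0)).1
      simp at this
      linarith
    · have := norm_add_le (z - toPlane v) (toPlane v)
      rw [sub_add_cancel] at this
      linarith

/-! ### Gluing circuits -/

/-- The sites of `[-N, N]²` which are not in `[-M, M]²`. -/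
def squareAnnulus (M N : ℤ) : Set Site :=
  {f | (|f.1| ≤ N ∧ |f.2| ≤ N) ∧ (f.1 < -M ∨ M < f.1 ∨ f.2 < -M ∨ M < f.2)}

theorem squareAnnulus_finite (M N : ℤ) : (squareAnnulus M N).Finite := by
  refine (Set.finite_Icc ((-N, -N) : Site) (N, N)).subset fun f hf => ?_
  have h1 := abs_le.1 hf.1.1
  have h2 := abs_le.1 hf.1.2
  exact ⟨⟨h1.1, h2.1⟩, h1.2, h2.2⟩

theorem norm_toPlane_sub_le (x y : Site) :
    ‖toPlane x - toPlane y‖ ≤ |(x.1 : ℝ) - y.1| + |(x.2 : ℝ) - y.2| :=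
  norm_le_abs_add_abs _

theorem toPlane_origin : toPlane 0 = 0 := by
  ext i; fin_cases i <;> simp [toPlane]

/-- If there is an open circuit around each site of a square annulus of a coarse lattice, then an
open path from the origin which ends in the annulus can be continued to the outside. -/
theorem exists_reachable_far {ω : Config} {Λ : ℝ} {m M N : ℤ} (hm : 0 < m) (hM0 : 0 ≤ M)
    (hΛM : Λ ≤ M) (hMN : M < N)
    (hω : ∀ v : squareAnnulus M N,
      ω ∈ openCircuit 1 (toPlane (m * v.1.1, m * v.1.2)) (2 * m) (Λ * m))
    {y : Site} (hy : (openGraph ω).Reachable 0 y)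
    (hfar : (M + 1) * m ≤ |y.1| ∨ (M + 1) * m ≤ |y.2|) (h1 : |y.1| ≤ N * m)
    (h2 : |y.2| ≤ N * m) :
    ∃ z, (openGraph ω).Reachable 0 z ∧ m * N - 2 * (Λ * m) ≤ ‖toPlane z‖ := by
  classical
  have hm' : (0 : ℝ) < m := by exact_mod_cast hm
  choose u c hc htr hb using hω
  have hloop := fun v => isLoop_of_circuit (by linarith) (hc v) (htr v) (hb v)
  have hsub := fun v : squareAnnulus M N => connectedComponentIn_subset_closedBall
    (γ := trace 1 (c v)) (fun z hz => (htr v hz).2) (by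
      obtain ⟨z, hz⟩ := (hloop v).1.gamma_nonempty
      have := htr v hz
      simp only [Set.mem_ofPred_eq] at this
      linarith) (hb v)
  set D : squareAnnulus M N → Set Plane := fun v =>
    connectedComponentIn (trace 1 (c v))ᶜ (toPlane (m * v.1.1, m * v.1.2)) with hD
  have hfin : Finite (squareAnnulus M N) := (squareAnnulus_finite M N).to_subtype
  -- Among the finitely many regions, replace each by a maximal one containing it, so that strict
  -- nesting is excluded.
  have hmax : ∀ v, ∃ w, D v ⊆ D w ∧ ∀ w', D w ⊆ D w' → D w' ⊆ D w := by
    intro v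
    obtain ⟨b, hvb, ⟨w, rfl⟩, hb⟩ := (Set.finite_range D).exists_le_maximal ⟨v, rfl⟩
    exact ⟨w, hvb, fun w' h => hb ⟨w', rfl⟩ h⟩
  choose top hle htop using hmax
  -- Maximal regions that meet cannot be strictly nested, so their circuits intersect and belong to
  -- one cluster.
  have hcl : ∀ v v', (D v ∩ D v').Nonempty →
      (openGraph ω).Reachable (u (top v)) (u (top v')) := by
    intro v v' hne
    by_cases hdis : Disjoint (trace 1 (c (top v))) (trace 1 (c (top v')))
    · rcases (hloop (top v)).1.ssubset_or_ssubset (hloop (top v')).1 hdis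
        (hne.mono (Set.inter_subset_inter (hle v) (hle v'))) with h | h
      · exact (h.2 (htop v _ h.1)).elim
      · exact (h.2 (htop v' _ h.1)).elim
    · exact reachable_of_traces_meet (Set.not_disjoint_iff_nonempty_inter.1 hdis)
  -- Neighbouring centers are at distance `m < 2 m`, so their regions meet and this cluster is
  -- constant on the annulus. The value off the annulus is irrelevant.
  let h : Site → (openGraph ω).ConnectedComponent := fun v =>
    if hv : v ∈ squareAnnulus M N then (openGraph ω).connectedComponentMk (u (top ⟨v, hv⟩))
    else (openGraph ω).connectedComponentMk 0
  have hstep : ∀ v v' : squareAnnulus M N,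
      |(m : ℝ) * v.1.1 - m * v'.1.1| + |(m : ℝ) * v.1.2 - m * v'.1.2| < 2 * m →
        h v' = h v := by
    intro v v' hvv
    simp only [h, dif_pos v.2, dif_pos v'.2]
    refine SimpleGraph.ConnectedComponent.sound (hcl v' v ⟨toPlane (m * v.1.1, m * v.1.2),
      (hloop v').2 ?_, (hloop v).2 (Metric.mem_ball_self (by linarith))⟩)
    rw [Metric.mem_ball, dist_eq_norm]
    refine lt_of_le_of_lt (norm_toPlane_sub_le _ _) ?_
    simpa using hvv
  have hconst : ∀ v v', v ∈ squareAnnulus M N → v' ∈ squareAnnulus M N → h v = h v' := by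
    intro v v' hv hv'
    refine eq_of_square_annulus h hMN (by omega) (squareAnnulus M N) rfl (by omega)
      (fun x y h1 h2 => ?_) (fun x y h1 h2 => ?_) hv hv'
    · refine hstep ⟨_, h1⟩ ⟨_, h2⟩ ?_
      simp only [Int.cast_add, Int.cast_one, sub_self, abs_zero, add_zero]
      rw [show (m : ℝ) * x - m * (x + 1) = -m by ring, abs_neg, abs_of_pos hm']
      linarith
    · refine hstep ⟨_, h1⟩ ⟨_, h2⟩ ?_
      simp only [Int.cast_add, Int.cast_one, sub_self, abs_zero, zero_add]
      rw [show (m : ℝ) * y - m * (y + 1) = -m by ring, abs_neg, abs_of_pos hm']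
      linarith
  have hdm : ∀ a : ℤ, m * (a / m) ≤ a ∧ a < m * (a / m) + m := fun a =>
    ⟨Int.mul_ediv_self_le hm.ne', Int.lt_mul_ediv_self_add hm⟩
  have hdiv : ∀ a : ℤ, |a| ≤ N * m → |a / m| ≤ N := by
    intro a ha
    obtain ⟨k1, k2⟩ := hdm a
    rw [abs_le] at ha ⊢
    constructor
    · by_contra hlt
      have : a / m + 1 ≤ -N := by omega
      nlinarith
    · by_contra hlt
      have : N + 1 ≤ a / m := by omega
      nlinarith
  have hdiv' : ∀ a : ℤ, (M + 1) * m ≤ |a| → a / m < -M ∨ M < a / m := by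
    intro a ha
    obtain ⟨k1, k2⟩ := hdm a
    by_contra hno
    push Not at hno
    rcases abs_cases a with h | h
    · rw [h.1] at ha; nlinarith
    · rw [h.1] at ha; nlinarith
  have hvJ : (y.1 / m, y.2 / m) ∈ squareAnnulus M N := by
    refine ⟨⟨hdiv _ h1, hdiv _ h2⟩, ?_⟩
    rcases hfar with hf | hf
    · rcases hdiv' _ hf with h | h
      · exact Or.inl h
      · exact Or.inr (Or.inl h)
    · rcases hdiv' _ hf with h | h
      · exact Or.inr (Or.inr (Or.inl h))
      · exact Or.inr (Or.inr (Or.inr h))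
  set v : squareAnnulus M N := ⟨(y.1 / m, y.2 / m), hvJ⟩ with hv
  have hyD : toPlane y ∈ D (top v) := by
    refine hle v ((hloop v).2 ?_)
    rw [Metric.mem_ball, dist_eq_norm]
    refine lt_of_le_of_lt (norm_toPlane_sub_le _ _) ?_
    have key : ∀ a : ℤ, |(a : ℝ) - ((m * (a / m) : ℤ) : ℝ)| < m := by
      intro a
      obtain ⟨k1, k2⟩ := hdm a
      rw [← Int.cast_sub, ← Int.cast_abs, Int.cast_lt, abs_lt]
      constructor <;> omega
    have k1 := key y.1
    have k2 := key y.2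
    simp only [hv]
    linarith
  -- Each center is at distance at least `(M + 1) m > Λ m` from the origin, beyond the radius of its
  -- region.
  have h0D : ∀ w, toPlane 0 ∉ D w := by
    intro w hw
    have hw' := hsub w hw
    rw [Metric.mem_closedBall, dist_eq_norm, toPlane_origin, zero_sub, norm_neg] at hw'
    have hbig : (M : ℝ) + 1 ≤ |(w.1.1 : ℝ)| ∨ (M : ℝ) + 1 ≤ |(w.1.2 : ℝ)| := by
      have : M + 1 ≤ |w.1.1| ∨ M + 1 ≤ |w.1.2| := by
        have := w.2.2
        simp only [le_abs]
        omega
      rcases this with h | h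
      · left; exact_mod_cast h
      · right; exact_mod_cast h
    have hn : ∀ i, |toPlane (m * w.1.1, m * w.1.2) i| ≤ Λ * m := fun i =>
      (abs_apply_le_norm _ i).trans hw'
    have n0 := hn 0
    have n1 := hn 1
    rw [toPlane_zero, Int.cast_mul, abs_mul, abs_of_pos hm'] at n0
    rw [toPlane_one, Int.cast_mul, abs_mul, abs_of_pos hm'] at n1
    rcases hbig with h | h <;> nlinarith
  have hy0 : y ≠ 0 := by
    rintro rfl
    exact h0D _ hyD
  obtain ⟨π⟩ := hy
  have hπ : ¬ π.Nil := fun hnil => hy0 hnil.eq.symm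
  have hconn := isPreconnected_insert_trace 1 π
  rw [one_smul] at hconn
  have hins : insert (toPlane 0) (trace 1 π) = trace 1 π := by
    have := insert_trace_eq (a := 1) hπ
    rwa [one_smul] at this
  have hyπ : toPlane y ∈ insert (toPlane 0) (trace 1 π) := by
    have hrev : ¬ π.reverse.Nil := by
      rwa [SimpleGraph.Walk.nil_reverse]
    have := insert_trace_eq (a := 1) hrev
    rw [one_smul] at this
    have hmem : toPlane y ∈ trace 1 π.reverse := by
      rw [← this]; exact Set.mem_insert _ _
    rw [mem_trace_one] at hmem
    obtain ⟨p, q, he, hz⟩ := hmem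
    rw [SimpleGraph.Walk.edges_reverse, List.mem_reverse] at he
    exact Set.mem_insert_of_mem _ (mem_trace_one.2 ⟨p, q, he, hz⟩)
  -- The path runs from outside the region to a point inside it, so it meets the circuit.
  have hmeet := (hloop (top v)).1.inter_nonempty hconn ⟨_, hyπ, hyD⟩
    fun hs => h0D _ (hs (Set.mem_insert _ _))
  rw [hins] at hmeet
  have hr0 : (openGraph ω).Reachable 0 (u (top v)) := reachable_of_traces_meet hmeet
  have hfJ : ((N, 0) : Site) ∈ squareAnnulus M N := by
    refine ⟨⟨?_, ?_⟩, Or.inr (Or.inl hMN)⟩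
    · rw [abs_of_nonneg (by omega)]
    · simp only [abs_zero]; omega
  set v' : squareAnnulus M N := ⟨(N, 0), hfJ⟩ with hv'
  have hr1 : (openGraph ω).Reachable (u (top v)) (u (top v')) := by
    have := hconst _ _ hvJ hfJ
    simp only [h, dif_pos hvJ, dif_pos hfJ] at this
    exact SimpleGraph.ConnectedComponent.exact this
  refine ⟨_, hr0.trans hr1, ?_⟩
  -- The region chosen for `(N, 0)` contains a point of norm `m N` and has radius at most `Λ m`
  -- about its own center, as has its circuit; hence the loss `2 Λ m`.
  have hin : toPlane (m * N, m * 0) ∈ D (top v') :=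
    hle v' ((hloop v').2 (Metric.mem_ball_self (by linarith)))
  have d1 := hsub _ hin
  have hu : toPlane (u (top v')) ∈ trace 1 (c (top v')) := by
    have := insert_trace_eq (a := 1) (hc (top v')).not_nil
    rw [one_smul] at this
    rw [← this]; exact Set.mem_insert _ _
  have d2 := (htr _ hu).2
  rw [Metric.mem_closedBall] at d1
  have d3 := dist_triangle_right (toPlane (m * N, m * 0)) (toPlane (u (top v')))
    (toPlane (m * (top v').1.1, m * (top v').1.2))
  have d4 : (m : ℝ) * N ≤ ‖toPlane (m * N, m * 0)‖ := by
    refine le_trans ?_ (abs_apply_le_norm _ 0)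
    rw [toPlane_zero, Int.cast_mul]
    exact le_abs_self _
  have d5 : ‖toPlane (m * N, m * 0)‖ ≤
      dist (toPlane (m * N, m * 0)) (toPlane (u (top v'))) + ‖toPlane (u (top v'))‖ := by
    rw [dist_eq_norm]
    exact norm_le_norm_sub_add _ _
  linarith

/-! ### One-arm probabilities -/

theorem mem_disc_iff {r : ℝ} {y : Site} : y ∈ disc r ↔ ‖toPlane y‖ ≤ r := by
  rw [mem_disc, edist2, toPlane_origin, sub_zero]

theorem norm_toPlane_le_of_adj {x y : Site} (h : squareLattice.Adj x y) :
    ‖toPlane y‖ ≤ ‖toPlane x‖ + 1 := by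
  have h1 := norm_toPlane_sub_le y x
  have h2 : |(y.1 : ℝ) - x.1| + |(y.2 : ℝ) - x.2| = 1 := by
    have := h.symm
    simp only [squareLattice] at this
    exact_mod_cast this
  have h3 := norm_le_norm_sub_add (toPlane y) (toPlane x)
  linarith

/-- Before its first exit from `D`, a path from `0` uses only bonds inside `D`, and it leaves
through a boundary site. -/
theorem arm_localIn {D : Finset Site} (h0 : (0 : Site) ∈ D) : LocalIn D (arm D) := by
  rintro ω ω' h ⟨y, hy, hr⟩
  by_contra hno
  have key : ∀ z, Relation.ReflTransGen (openGraph ω).Adj 0 z →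
      z ∈ D ∧ (openGraph ω').Reachable 0 z := by
    intro z hz
    induction hz with
    | refl => exact ⟨h0, SimpleGraph.Reachable.refl 0⟩
    | @tail u v _ h2 ih =>
      obtain ⟨hl, hω⟩ := h2
      have hv : v ∈ D := by
        by_contra hv
        exact hno ⟨u, mem_boundary.2 ⟨ih.1, v, hv, hl⟩, ih.2⟩
      rw [h _ (mem_bondsIn.2 ⟨⟨ih.1, hv⟩, hl⟩)] at hω
      exact ⟨hv, ih.2.trans (SimpleGraph.Adj.reachable ⟨hl, hω⟩)⟩
  exact hno ⟨y, hy, (key y ((SimpleGraph.reachable_iff_reflTransGen _ _).1 hr)).2⟩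

theorem origin_mem_disc {r : ℝ} (hr : 0 ≤ r) : (0 : Site) ∈ disc r := by
  rwa [mem_disc_iff, toPlane_origin, norm_zero]

section

variable {P : Measure Config}

theorem IsCriticalFK.arm_le_wired (hP : IsCriticalFK P) {r : ℝ} (hr : 0 ≤ r) :
    P.real (oneArm r) ≤ (wiredDisc r).real (oneArm r) :=
  hP.le_wired (arm_isUpperSet _) (arm_localIn (origin_mem_disc hr))

/-- The RSW bound, on the unit lattice and uniformly in the scale. -/
theorem RSW.exists_scale (hP : IsCriticalFK P) (hRSW : RSW P) :
    ∃ κ c ρ₀ : ℝ, 1 < κ ∧ 0 < c ∧ 0 < ρ₀ ∧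
      ∀ ρ ≥ ρ₀, c ≤ P.real (openCircuit 1 0 ρ (κ * ρ)) := by
  have := hP.1
  obtain ⟨r₁, r₂, h1, h12, hlim⟩ := hRSW 0
  obtain ⟨c, hc0, hc⟩ := exists_between hlim
  have hev := Filter.eventually_lt_of_lt_liminf hc
  obtain ⟨ε, hε, hsub⟩ := mem_nhdsGT_iff_exists_Ioo_subset.1 hev
  have hε' : (0 : ℝ) < ε := hε
  obtain ⟨a₀, ha₀⟩ : ((Set.Ioo 0 ε : Set ℝ)).Nonempty := Set.nonempty_Ioo.2 hε'
  have hctop : c ≠ ⊤ := ((hsub ha₀).trans_le prob_le_one).ne_top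
  -- Scale `ρ` on the unit lattice is mesh `a = r₁ / ρ`; the factor 2 makes `a < ε` strict.
  refine ⟨r₂ / r₁, c.toReal, 2 * r₁ / ε, by rwa [one_lt_div h1],
    ENNReal.toReal_pos hc0.ne' hctop, by positivity, fun ρ hρ => ?_⟩
  have hρ0 : 0 < ρ := lt_of_lt_of_le (by positivity) hρ
  have ha : r₁ / ρ ∈ Set.Ioo 0 ε := by
    refine ⟨by positivity, ?_⟩
    rw [ge_iff_le, div_le_iff₀ hε'] at hρ
    rw [div_lt_iff₀ hρ0]
    linarith
  have hr := openCircuit_rescale (ρ₂ := r₂) ha.1 h1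
  rw [div_div_cancel₀ h1.ne', div_div_eq_mul_div, mul_div_right_comm] at hr
  have hmem : c < P (openCircuit (r₁ / ρ) 0 r₁ r₂) := hsub ha
  exact ENNReal.toReal_mono (measure_ne_top P _) (hmem.le.trans (measure_mono hr))

/-- The circuit inside the disc makes the wired measure comparable at a smaller scale. -/
theorem IsCriticalFK.arm_ge_wired (hP : IsCriticalFK P) {κ c ρ₀ : ℝ} (hκ : 1 < κ)
    (hcirc : ∀ ρ ≥ ρ₀, c ≤ P.real (openCircuit 1 0 ρ (κ * ρ))) {r : ℝ}
    (hr : 32 * κ ≤ r) (hr' : 4 * κ * ρ₀ ≤ r) :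
    c * (wiredDisc r).real (oneArm r) ≤ P.real (oneArm (r / (16 * κ))) := by
  have := hP.1
  have hκ0 : 0 < κ := by linarith
  -- The outer radius of the annulus is `r / 4`, so the box `[-m, m]²` with `m = ⌈r / 4⌉` stays off
  -- the boundary of the disc; `l = ⌊ρ / 2⌋` fits inside the circuit and exceeds `ρ / 4` as `ρ ≥ 8`.
  set ρ := r / (4 * κ) with hρ
  have hρ8 : 8 ≤ ρ := by rw [hρ, le_div_iff₀ (by positivity)]; linarith
  have hρρ₀ : ρ₀ ≤ ρ := by rw [hρ, le_div_iff₀ (by positivity)]; linarith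
  have hκρ : κ * ρ = r / 4 := by rw [hρ]; field_simp
  have hs : r / (16 * κ) = ρ / 4 := by rw [hρ]; field_simp; norm_num
  have hr32 : 32 < r := by nlinarith
  have hl := Int.floor_le (ρ / 2)
  have hl' := Int.lt_floor_add_one (ρ / 2)
  have hm := Int.le_ceil (κ * ρ)
  have hm' := Int.ceil_lt_add_one (κ * ρ)
  set l := ⌊ρ / 2⌋
  set m := ⌈κ * ρ⌉
  have hl0 : 0 < l := by
    have : (0 : ℝ) < l := by linarith
    exact_mod_cast this
  have hm0 : 0 < m := by
    have : (0 : ℝ) < m := by linarith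
    exact_mod_cast this
  obtain ⟨W, hlim, hWV, hW⟩ := hP.exists_limit
  have hCloc := openCircuit_localIn ρ (κ * ρ)
  have hD' := arm_localIn (origin_mem_disc (r := ρ / 4) (by linarith))
  have hD := arm_localIn (origin_mem_disc (r := r) (by linarith))
  rw [hs]
  refine le_trans (mul_le_mul_of_nonneg_right (hcirc ρ hρρ₀) measureReal_nonneg) ?_
  rw [mul_comm]
  refine le_of_tendsto_of_tendsto ((hlim.tendsto_real hCloc).const_mul _)
    (hlim.tendsto_real hD') ?_
  filter_upwards [hW (disc r), hW (disc (κ * ρ))] with n hn hn'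
  refine fkMeasure_arm_ge (D := disc r) (D' := disc (ρ / 4)) (l := l) (m := m) pC_nonneg pC_lt_one
    hn.1 (hWV n) hn.2 hl0 hm0 ?_ (origin_mem_disc (by linarith)) ?_ hD.measurableSet
    hD'.measurableSet hCloc.measurableSet
    fun ω hω => shielded_of_openCircuit (by linarith) hl0 hm hω
  · intro x h1 h2
    have h1' : |(x.1 : ℝ)| ≤ m := by exact_mod_cast h1
    have h2' : |(x.2 : ℝ)| ≤ m := by exact_mod_cast h2
    have hx : ‖toPlane x‖ ≤ |(x.1 : ℝ)| + |(x.2 : ℝ)| := norm_le_abs_add_abs _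
    refine ⟨mem_disc_iff.2 (by linarith), fun hb => ?_⟩
    obtain ⟨-, y, hy, hxy⟩ := mem_boundary.1 hb
    have := norm_toPlane_le_of_adj hxy
    exact hy (mem_disc_iff.2 (by linarith))
  · intro x hx
    rw [mem_disc_iff] at hx
    have h1 : |(x.1 : ℝ)| ≤ _ := (abs_apply_le_norm (toPlane x) 0).trans hx
    have h2 : |(x.2 : ℝ)| ≤ _ := (abs_apply_le_norm (toPlane x) 1).trans hx
    have h1' : |(x.1 : ℝ)| < l := by linarith
    have h2' : |(x.2 : ℝ)| < l := by linarith
    exact ⟨by exact_mod_cast h1', by exact_mod_cast h2'⟩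

/-- Repeated positive association; locality and monotonicity are carried along the induction. -/
theorem IsCriticalFK.pow_mul_le_inter (hP : IsCriticalFK P) {ι : Type*} (F : Finset ι)
    {V : Finset Site} {A : Set Config} {E : ι → Set Config} {c : ℝ} (hc : 0 ≤ c)
    (hA : IsUpperSet A) (hAV : LocalIn V A) (hE : ∀ i, IsUpperSet (E i))
    (hEV : ∀ i ∈ F, LocalIn V (E i)) (hcE : ∀ i ∈ F, c ≤ P.real (E i)) :
    c ^ F.card * P.real A ≤ P.real (A ∩ ⋂ i ∈ F, E i) := by
  classical
  have := hP.1
  suffices h : LocalIn V (A ∩ ⋂ i ∈ F, E i) ∧ IsUpperSet (A ∩ ⋂ i ∈ F, E i) ∧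
      c ^ F.card * P.real A ≤ P.real (A ∩ ⋂ i ∈ F, E i) from h.2.2
  induction F using Finset.induction_on with
  | empty => simpa using ⟨hAV, hA⟩
  | insert i F hi ih =>
    obtain ⟨h1, h2, h3⟩ := ih (fun j hj => hEV j (Finset.mem_insert_of_mem hj))
      fun j hj => hcE j (Finset.mem_insert_of_mem hj)
    have e : A ∩ ⋂ j ∈ insert i F, E j = E i ∩ (A ∩ ⋂ j ∈ F, E j) := by
      rw [Finset.set_biInter_insert, Set.inter_left_comm]
    rw [e, Finset.card_insert_of_notMem hi, pow_succ']
    have hi' := hEV i (Finset.mem_insert_self i F)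
    refine ⟨hi'.inter h1, (hE i).inter h2, ?_⟩
    refine le_trans ?_ (hP.fkg (hE i) h2 hi' h1)
    rw [mul_assoc]
    exact mul_le_mul (hcE i (Finset.mem_insert_self i F)) h3
      (mul_nonneg (pow_nonneg hc _) measureReal_nonneg) measureReal_nonneg

/-- Open circuits extend an open arm to a larger scale, at the cost of a constant. -/
theorem IsCriticalFK.arm_extend (hP : IsCriticalFK P) {κ c ρ₀ : ℝ} (hκ : 1 < κ) (hc : 0 < c)
    (hcirc : ∀ ρ ≥ ρ₀, c ≤ P.real (openCircuit 1 0 ρ (κ * ρ))) :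
    ∃ c' R : ℝ, 0 < c' ∧ ∀ r ≥ R,
      c' * P.real (oneArm (r / (16 * κ))) ≤ P.real (oneArm r) := by
  have := hP.1
  have hκ0 : 0 < κ := by linarith
  obtain ⟨M, hM⟩ : ∃ M : ℤ, 2 * κ ≤ M := ⟨⌈2 * κ⌉, Int.le_ceil _⟩
  have hM0 : (0 : ℝ) < M := by linarith
  -- Since `r = 16 κ s ≤ 128 (M + 1) κ m`, this choice gives `m N - 4 κ m > r`, where `4 κ m` is the
  -- loss in `exists_reachable_far`. As `M` and `N` depend only on `κ`, so does the number of
  -- circuits.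
  obtain ⟨N, hN⟩ : ∃ N : ℤ, 128 * (M + 1) * κ + 4 * κ + 1 + M ≤ N :=
    ⟨⌈128 * (M + 1) * κ + 4 * κ + 1 + M⌉, Int.le_ceil _⟩
  have hNR : 8 * ((M : ℝ) + 1) ≤ N := by nlinarith
  have hMN : M < N := by
    have : (M : ℝ) < N := by nlinarith
    exact_mod_cast this
  set F := (squareAnnulus_finite M N).toFinset with hF
  refine ⟨c ^ F.card, 16 * κ * (8 * (M + 1) * (1 + |ρ₀|)), pow_pos hc _, fun r hr => ?_⟩
  obtain ⟨s, hs⟩ : ∃ s, s = r / (16 * κ) := ⟨_, rfl⟩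
  have hrs : r = 16 * κ * s := by rw [hs]; field_simp
  have hsR : 8 * (M + 1) * (1 + |ρ₀|) ≤ s := by
    rw [hs, le_div_iff₀ (by positivity)]
    linarith
  have hab := abs_nonneg ρ₀
  have hs8 : 8 * (M + 1) ≤ s := by nlinarith
  -- The coarse mesh is about `s / (4 (M + 1))`: an end point of the arm, at distance about `s`,
  -- then has a coordinate of size at least `(M + 1) m`, while `s ≤ 8 (M + 1) m ≤ N m`.
  obtain ⟨m, hm1, hm2⟩ : ∃ m : ℤ, (m : ℝ) ≤ s / (4 * (M + 1)) ∧ s / (4 * (M + 1)) < m + 1 :=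
    ⟨_, Int.floor_le _, Int.lt_floor_add_one _⟩
  rw [le_div_iff₀ (by positivity)] at hm1
  rw [div_lt_iff₀ (by positivity)] at hm2
  have hm3 : s ≤ 8 * (M + 1) * m := by nlinarith
  have hm0 : (0 : ℝ) < m := by
    by_contra hneg
    nlinarith
  have hmρ : ρ₀ ≤ 2 * m := by
    have h1 : 8 * ((M : ℝ) + 1) * (1 + |ρ₀|) ≤ 8 * (M + 1) * m := hsR.trans hm3
    have h2 := le_of_mul_le_mul_left h1 (by positivity)
    linarith [le_abs_self ρ₀]
  have hm0' : 0 < m := by exact_mod_cast hm0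
  let C : Set Config := openCircuit 1 0 (2 * m) (κ * (2 * m))
  have hC := openCircuit_localIn (2 * m) (κ * (2 * m))
  have hCup := openCircuit_isUpperSet 1 0 (2 * m) (κ * (2 * m))
  let E : Site → Set Config := fun v => shift (m * v.1, m * v.2) ⁻¹' C
  let V : Finset Site := disc s ∪
    F.biUnion fun v => translate (m * v.1, m * v.2) (disc (κ * (2 * m)))
  have hs0 : 0 < s := by linarith
  have hsub : oneArm s ∩ ⋂ v ∈ F, E v ⊆ oneArm r := by
    rintro ω ⟨⟨y, hy, hr0⟩, hω⟩
    have hω' : ∀ v : squareAnnulus M N,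
        ω ∈ openCircuit 1 (toPlane (m * v.1.1, m * v.1.2)) (2 * m) (2 * κ * m) := by
      intro v
      have := Set.mem_iInter₂.1 hω v.1 ((Set.Finite.mem_toFinset _).2 v.2)
      have := openCircuit_shift (by linarith) this
      rwa [show κ * (2 * (m : ℝ)) = 2 * κ * m by ring] at this
    obtain ⟨hyD, y', hy', hyy'⟩ := mem_boundary.1 hy
    rw [mem_disc_iff] at hyD hy'
    have hadj := norm_toPlane_le_of_adj hyy'
    have h12 : ‖toPlane y‖ ≤ |(y.1 : ℝ)| + |(y.2 : ℝ)| := norm_le_abs_add_abs _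
    have h1 : |(y.1 : ℝ)| ≤ _ := (abs_apply_le_norm (toPlane y) 0).trans hyD
    have h2 : |(y.2 : ℝ)| ≤ _ := (abs_apply_le_norm (toPlane y) 1).trans hyD
    have hsN : s ≤ N * m := hm3.trans (mul_le_mul_of_nonneg_right hNR hm0.le)
    have hfar : (M + 1) * m ≤ |y.1| ∨ (M + 1) * m ≤ |y.2| := by
      by_contra hno
      push Not at hno
      have k1 : |(y.1 : ℝ)| < (M + 1) * m := by exact_mod_cast hno.1
      have k2 : |(y.2 : ℝ)| < (M + 1) * m := by exact_mod_cast hno.2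
      nlinarith
    obtain ⟨z, hz, hzr⟩ := exists_reachable_far (Λ := 2 * κ) hm0' (by exact_mod_cast hM0.le) hM hMN
      hω' hr0 hfar (by exact_mod_cast h1.trans hsN) (by exact_mod_cast h2.trans hsN)
    have hr0' : (0 : ℝ) ≤ r := by rw [hrs]; positivity
    refine exists_reachable_boundary (openGraph_le ω) (origin_mem_disc hr0') ?_ hz
    rw [mem_disc_iff, not_le]
    refine lt_of_lt_of_le ?_ hzr
    rw [hrs]
    have k1 := mul_le_mul_of_nonneg_left hN hm0.le
    have k2 := mul_le_mul_of_nonneg_left hm3 hκ0.le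
    nlinarith
  have hmain := hP.pow_mul_le_inter F (V := V) (A := oneArm s) (E := E) hc.le (arm_isUpperSet _)
    ((arm_localIn (origin_mem_disc hs0.le)).mono Finset.subset_union_left)
    (fun v _ _ h hω => hCup (shift_mono _ h) hω)
    (fun v hv => (hC.shift _).mono (Finset.subset_union_right.trans' (Finset.subset_biUnion_of_mem
      (fun v : Site => translate (m * v.1, m * v.2) (disc (κ * (2 * m)))) hv)))
    (fun v _ => (hcirc _ hmρ).trans (hP.le_shift hCup hC _))
  rw [← hs]
  exact hmain.trans (measureReal_mono hsub (measure_ne_top P _))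

end

end IsingFK

end

/-! ### The two-sided comparison of one-arm probabilities. -/

theorem corollary1 (P : MeasureTheory.Measure IsingFK.Config)
    (hP : IsingFK.IsCriticalFK P) (hRSW : IsingFK.RSW P) :
    ∃ c C R : ℝ, 0 < c ∧ 0 < C ∧ ∀ x y : IsingFK.Site, R ≤ IsingFK.edist2 x y →
      c * (IsingFK.wiredDisc (IsingFK.edist2 x y / 3)).real
          (IsingFK.oneArm (IsingFK.edist2 x y / 3)) ≤
        P.real (IsingFK.oneArm (IsingFK.edist2 x y / 3)) ∧
      P.real (IsingFK.oneArm (IsingFK.edist2 x y / 3)) ≤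
        C * (IsingFK.wiredDisc (IsingFK.edist2 x y / 3)).real
          (IsingFK.oneArm (IsingFK.edist2 x y / 3)) := by
  obtain ⟨κ, c, ρ₀, hκ, hc, -, hcirc⟩ := hRSW.exists_scale hP
  obtain ⟨c', R, hc', hext⟩ := hP.arm_extend hκ hc hcirc
  -- The factor `c` pays for descending to scale `r / (16 κ)` and `c'` for extending back to `r`;
  -- the 3 accounts for `r = ‖x - y‖ / 3`.
  refine ⟨c' * c, 1, 3 * max R (max (32 * κ) (4 * κ * ρ₀)), by positivity, one_pos,
    fun x y hxy => ?_⟩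
  have hr : max R (max (32 * κ) (4 * κ * ρ₀)) ≤ IsingFK.edist2 x y / 3 := by linarith
  obtain ⟨h1, h2⟩ := max_le_iff.1 hr
  obtain ⟨h2, h3⟩ := max_le_iff.1 h2
  constructor
  · rw [mul_assoc]
    exact (mul_le_mul_of_nonneg_left (hP.arm_ge_wired hκ hcirc h2 h3) hc'.le).trans (hext _ h1)
  · rw [one_mul]
    exact hP.arm_le_wired (by linarith)
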